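/- Let $n\in\{2,3\}$, $\lambda_0,\Gamma_0\in\mathbb R$, $\Gamma_2>0$, $V\in\mathbb R^n$, and let $M\in\mathbb R^{n\times n}$ be symmetric. *Spaces.* Let $\mathrm M(\mathbb R^n)$ be the space of finite $\mathbb C^n$-valued Radon (Borel) measures on $\mathbb R^n$ with the total variation norm $\|\mu\|_{\mathrm M}=|\mu|(\mathbb R^n)$. Let $\mathrm{FM}(\mathbb R^n)$ be the space of all Fourier transforms $u:\mathbb R^n\to\mathbb C^n$ of such measures. For $u\in \mathrm{FM}(\mathbb R^n)$ let $\hat u\in\mathrm M(\mathbb R^n)$ be the unique measure with $u(x)=(2\pi)^{-n/2}\int_{\mathbb R^n} e^{ix\cdot\xi}\,d\hat u(\xi)$ for all $x$, and put $\|u\|_{\mathrm{FM}}=\|\hat u\|_{\mathrm M}$. Let $\mathrm{FM}_0(\mathbb R^n)=\{u\in \mathrm{FM}(\mathbb R^n):\hat u(\{0\})=0\}$. The Helmholtz projection $P$ maps $u\in\mathrm{FM}_0(\mathbb R^n)$ to the function $Pu$ with $\widehat{Pu}(\mathcal O)=\int_{\mathcal O}\bigl(I-\xi\xi^T/|\xi|^2\bigr)\,d\hat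 u(\xi)$ for all Borel sets $\mathcal O$. Put $\mathrm{FM}_{0,\sigma}(\mathbb R^n)=P\,\mathrm{FM}_0(\mathbb R^n)$, with the norm of $\mathrm{FM}(\mathbb R^n)$, and $\mathrm{FM}^4(\mathbb R^n)=\{u\in\mathrm{FM}(\mathbb R^n):\partial^\alpha u\in\mathrm{FM}(\mathbb R^n)\text{ for }|\alpha|\le4\}$. *Operator.* Define $A_{LF}$ by $$A_{LF}u=\lambda_0(V\cdot\nabla)u+PMu-\Gamma_0\Delta u+\Gamma_2\Delta^2u,\qquad D(A_{LF})=\mathrm{FM}_{0,\sigma}(\mathbb R^n)\cap\mathrm{FM}^4(\mathbb R^n).$$ *$H^\infty$-calculus.* For $\varphi\in(0,\pi)$ let $\Sigma_\varphi=\{z\in\mathbb C\setminus\{0\}:|\arg z|<\varphi\}$. An operator $A$ in a complex Banach space $X$ is sectorial if it is closed, has dense domain and dense range, $(-\infty,0)\subset\rho(A)$ and $\sup_{t>0}\|t(t+A)^{-1}\|<\infty$. Its spectral angle $\varphi_A$ is the infimum of all $\varphi\in(0,\pi)$ with $\Sigma_{\pi-\varphi}\subset\rho(-A)$ and $\sup_{z\in\Sigma_{\pi-\varphi}}\|z(z+A)^{-1}\|<\infty$.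 Let $H_0(\Sigma_\varphi)$ be the set of holomorphic $h$ on $\Sigma_\varphi$ with $|h(z)|\le C\min\{|z|^s,|z|^{-s}\}$ on $\Sigma_\varphi$ for some $C,s>0$. For $h\in H_0(\Sigma_\varphi)$ and $\varphi_A<\theta<\varphi$ put $h(A)=\frac1{2\pi i}\int_{\Gamma}h(z)(z-A)^{-1}\,dz$ with $\Gamma=(\infty,0]e^{i\theta}\cup[0,\infty)e^{-i\theta}$. A sectorial operator $A$ admits a bounded $H^\infty$-calculus if there are $\varphi\in(\varphi_A,\pi)$ and $K<\infty$ with $\|h(A)\|\le K\sup_{\Sigma_\varphi}|h|$ for all $h\in H_0(\Sigma_\varphi)$; the $H^\infty$-angle $\varphi_A^\infty$ is the infimum of all such $\varphi$. **Proposition.** $\mathrm{FM}_{0,\sigma}(\mathbb R^n)$ is a Banach space, $A_{LF}$ is well defined as an operator in $\mathrm{FM}_{0,\sigma}(\mathbb R^n)$ (that is, $A_{LF}u\in\mathrm{FM}_{0,\sigma}(\mathbb R^n)$ for all $u\in D(A_{LF})$), and there exists an $\omega>0$ such that $\omega+A_{LF}$ admits a bounded $H^\infty$-calculus on $\mathrm{FM}_{0,\sigma}(\mathbb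 R^n)$ with $H^\infty$-angle $\varphi^\infty_{\omega+A_{LF}}<\pi/2$. -/

import Mathlib

open MeasureTheory Filter Topology Set
open scoped ENNReal NNReal InnerProductSpace Laplacian

noncomputable section

namespace ActiveFluid

section FunctionalCalculus

variable {X : Type*} [NormedAddCommGroup X] [NormedSpace ℂ X]

/-- The bounded operator `R` is the inverse of `z - A : D(A) → X`. -/
def IsResolventAt (A : X →ₗ.[ℂ] X) (z : ℂ) (R : X →L[ℂ] X) : Prop :=
  (∀ x : X, ∃ h : R x ∈ A.domain, z • R x - A ⟨R x, h⟩ = x) ∧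
    ∀ x : A.domain, R (z • (x : X) - A x) = x

/-- The resolvent set `ρ(A)`. -/
def resolventSet (A : X →ₗ.[ℂ] X) : Set ℂ := {z | ∃ R : X →L[ℂ] X, IsResolventAt A z R}

open Classical in
/-- The resolvent `(z - A)⁻¹` for `z ∈ ρ(A)` (and `0` otherwise). -/
def resolvent (A : X →ₗ.[ℂ] X) (z : ℂ) : X →L[ℂ] X :=
  if h : ∃ R : X →L[ℂ] X, IsResolventAt A z R then h.choose else 0

/-- The open sector `Σ_φ = {z ≠ 0 : |arg z| < φ}`. -/
def sector (φ : ℝ) : Set ℂ := {z | z ≠ 0 ∧ |z.arg| < φ}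

/-- `A` is sectorial: closed, with dense domain and dense range, `(-∞, 0) ⊆ ρ(A)` and
`sup_{t > 0} ‖t (t + A)⁻¹‖ < ∞`. Here `(t + A)⁻¹ = -(-t - A)⁻¹`. -/
structure IsSectorial (A : X →ₗ.[ℂ] X) : Prop where
  isClosed : A.IsClosed
  dense_domain : Dense (A.domain : Set X)
  dense_range : Dense (Set.range fun x : A.domain ↦ A x)
  neg_mem_resolventSet : ∀ t : ℝ, 0 < t → (-t : ℂ) ∈ resolventSet A
  resolvent_bound : ∃ C : ℝ, ∀ t : ℝ, 0 < t → ‖(t : ℂ) • -resolvent A (-t : ℂ)‖ ≤ C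

/-- The spectral angle `φ_A`: the infimum of the `φ ∈ (0, π)` with `Σ_{π-φ} ⊆ ρ(-A)` and
`sup_{z ∈ Σ_{π-φ}} ‖z (z + A)⁻¹‖ < ∞`. -/
def spectralAngle (A : X →ₗ.[ℂ] X) : ℝ :=
  sInf {φ | φ ∈ Ioo 0 Real.pi ∧ (∀ z ∈ sector (Real.pi - φ), -z ∈ resolventSet A) ∧
    ∃ C : ℝ, ∀ z ∈ sector (Real.pi - φ), ‖z • -resolvent A (-z)‖ ≤ C}

/-- `H₀(Σ_φ)`: holomorphic functions on `Σ_φ` decaying polynomially at `0` and at `∞`. -/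
def HZero (φ : ℝ) : Set (ℂ → ℂ) :=
  {f | DifferentiableOn ℂ f (sector φ) ∧ ∃ s > (0 : ℝ), ∃ C : ℝ, ∀ z ∈ sector φ,
    (‖z‖ ≤ 1 → ‖f z‖ ≤ C * ‖z‖ ^ s) ∧ (1 ≤ ‖z‖ → ‖f z‖ ≤ C * ‖z‖ ^ (-s))}

/-- The Dunford integral `f(A) = (2πi)⁻¹ ∫_Γ f(z) (z - A)⁻¹ dz` along
`Γ = (∞, 0] e^{iθ} ∪ [0, ∞) e^{-iθ}`. -/
def dunford (A : X →ₗ.[ℂ] X) (f : ℂ → ℂ) (θ : ℝ) : X →L[ℂ] X :=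
  (2 * Real.pi * Complex.I)⁻¹ •
    ((∫ r in Ioi (0 : ℝ), (f (r * Complex.exp (-(θ * Complex.I))) *
        Complex.exp (-(θ * Complex.I))) • resolvent A (r * Complex.exp (-(θ * Complex.I)))) -
      ∫ r in Ioi (0 : ℝ), (f (r * Complex.exp (θ * Complex.I)) *
        Complex.exp (θ * Complex.I)) • resolvent A (r * Complex.exp (θ * Complex.I)))

/-- The estimate `‖f(A)‖ ≤ K sup_{Σ_φ} |f|` for all `f ∈ H₀(Σ_φ)`, where the contour of the Dunford
integral has an angle `θ ∈ (φ_A, φ)`. -/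
def HInftyEstimate (A : X →ₗ.[ℂ] X) (φ : ℝ) : Prop :=
  ∃ K : ℝ, ∀ f ∈ HZero φ, ∀ θ ∈ Ioo (spectralAngle A) φ,
    ‖dunford A f θ‖ ≤ K * ⨆ z : sector φ, ‖f z‖

/-- `A` admits a bounded `H^∞`-calculus: it is sectorial and the estimate holds for some angle
`φ ∈ (φ_A, π)`. -/
def HasBoundedHInftyCalculus (A : X →ₗ.[ℂ] X) : Prop :=
  IsSectorial A ∧ ∃ φ ∈ Ioo (spectralAngle A) Real.pi, HInftyEstimate A φ

/-- The `H^∞`-angle `φ_A^∞`: the infimum of the angles `φ ∈ (φ_A, π)` for which the estimate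
holds. -/
def hInftyAngle (A : X →ₗ.[ℂ] X) : ℝ :=
  sInf {φ | φ ∈ Ioo (spectralAngle A) Real.pi ∧ HInftyEstimate A φ}

/-- The operator `ω + A`, with the domain of `A`. -/
def shift (ω : ℂ) (A : X →ₗ.[ℂ] X) : X →ₗ.[ℂ] X where
  domain := A.domain
  toFun := ω • A.domain.subtype + A.toFun

theorem IsResolventAt.unique {A : X →ₗ.[ℂ] X} {z : ℂ} {R S : X →L[ℂ] X}
    (hR : IsResolventAt A z R) (hS : IsResolventAt A z S) : R = S := by
  ext x
  obtain ⟨h, hx⟩ := hS.1 x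
  have := hR.2 ⟨S x, h⟩
  rwa [hx] at this

end FunctionalCalculus

section FourierMeasures

/-- Compatibility of the integral against a vector measure with continuous linear maps acting on
the integrand, on the measure and on the values. -/
theorem integral_mapRange_comp {X E E' F F' G G' : Type*} [MeasurableSpace X]
    [NormedAddCommGroup E] [NormedSpace ℝ E] [NormedAddCommGroup E'] [NormedSpace ℝ E']
    [NormedAddCommGroup F] [NormedSpace ℝ F] [NormedAddCommGroup F'] [NormedSpace ℝ F']
    [NormedAddCommGroup G] [NormedSpace ℝ G] [NormedAddCommGroup G'] [NormedSpace ℝ G']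
    [CompleteSpace G] [CompleteSpace G']
    (μ : VectorMeasure X F) [IsFiniteMeasure μ.variation] (ν : VectorMeasure X F')
    [IsFiniteMeasure ν.variation]
    (B : E →L[ℝ] F →L[ℝ] G) (B' : E' →L[ℝ] F' →L[ℝ] G')
    (T : E →L[ℝ] E') (L : F →L[ℝ] F') (R : G →L[ℝ] G')
    (hν : ∀ s, MeasurableSet s → ν s = L (μ s))
    (h : ∀ x y, B' (T x) (L y) = R (B x y)) {f : X → E} (hf : μ.Integrable f) :
    VectorMeasure.integral ν (fun x ↦ T (f x)) B' = R (VectorMeasure.integral μ f B) := by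
  have hle : ν.variation ≤ ‖L‖₊ • μ.variation := by
    apply VectorMeasure.variation_le_of_forall_enorm_le (fun s hs ↦ ?_)
    rw [hν s hs]
    grw [ContinuousLinearMap.le_opENorm, VectorMeasure.enorm_measure_le_variation]
    exact le_of_eq rfl
  have hle' : ν.variation ≤ (‖L‖₊ : ℝ≥0∞) • μ.variation := hle
  have hint : ∀ {g : X → E}, μ.Integrable g → ν.Integrable (fun x ↦ T (g x)) := by
    intro g hg
    exact (T.integrable_comp hg).of_measure_le_smul (by simp) hle'
  have hdom : DominatedFinMeasAdditive μ.variation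
      (fun s ↦ (ν.transpose B' s)) (‖B'‖ * ‖L‖) := by
    refine ⟨fun s t hs ht _ _ hd ↦ cbmApplyMeasure_union ν B' hs ht hd, fun s hs hsf ↦ ?_⟩
    refine (norm_cbmApplyMeasure_le ν B' s).trans ?_
    rw [hν s hs, mul_assoc]
    gcongr
    refine (L.le_opNorm _).trans ?_
    gcongr
    exact VectorMeasure.norm_measure_le_variation hsf.ne
  have hcongr : ∀ {g : X → E'}, Integrable g μ.variation →
      VectorMeasure.integral ν g B' = setToFun μ.variation _ hdom g := by
    intro g hg
    rw [VectorMeasure.integral_eq_setToFun]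
    exact setToFun_congr_measure_of_integrable (‖L‖₊ : ℝ≥0∞) (by simp) hle'
      hdom (dominatedFinMeasAdditive_cbmApplyMeasure ν B') g hg |>.symm
  refine Integrable.induction (P := fun f ↦ VectorMeasure.integral ν (fun x ↦ T (f x)) B' =
    R (VectorMeasure.integral μ f B)) ?_ ?_ ?_ ?_ hf
  · intro c s hs hs'
    have : (fun x ↦ T (s.indicator (fun _ ↦ c) x)) = s.indicator (fun _ ↦ T c) := by
      ext x; by_cases hx : x ∈ s <;> simp [hx]
    rw [this, VectorMeasure.integral_indicator hs, VectorMeasure.integral_indicator hs,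
      VectorMeasure.integral_const, VectorMeasure.integral_const]
    simp [VectorMeasure.restrict_apply, hs, hν s hs, h]
  · intro f g hd hf hg h1 h2
    simp only [Pi.add_apply, map_add]
    rw [VectorMeasure.integral_fun_add (hint hf) (hint hg), h1, h2, ← map_add]
    congr 1
    exact (VectorMeasure.integral_fun_add hf hg).symm
  · have e : ∀ f : X →₁[μ.variation] E, VectorMeasure.integral ν (fun x ↦ T (f x)) B' =
        setToFun μ.variation _ hdom (T.compLp f) := by
      intro f
      rw [hcongr (T.integrable_comp (L1.integrable_coeFn f))]
      exact setToFun_congr_ae _ (EventuallyEq.symm (T.coeFn_compLp f))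
    simp only [e]
    refine isClosed_eq ?_ ?_
    · have := continuous_setToFun hdom
      exact this.comp (T.compLpL 1 μ.variation).continuous
    · exact R.continuous.comp VectorMeasure.continuous_integral
  · intro f g hfg hf h1
    rw [← VectorMeasure.integral_congr_ae hfg, ← h1]
    apply VectorMeasure.integral_congr_ae
    have : ν.variation ≪ μ.variation := Measure.absolutelyContinuous_of_le_smul hle'
    filter_upwards [this.ae_le hfg] with x hx
    rw [hx]

/-- `ℝⁿ` with its Euclidean norm. -/
abbrev Rn (n : ℕ) := EuclideanSpace ℝ (Fin n)

/-- `ℂⁿ` with its Euclidean norm. -/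
abbrev Cn (n : ℕ) := EuclideanSpace ℂ (Fin n)

/-- `M(ℝⁿ)`: the finite `ℂⁿ`-valued Radon measures, i.e. the Borel vector measures of finite
total variation (their variation is then a finite Borel measure on `ℝⁿ`, hence regular). -/
def RadonMeasures (n : ℕ) : Submodule ℂ (VectorMeasure (Rn n) (Cn n)) where
  carrier := {μ | μ.variation univ < ∞}
  add_mem' {μ ν} hμ hν := by
    have := VectorMeasure.variation_add_le (μ := μ) (ν := ν) univ
    exact this.trans_lt (ENNReal.add_lt_top.2 ⟨hμ, hν⟩)
  zero_mem' := by simp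
  smul_mem' c μ hμ := by
    change (c • μ).variation univ < ∞
    rw [VectorMeasure.variation_smul, Measure.smul_apply, ENNReal.smul_def, smul_eq_mul]
    exact ENNReal.mul_lt_top (by simp) hμ

instance (n : ℕ) (μ : RadonMeasures n) : IsFiniteMeasure μ.1.variation := ⟨μ.2⟩

/-- The total variation norm `‖μ‖_M = |μ|(ℝⁿ)`. -/
instance (n : ℕ) : Norm (RadonMeasures n) := ⟨fun μ ↦ (μ.1.variation univ).toReal⟩

theorem RadonMeasures.norm_def {n : ℕ} (μ : RadonMeasures n) :
    ‖μ‖ = (μ.1.variation univ).toReal := rfl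

theorem RadonMeasures.normCore (n : ℕ) : NormedSpace.Core ℂ (RadonMeasures n) where
  norm_nonneg μ := ENNReal.toReal_nonneg
  norm_smul c μ := by
    have : (c • μ).1.variation = ‖c‖₊ • μ.1.variation := VectorMeasure.variation_smul
    rw [RadonMeasures.norm_def, this, Measure.smul_apply, ENNReal.smul_def, smul_eq_mul]
    simp [RadonMeasures.norm_def]
  norm_triangle μ ν := by
    rw [RadonMeasures.norm_def, RadonMeasures.norm_def, RadonMeasures.norm_def,
      ← ENNReal.toReal_add (ne_of_lt μ.2) (ne_of_lt ν.2)]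
    exact ENNReal.toReal_mono (ENNReal.add_ne_top.2 ⟨ne_of_lt μ.2, ne_of_lt ν.2⟩)
      (VectorMeasure.variation_add_le (μ := μ.1) (ν := ν.1) univ)
  norm_eq_zero_iff μ := by
    rw [RadonMeasures.norm_def, ENNReal.toReal_eq_zero_iff]
    have : μ.1.variation univ ≠ ∞ := ne_of_lt μ.2
    simp [this]

instance (n : ℕ) : NormedAddCommGroup (RadonMeasures n) :=
  NormedAddCommGroup.ofCore (RadonMeasures.normCore n)

instance (n : ℕ) : NormedSpace ℂ (RadonMeasures n) :=
  NormedSpace.ofCore (RadonMeasures.normCore n)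

/-- The kernel `ξ ↦ (2π)^{-n/2} e^{i x·ξ}` of the inverse Fourier transform. -/
def kernel {n : ℕ} (x ξ : Rn n) : ℂ :=
  (((2 * Real.pi) ^ (-(n : ℝ) / 2) : ℝ) : ℂ) * Complex.exp (Complex.I * (⟪x, ξ⟫_ℝ : ℝ))

theorem continuous_kernel {n : ℕ} (x : Rn n) : Continuous (kernel x) := by
  unfold kernel; fun_prop

theorem integrable_kernel {n : ℕ} (μ : RadonMeasures n) (x : Rn n) :
    μ.1.Integrable (kernel x) := by
  refine Integrable.of_bound (continuous_kernel x).aestronglyMeasurable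
    |(2 * Real.pi) ^ (-(n : ℝ) / 2)| (ae_of_all _ fun ξ ↦ ?_)
  rw [kernel, norm_mul, mul_comm Complex.I, Complex.norm_exp_ofReal_mul_I, mul_one,
    Complex.norm_real, Real.norm_eq_abs]

/-- The inverse Fourier transform of finite measures,
`(𝓕⁻¹ μ)(x) = (2π)^{-n/2} ∫ e^{i x·ξ} dμ(ξ)`. -/
def fourierInv (n : ℕ) : RadonMeasures n →ₗ[ℂ] (Rn n → Cn n) where
  toFun μ x := VectorMeasure.integral μ.1 (kernel x) (ContinuousLinearMap.lsmul ℝ ℂ)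
  map_add' μ ν := by
    ext1 x
    exact VectorMeasure.integral_add_vectorMeasure (integrable_kernel μ x) (integrable_kernel ν x)
  map_smul' c μ := by
    ext1 x
    have := integral_mapRange_comp μ.1 (c • μ).1 (ContinuousLinearMap.lsmul ℝ ℂ)
      (ContinuousLinearMap.lsmul ℝ ℂ) (ContinuousLinearMap.id ℝ ℂ)
      (c • ContinuousLinearMap.id ℝ (Cn n)) (c • ContinuousLinearMap.id ℝ (Cn n))
      (fun s hs ↦ rfl) (fun z y ↦ smul_comm z c y) (integrable_kernel μ x)
    exact this

/-- The Fourier transform of finite measures,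
`(𝓕 μ)(x) = (2π)^{-n/2} ∫ e^{-i x·ξ} dμ(ξ)`. -/
def fourier (n : ℕ) (μ : RadonMeasures n) (x : Rn n) : Cn n :=
  VectorMeasure.integral μ.1 (kernel (-x)) (ContinuousLinearMap.lsmul ℝ ℂ)

/-- `𝓕⁻¹ M(ℝⁿ) = 𝓕 M(ℝⁿ)`, by reflection. -/
theorem range_fourier (n : ℕ) :
    Set.range (fourier n) = (LinearMap.range (fourierInv n) : Set (Rn n → Cn n)) := by
  have hm : MeasurableEmbedding (fun ξ : Rn n ↦ -ξ) := (MeasurableEquiv.neg (Rn n)).measurableEmbedding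
  let r : RadonMeasures n → RadonMeasures n := fun μ ↦ ⟨μ.1.map (fun ξ ↦ -ξ), by
    change (μ.1.map (fun ξ ↦ -ξ)).variation univ < ∞
    rw [hm.variation_map, hm.map_apply]
    exact μ.2⟩
  have hk : ∀ (x ξ : Rn n), kernel x (-ξ) = kernel (-x) ξ := fun x ξ ↦ by simp [kernel]
  have h1 : ∀ μ, fourierInv n (r μ) = fourier n μ := by
    intro μ; ext1 x
    change VectorMeasure.integral (μ.1.map (fun ξ ↦ -ξ)) _ _ = _
    rw [hm.integral_map_vectorMeasure]
    simp [fourier, hk]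
  have h2 : ∀ μ, fourier n (r μ) = fourierInv n μ := by
    intro μ; ext1 x
    change VectorMeasure.integral (μ.1.map (fun ξ ↦ -ξ)) _ _ = _
    rw [hm.integral_map_vectorMeasure]
    simp [fourierInv, hk]
  ext u
  constructor
  · rintro ⟨μ, rfl⟩
    exact ⟨r μ, h1 μ⟩
  · rintro ⟨μ, rfl⟩
    exact ⟨r μ, h2 μ⟩

theorem signedMeasure_eq_zero {n : ℕ} (s : SignedMeasure (Rn n))
    (hc : ∀ x : Rn n, VectorMeasure.integral s (fun ξ ↦ Real.cos ⟪x, ξ⟫_ℝ)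
      (ContinuousLinearMap.lsmul ℝ ℝ).flip = 0)
    (hs : ∀ x : Rn n, VectorMeasure.integral s (fun ξ ↦ Real.sin ⟪x, ξ⟫_ℝ)
      (ContinuousLinearMap.lsmul ℝ ℝ).flip = 0) : s = 0 := by
  set j := s.toJordanDecomposition
  have hj : s = j.posPart.toSignedMeasure - j.negPart.toSignedMeasure :=
    (s.toSignedMeasure_toJordanDecomposition).symm
  have key : ∀ f : Rn n → ℝ, Continuous f → (∀ ξ, ‖f ξ‖ ≤ 1) →
      VectorMeasure.integral s f (ContinuousLinearMap.lsmul ℝ ℝ).flip = 0 →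
      ∫ ξ, f ξ ∂j.posPart = ∫ ξ, f ξ ∂j.negPart := by
    intro f hf hb h0
    rw [hj, VectorMeasure.integral_sub_vectorMeasure,
      VectorMeasure.integral_toSignedMeasure, VectorMeasure.integral_toSignedMeasure,
      sub_eq_zero] at h0
    · exact h0
    · simp only [VectorMeasure.Integrable, Measure.variation_toSignedMeasure]
      exact Integrable.of_bound hf.aestronglyMeasurable 1 (ae_of_all _ hb)
    · simp only [VectorMeasure.Integrable, Measure.variation_toSignedMeasure]
      exact Integrable.of_bound hf.aestronglyMeasurable 1 (ae_of_all _ hb)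
  have hcf : ∀ (p : Measure (Rn n)) [IsFiniteMeasure p] (x : Rn n), charFun p x =
      ((∫ ξ, Real.cos ⟪x, ξ⟫_ℝ ∂p : ℝ) : ℂ) + ((∫ ξ, Real.sin ⟪x, ξ⟫_ℝ ∂p : ℝ) : ℂ) * Complex.I := by
    intro p _ x
    have i1 : Integrable (fun ξ ↦ Real.cos ⟪x, ξ⟫_ℝ) p :=
      Integrable.of_bound (by fun_prop) 1 (ae_of_all _ fun ξ ↦ Real.abs_cos_le_one _)
    have i2 : Integrable (fun ξ ↦ Real.sin ⟪x, ξ⟫_ℝ) p :=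
      Integrable.of_bound (by fun_prop) 1 (ae_of_all _ fun ξ ↦ Real.abs_sin_le_one _)
    rw [charFun_apply, ← integral_complex_ofReal, ← integral_complex_ofReal,
      ← integral_mul_const, ← integral_add i1.ofReal (i2.ofReal.mul_const _)]
    congr 1
    ext ξ
    rw [Complex.exp_mul_I, real_inner_comm]
    simp
  have : j.posPart = j.negPart := by
    apply Measure.ext_of_charFun
    ext1 x
    rw [hcf, hcf, key _ (by fun_prop) (fun ξ ↦ Real.abs_cos_le_one _) (hc x),
      key _ (by fun_prop) (fun ξ ↦ Real.abs_sin_le_one _) (hs x)]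
  rw [hj]
  simp [this]

theorem fourierInv_injective (n : ℕ) : Function.Injective (fourierInv n) := by
  rw [injective_iff_map_eq_zero]
  intro μ h0
  have hx : ∀ x, VectorMeasure.integral μ.1 (kernel x) (ContinuousLinearMap.lsmul ℝ ℂ) = 0 :=
    fun x ↦ congrFun h0 x
  set K : ℝ := (2 * Real.pi) ^ (-(n : ℝ) / 2) with hK
  have hKpos : 0 < K := by positivity
  -- real-valued integrands
  have real : ∀ f : Rn n → ℝ, Continuous f → (∀ ξ, ‖f ξ‖ ≤ 1) →
      VectorMeasure.integral μ.1 (fun ξ ↦ (f ξ : ℂ)) (ContinuousLinearMap.lsmul ℝ ℂ) = 0 →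
      ∀ ℓ : Cn n →L[ℝ] ℝ, VectorMeasure.integral
        (μ.1.mapRange ℓ.toLinearMap.toAddMonoidHom ℓ.continuous) f
        (ContinuousLinearMap.lsmul ℝ ℝ).flip = 0 := by
    intro f hf hb h ℓ
    have hi : μ.1.Integrable f := Integrable.of_bound hf.aestronglyMeasurable 1 (ae_of_all _ hb)
    have fin : IsFiniteMeasure
        (μ.1.mapRange ℓ.toLinearMap.toAddMonoidHom ℓ.continuous).variation := by
      have := SignedMeasure.totalVariation_eq_variation
        (μ.1.mapRange ℓ.toLinearMap.toAddMonoidHom ℓ.continuous)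
      rw [← this, SignedMeasure.totalVariation]
      infer_instance
    have e1 := integral_mapRange_comp μ.1 μ.1 (ContinuousLinearMap.lsmul ℝ ℝ)
      (ContinuousLinearMap.lsmul ℝ ℂ) Complex.ofRealCLM
      (ContinuousLinearMap.id ℝ (Cn n)) (ContinuousLinearMap.id ℝ (Cn n))
      (fun s hs ↦ rfl) (fun z y ↦ by simp) hi
    have e2 := integral_mapRange_comp μ.1
      (μ.1.mapRange ℓ.toLinearMap.toAddMonoidHom ℓ.continuous) (ContinuousLinearMap.lsmul ℝ ℝ)
      (ContinuousLinearMap.lsmul ℝ ℝ).flip (ContinuousLinearMap.id ℝ ℝ) ℓ ℓ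
      (fun s hs ↦ rfl) (fun z y ↦ by simp [mul_comm]) hi
    simp only [Complex.ofRealCLM_apply, ContinuousLinearMap.id_apply] at e1 e2
    rw [e2, ← e1, h, map_zero]
  have hcos : ∀ x : Rn n, VectorMeasure.integral μ.1 (fun ξ ↦ ((Real.cos ⟪x, ξ⟫_ℝ : ℝ) : ℂ))
      (ContinuousLinearMap.lsmul ℝ ℂ) = 0 := by
    intro x
    have := VectorMeasure.integral_fun_add (B := ContinuousLinearMap.lsmul ℝ ℂ)
      (integrable_kernel μ x) (integrable_kernel μ (-x))
    rw [hx, hx, add_zero] at this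
    have e : (fun ξ ↦ kernel x ξ + kernel (-x) ξ) =
        fun ξ ↦ (2 * K) • ((Real.cos ⟪x, ξ⟫_ℝ : ℝ) : ℂ) := by
      ext ξ
      simp only [kernel, ← hK, inner_neg_left, Complex.ofReal_neg, Complex.ofReal_cos,
        Complex.cos, Complex.real_smul]
      push_cast
      ring_nf
    rw [e, VectorMeasure.integral_fun_smul] at this
    exact (smul_eq_zero.1 this).resolve_left (by positivity)
  have hsin : ∀ x : Rn n, VectorMeasure.integral μ.1 (fun ξ ↦ ((Real.sin ⟪x, ξ⟫_ℝ : ℝ) : ℂ))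
      (ContinuousLinearMap.lsmul ℝ ℂ) = 0 := by
    intro x
    have i1 : μ.1.Integrable (fun ξ ↦ ((Real.cos ⟪x, ξ⟫_ℝ : ℝ) : ℂ)) :=
      Integrable.of_bound (by fun_prop) 1
        (ae_of_all _ fun ξ ↦ (Complex.norm_real _).trans_le (Real.abs_cos_le_one _))
    have i2 : μ.1.Integrable (fun ξ ↦ ((Real.sin ⟪x, ξ⟫_ℝ : ℝ) : ℂ)) :=
      Integrable.of_bound (by fun_prop) 1
        (ae_of_all _ fun ξ ↦ (Complex.norm_real _).trans_le (Real.abs_sin_le_one _))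
    have e : kernel x = fun ξ ↦ K • (((Real.cos ⟪x, ξ⟫_ℝ : ℝ) : ℂ) +
        Complex.I * ((Real.sin ⟪x, ξ⟫_ℝ : ℝ) : ℂ)) := by
      ext ξ
      rw [kernel, mul_comm Complex.I, Complex.exp_mul_I]
      simp [← hK, mul_comm Complex.I, mul_add]
    have h1 := hx x
    have i3 : μ.1.Integrable (fun ξ ↦ Complex.I * ((Real.sin ⟪x, ξ⟫_ℝ : ℝ) : ℂ)) :=
      MeasureTheory.Integrable.const_mul i2 _
    rw [e, VectorMeasure.integral_fun_smul, VectorMeasure.integral_fun_add i1 i3, hcos, zero_add]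
      at h1
    have h2 := (smul_eq_zero.1 h1).resolve_left hKpos.ne'
    have e1 := integral_mapRange_comp μ.1 μ.1 (ContinuousLinearMap.lsmul ℝ ℂ)
      (ContinuousLinearMap.lsmul ℝ ℂ) (Complex.I • ContinuousLinearMap.id ℝ ℂ)
      (ContinuousLinearMap.id ℝ (Cn n)) (Complex.I • ContinuousLinearMap.id ℝ (Cn n))
      (fun s hs ↦ rfl) (fun z y ↦ by simp [mul_smul]) i2
    simp only [smul_apply, ContinuousLinearMap.id_apply, smul_eq_mul] at e1
    rw [h2] at e1
    exact (smul_eq_zero.1 e1.symm).resolve_left Complex.I_ne_zero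
  have hℓ : ∀ ℓ : Cn n →L[ℝ] ℝ, μ.1.mapRange ℓ.toLinearMap.toAddMonoidHom ℓ.continuous = 0 := by
    intro ℓ
    apply signedMeasure_eq_zero
    · intro x
      exact real _ (by fun_prop) (fun ξ ↦ Real.abs_cos_le_one _) (hcos x) ℓ
    · intro x
      exact real _ (by fun_prop) (fun ξ ↦ Real.abs_sin_le_one _) (hsin x) ℓ
  ext s hs i
  have h1 := fun ℓ : Cn n →L[ℝ] ℝ ↦ congrArg (fun ν : SignedMeasure (Rn n) ↦ ν s) (hℓ ℓ)
  let p : Cn n →L[ℝ] ℂ := (EuclideanSpace.proj i : Cn n →L[ℂ] ℂ).restrictScalars ℝ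
  have hre := h1 (Complex.reCLM.comp p)
  have him := h1 (Complex.imCLM.comp p)
  exact Complex.ext hre him

/-- `FM(ℝⁿ)`: the functions `u : ℝⁿ → ℂⁿ` that are Fourier transforms of finite measures. -/
def FM (n : ℕ) : Type := LinearMap.range (fourierInv n)

namespace FM

variable {n : ℕ}

instance : AddCommGroup (FM n) := inferInstanceAs (AddCommGroup (LinearMap.range (fourierInv n)))

instance : Module ℂ (FM n) := inferInstanceAs (Module ℂ (LinearMap.range (fourierInv n)))

instance : CoeFun (FM n) (fun _ ↦ Rn n → Cn n) := ⟨fun u ↦ u.1⟩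

/-- The measure `û = 𝓕 u`, i.e. the unique finite measure with `u = 𝓕⁻¹ û`. -/
def hat (n : ℕ) : FM n ≃ₗ[ℂ] RadonMeasures n :=
  (LinearEquiv.ofInjective (fourierInv n) (fourierInv_injective n)).symm

theorem eq_fourierInv_hat (u : FM n) : (u : Rn n → Cn n) = fourierInv n (hat n u) :=
  (congrArg Subtype.val ((hat n).symm_apply_apply u)).symm

/-- `‖u‖_FM = ‖𝓕 u‖_M`. -/
instance : NormedAddCommGroup (FM n) :=
  NormedAddCommGroup.induced (FM n) (RadonMeasures n) (hat n) (hat n).injective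

instance : NormedSpace ℂ (FM n) := NormedSpace.induced ℂ (FM n) (RadonMeasures n) (hat n)

theorem norm_def (u : FM n) : ‖u‖ = ((hat n u).1.variation univ).toReal := rfl

@[ext] theorem ext {u v : FM n} (h : ∀ x, u x = v x) : u = v := Subtype.ext (funext h)

theorem add_apply (u v : FM n) (x : Rn n) : (u + v) x = u x + v x := rfl

theorem smul_apply (c : ℂ) (u : FM n) (x : Rn n) : (c • u) x = c • u x := rfl

end FM

/-- The pairing `(A, v) ↦ A v` of matrices and vectors. -/
def matVec (n : ℕ) : (Cn n →L[ℂ] Cn n) →L[ℝ] Cn n →L[ℝ] Cn n :=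
  ContinuousLinearMap.restrictScalarsL ℂ (Cn n) (Cn n) ℝ ℝ

theorem integrable_of_bounded {n : ℕ} {ψ : Rn n → Cn n →L[ℂ] Cn n} (hψ : StronglyMeasurable ψ)
    (hb : ∃ C, ∀ ξ, ‖ψ ξ‖ ≤ C) (μ : RadonMeasures n) : μ.1.Integrable ψ := by
  obtain ⟨C, hC⟩ := hb
  exact Integrable.of_bound hψ.aestronglyMeasurable C (ae_of_all _ hC)

theorem withDensity_mem {n : ℕ} {ψ : Rn n → Cn n →L[ℂ] Cn n} (hψ : StronglyMeasurable ψ)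
    (hb : ∃ C, ∀ ξ, ‖ψ ξ‖ ≤ C) (μ : RadonMeasures n) :
    μ.1.withDensity ψ (matVec n) ∈ RadonMeasures n := by
  have hi := integrable_of_bounded hψ hb μ
  have h1 : (μ.1.withDensity ψ (matVec n)).variation ≤
      ‖matVec n‖ₑ • μ.1.variation.withDensity fun ξ ↦ ‖ψ ξ‖ₑ := by
    refine VectorMeasure.variation_le_of_forall_enorm_le fun s hs ↦ ?_
    rw [VectorMeasure.withDensity_apply hi, Measure.smul_apply, smul_eq_mul,
      MeasureTheory.withDensity_apply _ hs]
    refine VectorMeasure.enorm_integral_le_lintegral_enorm.trans ?_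
    rw [VectorMeasure.variation_restrict hs]
  refine (h1 univ).trans_lt ?_
  rw [Measure.smul_apply, smul_eq_mul, MeasureTheory.withDensity_apply _ .univ, setLIntegral_univ]
  exact ENNReal.mul_lt_top (by simp) hi.2

theorem withDensity_add {n : ℕ} {ψ : Rn n → Cn n →L[ℂ] Cn n} {μ ν : VectorMeasure (Rn n) (Cn n)}
    (hμ : μ.Integrable ψ) (hν : ν.Integrable ψ) :
    (μ + ν).withDensity ψ (matVec n) = μ.withDensity ψ (matVec n) + ν.withDensity ψ (matVec n) := by
  ext1 s hs
  rw [_root_.add_apply, VectorMeasure.withDensity_apply (hμ.add_vectorMeasure hν),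
    VectorMeasure.withDensity_apply hμ, VectorMeasure.withDensity_apply hν,
    VectorMeasure.restrict_add, VectorMeasure.integral_add_vectorMeasure hμ.restrict hν.restrict]

theorem withDensity_smul {n : ℕ} {ψ : Rn n → Cn n →L[ℂ] Cn n} (c : ℂ)
    {μ : VectorMeasure (Rn n) (Cn n)} [IsFiniteMeasure μ.variation] (hμ : μ.Integrable ψ)
    (hcμ : (c • μ).Integrable ψ) :
    (c • μ).withDensity ψ (matVec n) = c • μ.withDensity ψ (matVec n) := by
  ext1 s hs
  rw [_root_.smul_apply, VectorMeasure.withDensity_apply hcμ, VectorMeasure.withDensity_apply hμ,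
    VectorMeasure.restrict_smul]
  exact integral_mapRange_comp (μ.restrict s) (c • μ.restrict s) (matVec n)
    (matVec n) (ContinuousLinearMap.id ℝ _)
    (c • ContinuousLinearMap.id ℝ (Cn n)) (c • ContinuousLinearMap.id ℝ (Cn n))
    (fun s hs ↦ rfl) (fun z y ↦ z.map_smul c y) hμ.restrict

/-- The measure `μ⌊ψ`, `(μ⌊ψ)(𝒪) = ∫_𝒪 ψ dμ`, for a bounded measurable matrix-valued `ψ`. -/
def RadonMeasures.floor {n : ℕ} (ψ : Rn n → Cn n →L[ℂ] Cn n) (hψ : StronglyMeasurable ψ)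
    (hb : ∃ C, ∀ ξ, ‖ψ ξ‖ ≤ C) : RadonMeasures n →ₗ[ℂ] RadonMeasures n where
  toFun μ := ⟨μ.1.withDensity ψ (matVec n), withDensity_mem hψ hb μ⟩
  map_add' μ ν := Subtype.ext
    (withDensity_add (integrable_of_bounded hψ hb μ) (integrable_of_bounded hψ hb ν))
  map_smul' c μ := Subtype.ext
    (withDensity_smul c (integrable_of_bounded hψ hb μ) (integrable_of_bounded hψ hb (c • μ)))

/-- The symbol `σ_P(ξ) = I - ξ ξᵀ / |ξ|²` of the Helmholtz projection (its value at the origin is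
irrelevant on measures without mass there). -/
def helmholtzSymbol {n : ℕ} (ξ : Rn n) : Cn n →L[ℂ] Cn n :=
  Matrix.toEuclideanCLM (𝕜 := ℂ)
    (1 - Matrix.of fun i j ↦ ((ξ i * ξ j / ‖ξ‖ ^ 2 : ℝ) : ℂ))

theorem stronglyMeasurable_helmholtzSymbol (n : ℕ) :
    StronglyMeasurable (helmholtzSymbol (n := n)) := by
  have hc : Continuous (fun A : Fin n → Fin n → ℂ ↦
      Matrix.toEuclideanCLM (n := Fin n) (𝕜 := ℂ) (Matrix.of A)) :=
    LinearMap.continuous_of_finiteDimensional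
      ((Matrix.toEuclideanCLM (n := Fin n) (𝕜 := ℂ)).toAlgEquiv.toLinearMap ∘ₗ
        (Matrix.ofLinearEquiv ℂ).toLinearMap)
  have hm : Measurable (fun ξ : Rn n ↦ fun i j ↦
      (1 : Matrix (Fin n) (Fin n) ℂ) i j - ((ξ i * ξ j / ‖ξ‖ ^ 2 : ℝ) : ℂ)) := by
    refine measurable_pi_lambda _ fun i ↦ measurable_pi_lambda _ fun j ↦ ?_
    fun_prop
  exact hc.comp_stronglyMeasurable hm.stronglyMeasurable

theorem helmholtzSymbol_bound (n : ℕ) : ∃ C, ∀ ξ : Rn n, ‖helmholtzSymbol ξ‖ ≤ C := by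
  have hc : Continuous (fun A : Matrix (Fin n) (Fin n) ℂ ↦
      Matrix.toEuclideanCLM (𝕜 := ℂ) A) :=
    LinearMap.continuous_of_finiteDimensional
      (Matrix.toEuclideanCLM (n := Fin n) (𝕜 := ℂ)).toAlgEquiv.toLinearMap
  let S : Set (Matrix (Fin n) (Fin n) ℂ) := Set.pi univ fun i ↦ Set.pi univ fun j ↦
    Metric.closedBall 0 2
  have hS : IsCompact S := isCompact_univ_pi fun i ↦ isCompact_univ_pi fun j ↦
    isCompact_closedBall _ _
  obtain ⟨C, hC⟩ := (hS.image hc).isBounded.exists_norm_le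
  refine ⟨C, fun ξ ↦ hC _ ⟨_, ?_, rfl⟩⟩
  intro i _ j _
  rw [mem_closedBall_zero_iff, Matrix.sub_apply, Matrix.of_apply]
  refine (norm_sub_le _ _).trans ?_
  have h1 : ‖(1 : Matrix (Fin n) (Fin n) ℂ) i j‖ ≤ 1 := by
    rw [Matrix.one_apply]; split_ifs <;> simp
  have h2 : ‖((ξ i * ξ j / ‖ξ‖ ^ 2 : ℝ) : ℂ)‖ ≤ 1 := by
    rw [Complex.norm_real, norm_div, norm_mul, norm_pow, norm_norm]
    refine div_le_one_of_le₀ ?_ (by positivity)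
    rw [sq]
    exact mul_le_mul (PiLp.norm_apply_le ξ i) (PiLp.norm_apply_le ξ j) (norm_nonneg _) (norm_nonneg _)
  linarith

/-- The Helmholtz projection `P u = 𝓕⁻¹(û⌊σ_P)`. -/
def helmholtz (n : ℕ) : FM n →ₗ[ℂ] FM n :=
  (FM.hat n).symm.toLinearMap ∘ₗ
    RadonMeasures.floor helmholtzSymbol (stronglyMeasurable_helmholtzSymbol n)
      (helmholtzSymbol_bound n) ∘ₗ (FM.hat n).toLinearMap

/-- `FM₀(ℝⁿ)`: those `u` for which `û` has no point mass at the origin. -/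
def FM0 (n : ℕ) : Submodule ℂ (FM n) where
  carrier := {u | (FM.hat n u).1 {0} = 0}
  add_mem' {u v} hu hv := by
    change (FM.hat n (u + v)).1 {0} = 0
    rw [map_add]
    change (FM.hat n u).1 {0} + (FM.hat n v).1 {0} = 0
    rw [show (FM.hat n u).1 {0} = 0 from hu, show (FM.hat n v).1 {0} = 0 from hv, add_zero]
  zero_mem' := by
    change (FM.hat n 0).1 {0} = 0
    rw [map_zero]; rfl
  smul_mem' c u hu := by
    change (FM.hat n (c • u)).1 {0} = 0
    rw [map_smul]
    change c • (FM.hat n u).1 {0} = 0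
    rw [show (FM.hat n u).1 {0} = 0 from hu, smul_zero]

/-- `FM_{0,σ}(ℝⁿ) = P FM₀(ℝⁿ)`, the solenoidal fields, with the norm of `FM(ℝⁿ)`. -/
def FM0sol (n : ℕ) : Submodule ℂ (FM n) := (FM0 n).map (helmholtz n)

/-- `FMᵏ(ℝⁿ)`: the partial derivatives `∂^α u`, `|α| ≤ k`, belong to `FM(ℝⁿ)`. (Elements of `FM(ℝⁿ)`
are continuous, so it is the same to take distributional or classical derivatives here.) -/
def FMk (n k : ℕ) : Submodule ℂ (FM n) where
  carrier := {u | ContDiff ℝ k u ∧ ∀ j ≤ k, ∀ s : Fin j → Fin n, ∃ w : FM n, ∀ x,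
    w x = iteratedFDeriv ℝ j u x (fun i ↦ EuclideanSpace.single (s i) (1 : ℝ))}
  add_mem' {u v} hu hv := by
    refine ⟨hu.1.add hv.1, fun j hj s ↦ ?_⟩
    obtain ⟨w, hw⟩ := hu.2 j hj s
    obtain ⟨z, hz⟩ := hv.2 j hj s
    refine ⟨w + z, fun x ↦ ?_⟩
    have hj' : (j : WithTop ℕ∞) ≤ k := by exact_mod_cast hj
    change w x + z x = iteratedFDeriv ℝ j (fun x ↦ u x + v x) x _
    rw [fun_iteratedFDeriv_add_apply (hu.1.contDiffAt.of_le hj') (hv.1.contDiffAt.of_le hj'), hw, hz]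
    rfl
  zero_mem' := by
    refine ⟨contDiff_const (c := (0 : Cn n)), fun j hj s ↦ ⟨0, fun x ↦ ?_⟩⟩
    change (0 : Cn n) = iteratedFDeriv ℝ j (0 : Rn n → Cn n) x _
    rw [iteratedFDeriv_zero]
    rfl
  smul_mem' c u hu := by
    refine ⟨hu.1.const_smul c, fun j hj s ↦ ?_⟩
    obtain ⟨w, hw⟩ := hu.2 j hj s
    refine ⟨c • w, fun x ↦ ?_⟩
    have hj' : (j : WithTop ℕ∞) ≤ k := by exact_mod_cast hj
    change c • w x = iteratedFDeriv ℝ j (c • (u : Rn n → Cn n)) x _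
    rw [iteratedFDeriv_const_smul_apply (hu.1.contDiffAt.of_le hj'), hw]
    rfl

/-- A real matrix `M`, acting on `ℂⁿ`. -/
def matCLM {n : ℕ} (M : Matrix (Fin n) (Fin n) ℝ) : Cn n →L[ℂ] Cn n :=
  Matrix.toEuclideanCLM (𝕜 := ℂ) (M.map Complex.ofReal)

theorem mapRange_mem {n : ℕ} (L : Cn n →L[ℂ] Cn n) (μ : RadonMeasures n) :
    μ.1.mapRange L.toLinearMap.toAddMonoidHom L.continuous ∈ RadonMeasures n := by
  have : (μ.1.mapRange L.toLinearMap.toAddMonoidHom L.continuous).variation ≤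
      ‖L‖₊ • μ.1.variation := by
    refine VectorMeasure.variation_le_of_forall_enorm_le fun s hs ↦ ?_
    refine (L.le_opENorm (μ.1 s)).trans ?_
    grw [VectorMeasure.enorm_measure_le_variation]
    exact le_of_eq rfl
  exact (this univ).trans_lt (ENNReal.mul_lt_top (by simp) μ.2)

theorem comp_mem_range {n : ℕ} (L : Cn n →L[ℂ] Cn n) (u : FM n) :
    (fun x ↦ L (u x)) ∈ LinearMap.range (fourierInv n) := by
  refine ⟨⟨_, mapRange_mem L (FM.hat n u)⟩, ?_⟩
  ext1 x
  have : IsFiniteMeasure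
      ((FM.hat n u).1.mapRange L.toLinearMap.toAddMonoidHom L.continuous).variation :=
    ⟨mapRange_mem L (FM.hat n u)⟩
  rw [FM.eq_fourierInv_hat u]
  exact integral_mapRange_comp (FM.hat n u).1
    ((FM.hat n u).1.mapRange L.toLinearMap.toAddMonoidHom L.continuous)
    (ContinuousLinearMap.lsmul ℝ ℂ) (ContinuousLinearMap.lsmul ℝ ℂ) (ContinuousLinearMap.id ℝ ℂ)
    (L.restrictScalars ℝ) (L.restrictScalars ℝ) (fun s hs ↦ rfl)
    (fun z y ↦ (L.map_smul z y).symm) (integrable_kernel _ x)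

/-- The multiplication operator `u ↦ M u`, `(M u)(x) = M (u(x))`. -/
def matMul {n : ℕ} (M : Matrix (Fin n) (Fin n) ℝ) : FM n →ₗ[ℂ] FM n where
  toFun u := ⟨fun x ↦ matCLM M (u x), comp_mem_range (matCLM M) u⟩
  map_add' u v := by
    ext1 x
    exact map_add (matCLM M) (u x) (v x)
  map_smul' c u := by
    ext1 x
    exact map_smul (matCLM M) c (u x)

theorem contDiff_laplacian {n : ℕ} {u : Rn n → Cn n} (hu : ContDiff ℝ 4 u) :
    ContDiff ℝ 2 (Δ u) := by
  rw [InnerProductSpace.laplacian_eq_iteratedFDeriv_stdOrthonormalBasis]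
  refine ContDiff.sum fun i _ ↦ ?_
  have : ContDiff ℝ 2 (iteratedFDeriv ℝ 2 u) := hu.iteratedFDeriv_right (by norm_num)
  exact (ContinuousMultilinearMap.apply ℝ (fun _ : Fin 2 ↦ Rn n) (Cn n) _).contDiff.comp this

/-- The function `λ₀ (V·∇)u + P M u - Γ₀ Δu + Γ₂ Δ²u`. -/
def linExpr {n : ℕ} (lam0 Γ0 Γ2 : ℝ) (V : Rn n) (M : Matrix (Fin n) (Fin n) ℝ) (u : FM n)
    (x : Rn n) : Cn n :=
  lam0 • fderiv ℝ u x V + helmholtz n (matMul M u) x - Γ0 • Δ (u : Rn n → Cn n) x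
    + Γ2 • Δ (Δ (u : Rn n → Cn n)) x

theorem linExpr_add {n : ℕ} (lam0 Γ0 Γ2 : ℝ) (V : Rn n) (M : Matrix (Fin n) (Fin n) ℝ) {u v : FM n}
    (hu : ContDiff ℝ 4 u) (hv : ContDiff ℝ 4 v) (x : Rn n) :
    linExpr lam0 Γ0 Γ2 V M (u + v) x = linExpr lam0 Γ0 Γ2 V M u x + linExpr lam0 Γ0 Γ2 V M v x := by
  have hu2 : ContDiff ℝ 2 u := hu.of_le (by norm_num)
  have hv2 : ContDiff ℝ 2 v := hv.of_le (by norm_num)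
  have hΔ : Δ ((u : Rn n → Cn n) + v) = Δ (u : Rn n → Cn n) + Δ (v : Rn n → Cn n) :=
    funext fun y ↦ (hu2.contDiffAt (x := y)).laplacian_add hv2.contDiffAt
  have hc : ((u + v : FM n) : Rn n → Cn n) = (u : Rn n → Cn n) + v := rfl
  simp only [linExpr, hc, hΔ, map_add, FM.add_apply]
  rw [(contDiff_laplacian hu).contDiffAt.laplacian_add (contDiff_laplacian hv).contDiffAt,
    fderiv_add (hu2.differentiable (by norm_num) x) (hv2.differentiable (by norm_num) x)]
  simp only [Pi.add_apply, _root_.add_apply, smul_add]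
  abel

theorem linExpr_smul {n : ℕ} (lam0 Γ0 Γ2 : ℝ) (V : Rn n) (M : Matrix (Fin n) (Fin n) ℝ) (c : ℂ)
    {u : FM n} (hu : ContDiff ℝ 4 u) (x : Rn n) :
    linExpr lam0 Γ0 Γ2 V M (c • u) x = c • linExpr lam0 Γ0 Γ2 V M u x := by
  have hu2 : ContDiff ℝ 2 u := hu.of_le (by norm_num)
  have hΔ : Δ (c • (u : Rn n → Cn n)) = c • Δ (u : Rn n → Cn n) :=
    funext fun y ↦ InnerProductSpace.laplacian_smul c (hu2.contDiffAt (x := y))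
  have hc : ((c • u : FM n) : Rn n → Cn n) = c • (u : Rn n → Cn n) := rfl
  simp only [linExpr, hc, hΔ, map_smul, FM.smul_apply]
  rw [InnerProductSpace.laplacian_smul c (contDiff_laplacian hu).contDiffAt,
    fderiv_const_smul (hu2.differentiable (by norm_num) x)]
  simp only [Pi.smul_apply, _root_.smul_apply, smul_add, smul_sub, smul_comm c]

/-- The pairs `(u, f)` of fields in `FM_{0,σ}(ℝⁿ)` with `u ∈ FM⁴(ℝⁿ)` and
`f = λ₀ (V·∇)u + P M u - Γ₀ Δu + Γ₂ Δ²u`. -/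
def graphALF (n : ℕ) (lam0 Γ0 Γ2 : ℝ) (V : Rn n) (M : Matrix (Fin n) (Fin n) ℝ) :
    Submodule ℂ (FM0sol n × FM0sol n) where
  carrier := {p | p.1.1 ∈ FMk n 4 ∧ ∀ x, p.2.1 x = linExpr lam0 Γ0 Γ2 V M p.1.1 x}
  add_mem' {p q} hp hq := by
    refine ⟨add_mem hp.1 hq.1, fun x ↦ ?_⟩
    change p.2.1 x + q.2.1 x = linExpr lam0 Γ0 Γ2 V M (p.1.1 + q.1.1) x
    rw [linExpr_add _ _ _ _ _ hp.1.1 hq.1.1, hp.2, hq.2]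
  zero_mem' := by
    refine ⟨zero_mem _, fun x ↦ ?_⟩
    have := linExpr_smul lam0 Γ0 Γ2 V M 0 (u := 0) (zero_mem (FMk n 4)).1 x
    rw [zero_smul, zero_smul] at this
    exact this.symm
  smul_mem' c p hp := by
    refine ⟨Submodule.smul_mem _ c hp.1, fun x ↦ ?_⟩
    change c • p.2.1 x = linExpr lam0 Γ0 Γ2 V M (c • p.1.1) x
    rw [linExpr_smul _ _ _ _ _ _ hp.1.1, hp.2]

/-- The operator `A_LF` in `FM_{0,σ}(ℝⁿ)`,
`A_LF u = λ₀ (V·∇)u + P M u - Γ₀ Δu + Γ₂ Δ²u`, defined for those `u ∈ FM_{0,σ}(ℝⁿ) ∩ FM⁴(ℝⁿ)` for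
which the right-hand side belongs to `FM_{0,σ}(ℝⁿ)`. -/
def ALF (n : ℕ) (lam0 Γ0 Γ2 : ℝ) (V : Rn n) (M : Matrix (Fin n) (Fin n) ℝ) :
    FM0sol n →ₗ.[ℂ] FM0sol n :=
  (graphALF n lam0 Γ0 Γ2 V M).toLinearPMap

theorem graph_ALF (n : ℕ) (lam0 Γ0 Γ2 : ℝ) (V : Rn n) (M : Matrix (Fin n) (Fin n) ℝ) :
    (ALF n lam0 Γ0 Γ2 V M).graph = graphALF n lam0 Γ0 Γ2 V M := by
  refine Submodule.toLinearPMap_graph_eq _ ?_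
  rintro ⟨u, f⟩ ⟨hu, hf⟩ h0
  refine Subtype.ext (FM.ext fun x ↦ ?_)
  have h1 : u = 0 := h0
  have := linExpr_smul lam0 Γ0 Γ2 V M 0 (u := 0) (zero_mem (FMk n 4)).1 x
  rw [zero_smul, zero_smul] at this
  have h2 := hf x
  rw [h1] at h2
  exact h2.trans this

theorem ALF_apply (n : ℕ) (lam0 Γ0 Γ2 : ℝ) (V : Rn n) (M : Matrix (Fin n) (Fin n) ℝ)
    (u : (ALF n lam0 Γ0 Γ2 V M).domain) (x : Rn n) :
    (ALF n lam0 Γ0 Γ2 V M u).1 x = linExpr lam0 Γ0 Γ2 V M u.1.1 x := by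
  have h := (ALF n lam0 Γ0 Γ2 V M).mem_graph u
  rw [graph_ALF] at h
  exact h.2 x

end FourierMeasures

end ActiveFluid

end

open ActiveFluid

/-!
On Fourier transforms, the part `λ₀ (V·∇) - Γ₀ Δ + Γ₂ Δ²` of the operator is the multiplication with
the scalar function `p(ξ) = i λ₀ (V·ξ) + Γ₀ |ξ|² + Γ₂ |ξ|⁴`, and `u ↦ P M u` is a bounded operator
on `FM_{0,σ}(ℝⁿ)`, because `P` and `M` act as multiplication with bounded matrix-valued functions.

*Structure of the space.* By the Radon-Nikodym theorem (`exists_withDensityᵥ_eq`) the transform `û`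
has a density with respect to some finite positive measure `τ`, and `u ↦ û` identifies the fields
with such densities isometrically with `L¹(τ; ℂⁿ)` (`ofL1`). Countably many fields share a `τ`,
which gives the completeness of `FM(ℝⁿ)`. Bounded measurable symbols act on densities pointwise, and
`FM_{0,σ}(ℝⁿ)` is the range of the projection with symbol `solSymbol` (`mem_FM0sol_iff`), hence
closed, and invariant under scalar multipliers.

*Domain.* A derivative in `FM(ℝⁿ)` has the transform `i ξ û` (`density_of_fderiv`), so on `FM⁴(ℝⁿ)`
the differential operator is the multiplication with `p`. Conversely, symbols that decay of order
four map into `FM⁴(ℝⁿ)` (`smult_mem_FMk`).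

*Resolvents.* For large `ω` the values of `q = ω + p` lie in the sector `|arg q| ≤ π / 4`, with
`|q| ≥ Λ` for a given `Λ` (`exists_shift_scalarSymbol`). For `Re z ≤ |z| / 4` the multiplier
`R₀(z) = (z - q)⁻¹` therefore has norm at most `16 / (|z| + Λ)`, and a Neumann series provides the
resolvent `R(z)` of the full operator (`exists_perturbed_resolvent`, `isResolventAt_shift_ALF`).
Moreover `R(z) - R₀(z) = R₀(z) P M R(z)` is of order `|z|⁻²`.

*The `H^∞`-bound.* For `h ∈ H₀` the Dunford integral is taken over the two rays `arg z = ±θ₀`, with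
`θ₀ < π / 2` and `cos θ₀ ≤ 1 / 4`. The multiplier `R'(z) = (z + |q|)⁻¹` is holomorphic for
`Re z > 0`, so by Cauchy's theorem the integral of `h R'` over the contour vanishes, and `R` may be
replaced by `R - R'` (`hasBoundedHInftyCalculus_of_comparison`). At each frequency
`|(z - q)⁻¹ - (z + |q|)⁻¹| ≤ 64 |q| / (|z| + |q|)²`, whose integral over `|z| ∈ (0, ∞)` is `64`
whatever `|q|` is. As the norm of `FM(ℝⁿ)` is an `L¹`-norm, Tonelli's theorem turns this into
`∫ ‖(R₀ - R')(z) x‖ d|z| ≤ 64 ‖x‖` (`lintegral_solMult_sub_le`), and the bound of the calculus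
follows.
-/

noncomputable section

namespace ActiveFluid

/-! ### Contour integrals over rays and pseudo-resolvents -/

section Contour

variable {E : Type*} [NormedAddCommGroup E] [NormedSpace ℂ E]

/-- The integral of `F` along the ray `[0, ∞) e^{iθ}`. -/
def rayIntegral (F : ℂ → E) (θ : ℝ) : E :=
  ∫ r in Ioi (0 : ℝ), Complex.exp (θ * Complex.I) • F (r * Complex.exp (θ * Complex.I))

/-- The integrand of `rayIntegral F θ` is integrable. -/
def RayIntegrable (F : ℂ → E) (θ : ℝ) : Prop :=
  IntegrableOn (fun r : ℝ ↦ Complex.exp (θ * Complex.I) • F (r * Complex.exp (θ * Complex.I)))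
    (Ioi 0)

/-- The closed sector `{z ≠ 0 : a ≤ arg z ≤ b}`, without its vertex. -/
def closedSector (a b : ℝ) : Set ℂ := {z | z ≠ 0 ∧ z.arg ∈ Icc a b}

/-- `F(z) dz` is integrable along rays in `S` with an exponential rate in `log |z|`:
`|z| ‖F z‖ ≤ C min(|z|^s, |z|^{-s})` for some `s > 0`. -/
def HasContourDecay (F : ℂ → E) (S : Set ℂ) : Prop :=
  ∃ s > (0 : ℝ), ∃ C : ℝ, ∀ z ∈ S, ‖z‖ * ‖F z‖ ≤ C * Real.exp (-s * |Real.log ‖z‖|)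

theorem exp_re_add_im_mul_I (x θ : ℝ) :
    Complex.exp (x + θ * Complex.I) = (Real.exp x : ℝ) * Complex.exp (θ * Complex.I) := by
  rw [Complex.exp_add, Complex.ofReal_exp]

theorem rayIntegral_eq_integral_exp (F : ℂ → E) (θ : ℝ) :
    rayIntegral F θ = ∫ x : ℝ, Complex.exp (x + θ * Complex.I) •
      F (Complex.exp (x + θ * Complex.I)) := by
  have := integral_image_eq_integral_abs_deriv_smul (s := univ) (f := Real.exp) (f' := Real.exp)
    MeasurableSet.univ (fun x _ ↦ (Real.hasDerivAt_exp x).hasDerivWithinAt)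
    Real.exp_injective.injOn
    (fun r : ℝ ↦ Complex.exp (θ * Complex.I) • F (r * Complex.exp (θ * Complex.I)))
  rw [image_univ, Real.range_exp, setIntegral_univ] at this
  rw [rayIntegral, this]
  refine integral_congr_ae (ae_of_all _ fun x ↦ ?_)
  simp only [exp_re_add_im_mul_I, abs_of_pos (Real.exp_pos x), mul_smul, Complex.coe_smul]

theorem rayIntegrable_iff_integrable_exp (F : ℂ → E) (θ : ℝ) :
    RayIntegrable F θ ↔ Integrable fun x : ℝ ↦ Complex.exp (x + θ * Complex.I) •
      F (Complex.exp (x + θ * Complex.I)) := by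
  have := integrableOn_image_iff_integrableOn_abs_deriv_smul (s := univ) (f := Real.exp)
    (f' := Real.exp) MeasurableSet.univ (fun x _ ↦ (Real.hasDerivAt_exp x).hasDerivWithinAt)
    Real.exp_injective.injOn
    (fun r : ℝ ↦ Complex.exp (θ * Complex.I) • F (r * Complex.exp (θ * Complex.I)))
  rw [image_univ, Real.range_exp, integrableOn_univ] at this
  rw [RayIntegrable, this]
  refine integrable_congr (ae_of_all _ fun x ↦ ?_)
  simp only [exp_re_add_im_mul_I, abs_of_pos (Real.exp_pos x), mul_smul, Complex.coe_smul]

theorem integrable_exp_neg_mul_abs {s : ℝ} (hs : 0 < s) :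
    Integrable fun x : ℝ ↦ Real.exp (-s * |x|) := by
  rw [← integrableOn_univ, ← Iic_union_Ioi (a := (0 : ℝ)), integrableOn_union]
  constructor
  · refine (integrableOn_exp_mul_Iic hs 0).congr_fun (fun x hx ↦ ?_) measurableSet_Iic
    simp only [abs_of_nonpos (mem_Iic.1 hx)]
    ring_nf
  · refine (integrableOn_exp_mul_Ioi (neg_neg_of_pos hs) 0).congr_fun (fun x hx ↦ ?_)
      measurableSet_Ioi
    simp only [abs_of_pos (mem_Ioi.1 hx)]

/-- Cauchy's theorem on a horizontal strip. -/
theorem integral_horizontal_eq {G : ℂ → E} {a b s C : ℝ} (hab : a ≤ b) (hs : 0 < s)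
    (hG : DifferentiableOn ℂ G {w | w.im ∈ Icc a b})
    (hC : ∀ w : ℂ, w.im ∈ Icc a b → ‖G w‖ ≤ C * Real.exp (-s * |w.re|)) :
    Integrable (fun x : ℝ ↦ G (x + a * Complex.I)) ∧
    ∫ x : ℝ, G (x + a * Complex.I) = ∫ x : ℝ, G (x + b * Complex.I) := by
  have hint : ∀ c ∈ Icc a b, Integrable (fun x : ℝ ↦ G (x + c * Complex.I)) := by
    intro c hc
    refine ((integrable_exp_neg_mul_abs hs).const_mul C).mono' ?_ (ae_of_all _ fun x ↦ ?_)
    · refine Continuous.aestronglyMeasurable ?_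
      exact hG.continuousOn.comp_continuous (by fun_prop) (fun x ↦ by simpa using hc)
    · simpa using hC (x + c * Complex.I) (by simpa using hc)
  refine ⟨hint a ⟨le_rfl, hab⟩, ?_⟩
  have ha := intervalIntegral_tendsto_integral (hint a ⟨le_rfl, hab⟩) tendsto_neg_atTop_atBot
    tendsto_id
  have hb := intervalIntegral_tendsto_integral (hint b ⟨hab, le_rfl⟩) tendsto_neg_atTop_atBot
    tendsto_id
  have hside : ∀ σ : ℝ, |σ| = 1 → Tendsto (fun R : ℝ ↦ Complex.I •
      ∫ y : ℝ in a..b, G ((σ * R : ℝ) + y * Complex.I)) atTop (𝓝 0) := by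
    intro σ hσ
    have h0 : Tendsto (fun R : ℝ ↦ C * Real.exp (-s * R) * |b - a|) atTop (𝓝 0) := by
      have : Tendsto (fun R : ℝ ↦ Real.exp (-s * R)) atTop (𝓝 0) :=
        Real.tendsto_exp_atBot.comp (tendsto_id.const_mul_atTop_of_neg (by linarith))
      simpa using (this.const_mul C).mul_const |b - a|
    refine squeeze_zero_norm' ?_ h0
    filter_upwards [eventually_ge_atTop 0] with R hR
    rw [norm_smul, Complex.norm_I, one_mul]
    refine intervalIntegral.norm_integral_le_of_norm_le_const fun y hy ↦ ?_
    rw [uIoc_of_le hab] at hy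
    have := hC ((σ * R : ℝ) + y * Complex.I) (by simpa using Ioc_subset_Icc_self hy)
    simpa [abs_mul, hσ, abs_of_nonneg hR] using this
  have hrect : ∀ R : ℝ, (∫ x : ℝ in (-R)..R, G (x + a * Complex.I)) -
      (∫ x : ℝ in (-R)..R, G (x + b * Complex.I)) +
      Complex.I • (∫ y : ℝ in a..b, G ((1 * R : ℝ) + y * Complex.I)) -
      Complex.I • (∫ y : ℝ in a..b, G ((-1 * R : ℝ) + y * Complex.I)) = 0 := by
    intro R
    have := Complex.integral_boundary_rect_eq_zero_of_differentiableOn G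
      ⟨-R, a⟩ ⟨R, b⟩ (hG.mono ?_)
    · simpa using this
    · intro w hw
      have := hw.2
      rwa [uIcc_of_le hab] at this
  have hlim := ((ha.sub hb).add (hside 1 (by simp))).sub (hside (-1) (by simp))
  simp only [id] at hlim
  rw [tendsto_congr hrect, tendsto_const_nhds_iff] at hlim
  simpa using sub_eq_zero.1 (by simpa using hlim.symm)

/-- Cauchy's theorem on a sector. -/
theorem rayIntegral_eq_of_differentiableOn {F : ℂ → E} {a b : ℝ} (hab : a ≤ b)
    (ha : -Real.pi < a) (hb : b < Real.pi) (hF : DifferentiableOn ℂ F (closedSector a b))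
    (hd : HasContourDecay F (closedSector a b)) :
    RayIntegrable F a ∧ rayIntegral F a = rayIntegral F b := by
  obtain ⟨s, hs, C, hC⟩ := hd
  have hmem : ∀ w : ℂ, w.im ∈ Icc a b → Complex.exp w ∈ closedSector a b := by
    intro w hw
    refine ⟨Complex.exp_ne_zero w, ?_⟩
    have : (Complex.exp w).arg = w.im := by
      rw [Complex.arg_exp, toIocMod_eq_self]
      constructor <;> linarith [hw.1, hw.2]
    rwa [this]
  rw [rayIntegrable_iff_integrable_exp, rayIntegral_eq_integral_exp, rayIntegral_eq_integral_exp]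
  refine integral_horizontal_eq (G := fun w ↦ Complex.exp w • F (Complex.exp w)) (C := C)
    hab hs ?_ ?_
  · exact Complex.differentiable_exp.differentiableOn.smul
      (hF.comp Complex.differentiable_exp.differentiableOn hmem)
  · intro w hw
    simpa [norm_smul, Complex.norm_exp] using hC _ (hmem w hw)

end Contour

section PseudoResolvent

variable {X : Type*} [NormedAddCommGroup X] [NormedSpace ℂ X]

/-- A family of bounded operators on the open set `U` that satisfies the resolvent identity and
`sup_{z ∈ U} ‖z R(z)‖ < ∞`. As `0 ∉ U`, such a family is locally bounded. -/
structure IsPseudoResolventOn (R : ℂ → X →L[ℂ] X) (U : Set ℂ) : Prop where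
  isOpen : IsOpen U
  zero_notMem : (0 : ℂ) ∉ U
  sub_eq : ∀ z ∈ U, ∀ w ∈ U, R w - R z = (z - w) • (R w * R z)
  bound : ∃ C : ℝ, ∀ z ∈ U, ‖z‖ * ‖R z‖ ≤ C

/-- The resolvent identity gives continuity by the local boundedness of `R`, and then the derivative
`-R(z)²`. -/
theorem IsPseudoResolventOn.differentiableAt {R : ℂ → X →L[ℂ] X} {U : Set ℂ}
    (h : IsPseudoResolventOn R U) {z : ℂ} (hz : z ∈ U) : DifferentiableAt ℂ R z := by
  obtain ⟨C, hC⟩ := h.bound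
  have hz0 : 0 < ‖z‖ := norm_pos_iff.2 fun h0 ↦ h.zero_notMem (h0 ▸ hz)
  have hnear : ∀ᶠ w in 𝓝 z, w ∈ U ∧ ‖z‖ / 2 < ‖w‖ :=
    Filter.Eventually.and (h.isOpen.mem_nhds hz)
      (continuous_norm.continuousAt.eventually_const_lt (by linarith))
  have hcont : Tendsto R (𝓝 z) (𝓝 (R z)) := by
    rw [tendsto_iff_norm_sub_tendsto_zero]
    have h0 : Tendsto (fun w ↦ ‖z - w‖ * (C / (‖z‖ / 2) * ‖R z‖)) (𝓝 z) (𝓝 0) := by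
      have : Tendsto (fun w : ℂ ↦ ‖z - w‖) (𝓝 z) (𝓝 ‖z - z‖) :=
        (continuous_const.sub continuous_id).norm.tendsto z
      simpa using this.mul_const (C / (‖z‖ / 2) * ‖R z‖)
    refine squeeze_zero' (Eventually.of_forall fun _ ↦ norm_nonneg _) ?_ h0
    filter_upwards [hnear] with w hw
    rw [h.sub_eq z hz w hw.1, norm_smul]
    gcongr
    refine (norm_mul_le _ _).trans ?_
    gcongr
    rw [le_div_iff₀ (by linarith)]
    have := hC w hw.1
    nlinarith [hw.2, norm_nonneg (R w)]
  refine (HasDerivAt.differentiableAt (f' := -(R z * R z)) ?_)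
  rw [hasDerivAt_iff_tendsto_slope]
  have : Tendsto (fun w ↦ -(R w * R z)) (𝓝[≠] z) (𝓝 (-(R z * R z))) :=
    ((hcont.mul_const (R z)).neg).mono_left nhdsWithin_le_nhds
  refine this.congr' ?_
  filter_upwards [nhdsWithin_le_nhds hnear, self_mem_nhdsWithin] with w hw hwz
  have hne : w - z ≠ 0 := sub_ne_zero.2 hwz
  rw [slope_def_module, h.sub_eq z hz w hw.1, smul_smul,
    show (w - z)⁻¹ * (z - w) = -1 by field_simp; ring, neg_one_smul]

theorem isOpen_sector {φ : ℝ} (hφ : φ ≤ Real.pi) : IsOpen (sector φ) := by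
  have h : sector φ = Complex.slitPlane ∩ Complex.arg ⁻¹' (Ioo (-φ) φ) := by
    ext z
    simp only [sector, mem_ofPred_eq, mem_inter_iff, mem_preimage, mem_Ioo,
      Complex.mem_slitPlane_iff_arg, abs_lt]
    constructor
    · rintro ⟨h0, h1, h2⟩
      exact ⟨⟨by linarith, h0⟩, h1, h2⟩
    · rintro ⟨⟨-, h0⟩, h1⟩
      exact ⟨h0, h1⟩
  rw [h]
  exact ContinuousOn.isOpen_inter_preimage
    (fun z hz ↦ (Complex.continuousAt_arg hz).continuousWithinAt) Complex.isOpen_slitPlane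
    isOpen_Ioo

/-- The two power bounds in the definition of `H₀(Σ_φ)`, in the variable `log |z|`. -/
theorem HZero.exists_decay {φ : ℝ} {f : ℂ → ℂ} (hf : f ∈ HZero φ) :
    ∃ s > (0 : ℝ), ∃ C ≥ 0, ∀ z ∈ sector φ, ‖f z‖ ≤ C * Real.exp (-s * |Real.log ‖z‖|) := by
  obtain ⟨-, s, hs, C, hC⟩ := hf
  refine ⟨s, hs, |C|, abs_nonneg C, fun z hz ↦ ?_⟩
  have hz0 : 0 < ‖z‖ := norm_pos_iff.2 hz.1
  rcases le_total ‖z‖ 1 with h1 | h1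
  · refine ((hC z hz).1 h1).trans ?_
    rw [abs_of_nonpos (Real.log_nonpos hz0.le h1), Real.rpow_def_of_pos hz0]
    have e : -s * -Real.log ‖z‖ = Real.log ‖z‖ * s := by ring
    rw [e]
    gcongr
    exact le_abs_self C
  · refine ((hC z hz).2 h1).trans ?_
    rw [abs_of_nonneg (Real.log_nonneg h1), Real.rpow_def_of_pos hz0]
    have e : -s * Real.log ‖z‖ = Real.log ‖z‖ * -s := by ring
    rw [e]
    gcongr
    exact le_abs_self C

theorem HZero.bddAbove {φ : ℝ} {f : ℂ → ℂ} (hf : f ∈ HZero φ) :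
    BddAbove (range fun z : sector φ ↦ ‖f z‖) := by
  obtain ⟨s, hs, C, hC0, hC⟩ := HZero.exists_decay hf
  refine ⟨C, ?_⟩
  rintro _ ⟨z, rfl⟩
  refine (hC z z.2).trans (mul_le_of_le_one_right hC0 (Real.exp_le_one_iff.2 ?_))
  nlinarith [abs_nonneg (Real.log ‖(z : ℂ)‖)]

/-- For `f ∈ H₀(Σ_φ)` and a pseudo-resolvent `R` the integral of `f R` along a ray does not change
when the ray is turned within the domain of `f R`. -/
theorem IsPseudoResolventOn.rayIntegral_eq {R : ℂ → X →L[ℂ] X} {U : Set ℂ}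
    (h : IsPseudoResolventOn R U) {φ : ℝ} (hφ : φ ≤ Real.pi) {f : ℂ → ℂ} (hf : f ∈ HZero φ)
    {a b : ℝ} (hab : a ≤ b) (ha : -φ < a) (hb : b < φ) (hU : closedSector a b ⊆ U) :
    RayIntegrable (fun z ↦ f z • R z) a ∧
      rayIntegral (fun z ↦ f z • R z) a = rayIntegral (fun z ↦ f z • R z) b := by
  have hsub : closedSector a b ⊆ sector φ := fun z hz ↦
    ⟨hz.1, abs_lt.2 ⟨ha.trans_le hz.2.1, hz.2.2.trans_lt hb⟩⟩
  refine rayIntegral_eq_of_differentiableOn hab (by linarith) (by linarith) ?_ ?_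
  · exact (hf.1.mono hsub).smul fun z hz ↦ (h.differentiableAt (hU hz)).differentiableWithinAt
  · obtain ⟨s, hs, C, hC0, hC⟩ := HZero.exists_decay hf
    obtain ⟨D, hD⟩ := h.bound
    refine ⟨s, hs, C * D, fun z hz ↦ ?_⟩
    rw [norm_smul]
    calc ‖z‖ * (‖f z‖ * ‖R z‖) = ‖f z‖ * (‖z‖ * ‖R z‖) := by ring
      _ ≤ (C * Real.exp (-s * |Real.log ‖z‖|)) * D := by
        gcongr
        · exact hC z (hsub hz)
        · exact hD z (hU hz)
      _ = C * D * Real.exp (-s * |Real.log ‖z‖|) := by ring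

/-- The comparison estimate for two operator families along a ray, in terms of a strong (not a norm)
integral bound for their difference. -/
theorem norm_rayIntegral_sub_le [CompleteSpace X] {R R' : ℂ → X →L[ℂ] X} {f : ℂ → ℂ} {θ K N : ℝ}
    (hK : 0 ≤ K) (hN : 0 ≤ N)
    (hR : RayIntegrable (fun z ↦ f z • R z) θ) (hR' : RayIntegrable (fun z ↦ f z • R' z) θ)
    (hf : ∀ r : ℝ, 0 < r → ‖f (r * Complex.exp (θ * Complex.I))‖ ≤ N)
    (hKR : ∀ x : X, ∫⁻ r in Ioi (0 : ℝ), ‖(R (r * Complex.exp (θ * Complex.I)) -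
      R' (r * Complex.exp (θ * Complex.I))) x‖ₑ ≤ ENNReal.ofReal (K * ‖x‖)) :
    ‖rayIntegral (fun z ↦ f z • R z) θ - rayIntegral (fun z ↦ f z • R' z) θ‖ ≤ N * K := by
  unfold RayIntegrable at hR hR'
  refine ContinuousLinearMap.opNorm_le_bound _ (by positivity) fun x ↦ ?_
  rw [rayIntegral, rayIntegral, ← integral_sub hR hR',
    ContinuousLinearMap.integral_apply (by exact hR.sub hR')]
  have h1 : ‖∫ r in Ioi (0 : ℝ), (Complex.exp (θ * Complex.I) •
      (f (r * Complex.exp (θ * Complex.I)) • R (r * Complex.exp (θ * Complex.I))) -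
      Complex.exp (θ * Complex.I) •
      (f (r * Complex.exp (θ * Complex.I)) • R' (r * Complex.exp (θ * Complex.I)))) x‖ₑ ≤
      ENNReal.ofReal (N * K * ‖x‖) := by
    refine (enorm_integral_le_lintegral_enorm _).trans ?_
    calc _ ≤ ∫⁻ r in Ioi (0 : ℝ), ENNReal.ofReal N * ‖(R (r * Complex.exp (θ * Complex.I)) -
          R' (r * Complex.exp (θ * Complex.I))) x‖ₑ := by
          refine setLIntegral_mono' measurableSet_Ioi fun r hr ↦ ?_
          rw [← smul_sub, ← smul_sub, _root_.smul_apply,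
            _root_.smul_apply, enorm_smul, enorm_smul]
          have : ‖Complex.exp (θ * Complex.I)‖ₑ = 1 := by
            rw [← ofReal_norm, Complex.norm_exp_ofReal_mul_I, ENNReal.ofReal_one]
          rw [this, one_mul]
          gcongr
          rw [← ofReal_norm]
          exact ENNReal.ofReal_le_ofReal (hf r hr)
      _ ≤ ENNReal.ofReal N * ENNReal.ofReal (K * ‖x‖) := by
          rw [lintegral_const_mul' _ _ ENNReal.ofReal_ne_top]
          gcongr
          exact hKR x
      _ = ENNReal.ofReal (N * K * ‖x‖) := by
          rw [← ENNReal.ofReal_mul hN, mul_assoc]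
  rw [← ofReal_norm] at h1
  exact (ENNReal.ofReal_le_ofReal_iff (by positivity)).1 h1

end PseudoResolvent

/-! ### A criterion for a bounded `H^∞`-calculus -/

section Comparison

variable {X : Type*} [NormedAddCommGroup X] [NormedSpace ℂ X]

theorem isResolventAt_resolvent {A : X →ₗ.[ℂ] X} {z : ℂ} (h : z ∈ resolventSet A) :
    IsResolventAt A z (resolvent A z) := by
  have h' : ∃ R : X →L[ℂ] X, IsResolventAt A z R := h
  rw [resolvent, dif_pos h']
  exact h'.choose_spec

theorem IsResolventAt.resolvent_eq {A : X →ₗ.[ℂ] X} {z : ℂ} {R : X →L[ℂ] X}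
    (h : IsResolventAt A z R) : resolvent A z = R :=
  (isResolventAt_resolvent ⟨R, h⟩).unique h

theorem IsResolventAt.sub_eq {A : X →ₗ.[ℂ] X} {z w : ℂ} {R S : X →L[ℂ] X}
    (hR : IsResolventAt A z R) (hS : IsResolventAt A w S) : S - R = (z - w) • (S * R) := by
  ext x
  obtain ⟨h, hx⟩ := hR.1 x
  have h1 := hS.2 ⟨R x, h⟩
  have h2 : x = (w • R x - A ⟨R x, h⟩) + (z - w) • R x := by
    nth_rewrite 1 [← hx]
    rw [sub_smul]
    abel
  change S x - R x = (z - w) • S (R x)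
  nth_rewrite 1 [h2]
  rw [map_add, h1, map_smul]
  abel

theorem IsResolventAt.isClosed {A : X →ₗ.[ℂ] X} {z : ℂ} {R : X →L[ℂ] X}
    (hR : IsResolventAt A z R) : A.IsClosed := by
  have h : (A.graph : Set (X × X)) = {p | R (z • p.1 - p.2) = p.1} := by
    ext ⟨x, y⟩
    simp only [SetLike.mem_coe, LinearPMap.mem_graph_iff, mem_ofPred_eq]
    constructor
    · rintro ⟨u, rfl, rfl⟩
      exact hR.2 u
    · intro hxy
      obtain ⟨h, hx⟩ := hR.1 (z • x - y)
      refine ⟨⟨_, h⟩, hxy, ?_⟩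
      rw [show z • R (z • x - y) = z • x by rw [hxy]] at hx
      exact sub_right_injective hx
  rw [LinearPMap.IsClosed, h]
  exact isClosed_eq (by fun_prop) (by fun_prop)

theorem neg_mem_sector {z : ℂ} {ψ : ℝ} (hz : z ≠ 0) (hψ : 0 < ψ) (h : ψ < |z.arg|) :
    -z ∈ sector (Real.pi - ψ) := by
  refine ⟨neg_ne_zero.2 hz, ?_⟩
  by_cases h1 : 0 < z.im ∨ z.im = 0 ∧ z.re < 0
  · have h0 : 0 ≤ z.arg := Complex.arg_nonneg_iff.2 (by rcases h1 with h1 | h1 <;> linarith [h1])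
    rw [Complex.arg_neg_eq_arg_sub_pi_iff.2 h1, abs_of_nonpos (by linarith [Complex.arg_le_pi z])]
    rw [abs_of_nonneg h0] at h
    linarith
  · by_cases h2 : z.im < 0
    · have h0 : z.arg < 0 := Complex.arg_neg_iff.2 h2
      rw [Complex.arg_neg_eq_arg_add_pi_iff.2 (Or.inl h2),
        abs_of_nonneg (by linarith [Complex.neg_pi_lt_arg z])]
      rw [abs_of_neg h0] at h
      linarith
    · exfalso
      push Not at h1 h2
      have hi : z.im = 0 := le_antisymm h1.1 h2
      have : z.arg = 0 := Complex.arg_eq_zero_iff.2 ⟨h1.2 hi, hi⟩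
      rw [this, abs_zero] at h
      linarith

theorem isPseudoResolventOn_resolvent {A : X →ₗ.[ℂ] X} {ψ : ℝ} (hψ : ψ ≤ Real.pi)
    (h : ∀ z ∈ sector ψ, -z ∈ resolventSet A)
    (hb : ∃ C : ℝ, ∀ z ∈ sector ψ, ‖z • -resolvent A (-z)‖ ≤ C) :
    IsPseudoResolventOn (resolvent A) {z | -z ∈ sector ψ} where
  isOpen := (isOpen_sector hψ).preimage continuous_neg
  zero_notMem h0 := by simpa using h0.1
  sub_eq z hz w hw := by
    have h1 := h _ hz
    have h2 := h _ hw
    rw [neg_neg] at h1 h2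
    exact (isResolventAt_resolvent h1).sub_eq (isResolventAt_resolvent h2)
  bound := by
    obtain ⟨C, hC⟩ := hb
    refine ⟨C, fun z hz ↦ ?_⟩
    simpa [norm_smul] using hC _ hz

theorem dunford_eq (A : X →ₗ.[ℂ] X) (f : ℂ → ℂ) (θ : ℝ) :
    dunford A f θ = (2 * Real.pi * Complex.I)⁻¹ •
      (rayIntegral (fun z ↦ f z • resolvent A z) (-θ) -
        rayIntegral (fun z ↦ f z • resolvent A z) θ) := by
  simp only [dunford, rayIntegral, smul_smul, Complex.ofReal_neg, neg_mul,
    mul_comm (f _)]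

theorem spectralAngle_nonneg (A : X →ₗ.[ℂ] X) : 0 ≤ spectralAngle A :=
  Real.sInf_nonneg fun _ h ↦ h.1.1.le

theorem isSectorial_of_resolvent {A : X →ₗ.[ℂ] X} {C : ℝ}
    (hdense : Dense (A.domain : Set X))
    (hres : ∀ z : ℂ, z.re ≤ ‖z‖ / 4 → ∃ R : X →L[ℂ] X, IsResolventAt A z R ∧ ‖z‖ * ‖R‖ ≤ C) :
    IsSectorial A := by
  obtain ⟨R, hR, -⟩ := hres 0 (by simp)
  have hneg : ∀ t : ℝ, 0 < t → (-t : ℂ).re ≤ ‖(-t : ℂ)‖ / 4 := fun t ht ↦ by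
    have := norm_nonneg (-t : ℂ)
    rw [Complex.neg_re, Complex.ofReal_re]
    linarith
  refine ⟨hR.isClosed, hdense, ?_, fun t ht ↦ ?_, C, fun t ht ↦ ?_⟩
  -- `0` is in the resolvent set, hence `A` is onto
  · have : (range fun x : A.domain ↦ A x) = univ := by
      refine eq_univ_of_forall fun x ↦ ?_
      obtain ⟨h, hx⟩ := hR.1 (-x)
      refine ⟨⟨_, h⟩, ?_⟩
      simpa using hx
    rw [this]
    exact dense_univ
  · obtain ⟨S, hS, -⟩ := hres _ (hneg t ht)
    exact ⟨S, hS⟩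
  · obtain ⟨S, hS, hb⟩ := hres _ (hneg t ht)
    rw [hS.resolvent_eq, norm_smul, norm_neg]
    simpa using hb

/-- A criterion for a bounded `H^∞`-calculus of angle less than `π / 2`: the resolvent of `A` is
compared, on each of the two rays of the contour, with a pseudo-resolvent `R'` that is holomorphic
in the whole right half-plane, so that `R'` does not contribute to the Dunford integral. The
difference only has to be integrable pointwise, with values `(resolvent A z - R' z) x`. The number
`1 / 4` is a cosine, of an angle that bounds the spectral angle. -/
theorem hasBoundedHInftyCalculus_of_comparison [CompleteSpace X] {A : X →ₗ.[ℂ] X} {C K : ℝ}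
    {R' : ℂ → X →L[ℂ] X} (hdense : Dense (A.domain : Set X))
    (hres : ∀ z : ℂ, z.re ≤ ‖z‖ / 4 → ∃ R : X →L[ℂ] X, IsResolventAt A z R ∧ ‖z‖ * ‖R‖ ≤ C)
    (hR' : IsPseudoResolventOn R' {z | 0 < z.re}) (hK : 0 ≤ K)
    (hcomp : ∀ u : ℂ, ‖u‖ = 1 → 0 ≤ u.re → u.re ≤ 1 / 4 → ∀ x : X,
      ∫⁻ r in Ioi (0 : ℝ), ‖(resolvent A (r * u) - R' (r * u)) x‖ₑ ≤ ENNReal.ofReal (K * ‖x‖)) :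
    HasBoundedHInftyCalculus A ∧ hInftyAngle A < Real.pi / 2 := by
  set φ₁ : ℝ := Real.arccos (1 / 4) with hφ₁
  have hcos : Real.cos φ₁ = 1 / 4 := Real.cos_arccos (by norm_num) (by norm_num)
  have h1pos : 0 < φ₁ := Real.arccos_pos.2 (by norm_num)
  have h1lt : φ₁ < Real.pi / 2 := Real.arccos_lt_pi_div_two.2 (by norm_num)
  have hpi := Real.pi_pos
  set S : Set ℝ := {φ | φ ∈ Ioo 0 Real.pi ∧ (∀ z ∈ sector (Real.pi - φ), -z ∈ resolventSet A) ∧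
    ∃ C : ℝ, ∀ z ∈ sector (Real.pi - φ), ‖z • -resolvent A (-z)‖ ≤ C} with hS
  have hre : ∀ z ∈ sector (Real.pi - φ₁), (-z).re ≤ ‖-z‖ / 4 := by
    rintro z ⟨hz0, hz⟩
    have h2 : Real.cos (Real.pi - φ₁) ≤ Real.cos |z.arg| :=
      Real.cos_le_cos_of_nonneg_of_le_pi (abs_nonneg _) (by linarith) hz.le
    rw [Real.cos_pi_sub, hcos, Real.cos_abs, Complex.cos_arg hz0,
      le_div_iff₀ (norm_pos_iff.2 hz0)] at h2
    rw [norm_neg, Complex.neg_re]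
    linarith
  have h1S : φ₁ ∈ S := by
    refine ⟨⟨h1pos, by linarith⟩, fun z hz ↦ ?_, C, fun z hz ↦ ?_⟩
    · obtain ⟨R, hR, -⟩ := hres _ (hre z hz)
      exact ⟨R, hR⟩
    · obtain ⟨R, hR, hb⟩ := hres _ (hre z hz)
      rw [hR.resolvent_eq, norm_smul, norm_neg]
      simpa using hb
  have hangle : spectralAngle A ≤ φ₁ := csInf_le ⟨0, fun φ h ↦ h.1.1.le⟩ h1S
  have hangle0 := spectralAngle_nonneg A
  obtain ⟨θ₀, h1θ, hθ₀⟩ := exists_between h1lt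
  obtain ⟨φ, hθφ, hφ⟩ := exists_between hθ₀
  have hest : HInftyEstimate A φ := by
    refine ⟨(2 * Real.pi)⁻¹ * (2 * K), fun f hf θ hθ ↦ ?_⟩
    set N : ℝ := ⨆ z : sector φ, ‖f z‖ with hN
    have hN0 : 0 ≤ N := Real.iSup_nonneg fun _ ↦ norm_nonneg _
    have hfN : ∀ z ∈ sector φ, ‖f z‖ ≤ N := fun z hz ↦ le_ciSup (HZero.bddAbove hf) ⟨z, hz⟩
    -- an angle below both `θ` and `θ₀` at which the resolvent is still controlled
    obtain ⟨φ₃, h3S, h3θ, h3θ₀⟩ : ∃ φ₃ ∈ S, φ₃ < θ ∧ φ₃ < θ₀ := by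
      obtain ⟨φ₂, h2S, h2θ⟩ := exists_lt_of_csInf_lt ⟨φ₁, h1S⟩ hθ.1
      rcases le_total φ₁ φ₂ with h | h
      · exact ⟨φ₁, h1S, h.trans_lt h2θ, h1θ⟩
      · exact ⟨φ₂, h2S, h2θ, h.trans_lt h1θ⟩
    have hps := isPseudoResolventOn_resolvent (by linarith [h3S.1.1]) h3S.2.1 h3S.2.2
    have hupper : ∀ a b, φ₃ < a → closedSector a b ⊆ {z | -z ∈ sector (Real.pi - φ₃)} :=
      fun a b ha z hz ↦ neg_mem_sector hz.1 h3S.1.1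
        ((ha.trans_le hz.2.1).trans_le (le_abs_self _))
    have hlower : ∀ a b, b < -φ₃ → closedSector a b ⊆ {z | -z ∈ sector (Real.pi - φ₃)} :=
      fun a b hb z hz ↦ neg_mem_sector hz.1 h3S.1.1
        (by linarith [neg_le_abs z.arg, hz.2.2])
    have hup : ∀ a b, a ≤ b → φ₃ < a → b < φ → _ := fun a b hab ha hb ↦
      hps.rayIntegral_eq (by linarith) hf hab (by linarith [h3S.1.1]) hb (hupper a b ha)
    have hlo : ∀ a b, a ≤ b → b < -φ₃ → -φ < a → _ := fun a b hab hb ha ↦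
      hps.rayIntegral_eq (by linarith) hf hab ha (by linarith [h3S.1.1]) (hlower a b hb)
    have e1 : rayIntegral (fun z ↦ f z • resolvent A z) θ =
        rayIntegral (fun z ↦ f z • resolvent A z) θ₀ := by
      rcases le_total θ θ₀ with h | h
      · exact (hup _ _ h h3θ hθφ).2
      · exact (hup _ _ h h3θ₀ hθ.2).2.symm
    have e2 : rayIntegral (fun z ↦ f z • resolvent A z) (-θ) =
        rayIntegral (fun z ↦ f z • resolvent A z) (-θ₀) := by
      rcases le_total θ θ₀ with h | h
      · exact (hlo _ _ (neg_le_neg h) (neg_lt_neg h3θ) (neg_lt_neg hθφ)).2.symm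
      · exact (hlo _ _ (neg_le_neg h) (neg_lt_neg h3θ₀) (neg_lt_neg hθ.2)).2
    have i1 := (hup θ₀ θ₀ le_rfl h3θ₀ hθφ).1
    have i2 := (hlo (-θ₀) (-θ₀) le_rfl (neg_lt_neg h3θ₀) (neg_lt_neg hθφ)).1
    have hsub' : ∀ a b, -θ₀ ≤ a → b ≤ θ₀ → closedSector a b ⊆ {z | 0 < z.re} := by
      intro a b ha hb z hz
      have : |z.arg| < Real.pi / 2 :=
        abs_lt.2 ⟨by linarith [hz.2.1], by linarith [hz.2.2]⟩
      exact (Complex.abs_arg_lt_pi_div_two_iff.1 this).resolve_right hz.1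
    have j2 := hR'.rayIntegral_eq (by linarith) hf (a := -θ₀) (b := θ₀) (by linarith) (by linarith)
      hθφ (hsub' _ _ le_rfl le_rfl)
    have j1 := (hR'.rayIntegral_eq (by linarith) hf (a := θ₀) (b := θ₀) le_rfl (by linarith)
      hθφ (hsub' _ _ (by linarith) le_rfl)).1
    have hunit : ∀ σ : ℝ, |σ| = θ₀ → (∀ r : ℝ, 0 < r → ‖f (r * Complex.exp (σ * Complex.I))‖ ≤ N) ∧
        ∀ x : X, ∫⁻ r in Ioi (0 : ℝ), ‖(resolvent A (r * Complex.exp (σ * Complex.I)) -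
          R' (r * Complex.exp (σ * Complex.I))) x‖ₑ ≤ ENNReal.ofReal (K * ‖x‖) := by
      intro σ hσ
      have hc : Real.cos σ = Real.cos θ₀ := by rw [← hσ, Real.cos_abs]
      constructor
      · intro r hr
        refine hfN _ ⟨mul_ne_zero (by exact_mod_cast hr.ne') (Complex.exp_ne_zero _), ?_⟩
        have hσ' := abs_lt.1 (show |σ| < Real.pi by linarith)
        have harg : (r * Complex.exp (σ * Complex.I)).arg = σ := by
          rw [Complex.arg_real_mul _ hr, Complex.arg_exp_mul_I, toIocMod_eq_self]
          constructor <;> linarith [hσ'.1, hσ'.2]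
        rw [harg, hσ]
        exact hθφ
      · refine hcomp _ (Complex.norm_exp_ofReal_mul_I σ) ?_ ?_
        · rw [Complex.exp_ofReal_mul_I_re, hc]
          exact Real.cos_nonneg_of_mem_Icc ⟨by linarith, hθ₀.le⟩
        · rw [Complex.exp_ofReal_mul_I_re, hc, ← hcos]
          exact Real.cos_le_cos_of_nonneg_of_le_pi h1pos.le (by linarith) h1θ.le
    have hθ₀' : |θ₀| = θ₀ := abs_of_pos (by linarith)
    have b1 := norm_rayIntegral_sub_le hK hN0 i1 j1 (hunit θ₀ hθ₀').1 (hunit θ₀ hθ₀').2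
    have b2 := norm_rayIntegral_sub_le hK hN0 i2 j2.1 (hunit (-θ₀) (by rw [abs_neg, hθ₀'])).1
      (hunit (-θ₀) (by rw [abs_neg, hθ₀'])).2
    rw [dunford_eq, e1, e2, norm_smul]
    have hnorm : ‖(2 * Real.pi * Complex.I : ℂ)⁻¹‖ = (2 * Real.pi)⁻¹ := by
      simp [abs_of_pos hpi]
    rw [hnorm, mul_assoc]
    gcongr
    calc ‖rayIntegral (fun z ↦ f z • resolvent A z) (-θ₀) -
          rayIntegral (fun z ↦ f z • resolvent A z) θ₀‖
        = ‖(rayIntegral (fun z ↦ f z • resolvent A z) (-θ₀) -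
            rayIntegral (fun z ↦ f z • R' z) (-θ₀)) -
          (rayIntegral (fun z ↦ f z • resolvent A z) θ₀ -
            rayIntegral (fun z ↦ f z • R' z) θ₀)‖ := by
          rw [j2.2]
          congr 1
          abel
      _ ≤ N * K + N * K := (norm_sub_le _ _).trans (add_le_add b2 b1)
      _ = 2 * K * N := by ring
  have hmem : φ ∈ Ioo (spectralAngle A) Real.pi := ⟨by linarith, by linarith⟩
  refine ⟨⟨isSectorial_of_resolvent hdense hres, φ, hmem, hest⟩, ?_⟩
  have hbdd : BddBelow {φ | φ ∈ Ioo (spectralAngle A) Real.pi ∧ HInftyEstimate A φ} :=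
    ⟨0, fun ψ hψ ↦ hangle0.trans hψ.1.1.le⟩
  exact (csInf_le hbdd ⟨hmem, hest⟩).trans_lt hφ

end Comparison

/-! ### Densities of Fourier transforms, and completeness -/

section Density

/-- Integration of a bounded function against the vector measure with density `g`, for a bounded
bilinear pairing. -/
theorem integral_withDensityᵥ {α E F G : Type*} [MeasurableSpace α]
    [NormedAddCommGroup E] [NormedSpace ℝ E] [NormedAddCommGroup F] [NormedSpace ℝ F]
    [CompleteSpace F] [NormedAddCommGroup G] [NormedSpace ℝ G] [CompleteSpace G]
    {τ : Measure α} {g : α → F} (hg : Integrable g τ) (B : E →L[ℝ] F →L[ℝ] G) {f : α → E}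
    (hf : StronglyMeasurable f) {C : ℝ} (hC : ∀ x, ‖f x‖ ≤ C) :
    VectorMeasure.integral (τ.withDensityᵥ g) f B = ∫ x, B (f x) (g x) ∂τ := by
  set μ := τ.withDensityᵥ g with hμ
  have hvar : μ.variation = τ.withDensity fun x ↦ ‖g x‖ₑ := Measure.variation_withDensityᵥ hg
  have hfin : IsFiniteMeasure μ.variation := by
    rw [hvar]
    exact isFiniteMeasure_withDensity hg.2.ne
  have hint : ∀ {h : α → E} {D : ℝ}, StronglyMeasurable h → (∀ x, ‖h x‖ ≤ D) →
      Integrable (fun x ↦ B (h x) (g x)) τ := by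
    intro h D hh hD
    refine (hg.norm.const_mul (‖B‖ * D)).mono'
      (B.aestronglyMeasurable_comp₂ hh.aestronglyMeasurable hg.1) (ae_of_all _ fun x ↦ ?_)
    refine (B.le_opNorm₂ _ _).trans ?_
    gcongr
    exact hD x
  have hintμ : ∀ {h : α → E} {D : ℝ}, StronglyMeasurable h → (∀ x, ‖h x‖ ≤ D) →
      μ.Integrable h := fun hh hD ↦
    Integrable.of_bound hh.aestronglyMeasurable _ (ae_of_all _ hD)
  have hsbdd : ∀ h : SimpleFunc α E, ∃ D, ∀ x, ‖h x‖ ≤ D := fun h ↦ h.exists_forall_norm_le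
  have hsimple : ∀ h : SimpleFunc α E,
      VectorMeasure.integral μ h B = ∫ x, B (h x) (g x) ∂τ := by
    intro h
    induction h using SimpleFunc.induction with
    | const c hs =>
      rename_i s
      simp only [SimpleFunc.coe_piecewise, SimpleFunc.coe_const,
        piecewise_eq_indicator, Function.const_zero]
      have e : (fun x ↦ B (s.indicator (Function.const α c) x) (g x)) =
          s.indicator fun x ↦ B c (g x) := by
        ext x
        by_cases hx : x ∈ s <;> simp [hx]
      rw [e, MeasureTheory.integral_indicator hs, VectorMeasure.integral_indicator hs]
      change VectorMeasure.integral _ (fun _ ↦ c) B = _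
      rw [VectorMeasure.integral_const, (B c).integral_comp_comm hg.integrableOn,
        VectorMeasure.restrict_apply _ hs MeasurableSet.univ, univ_inter, hμ,
        withDensityᵥ_apply hg hs]
    | add _ h1 h2 =>
      rename_i f₁ f₂ _
      obtain ⟨D₁, hD₁⟩ := hsbdd f₁
      obtain ⟨D₂, hD₂⟩ := hsbdd f₂
      rw [SimpleFunc.coe_add, VectorMeasure.integral_add (hintμ f₁.stronglyMeasurable hD₁)
        (hintμ f₂.stronglyMeasurable hD₂), h1, h2,
        ← integral_add (hint f₁.stronglyMeasurable hD₁) (hint f₂.stronglyMeasurable hD₂)]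
      simp
  obtain ⟨D, hD0, hD⟩ : ∃ D, 0 ≤ D ∧ ∀ x, ‖f x‖ ≤ D :=
    ⟨|C|, abs_nonneg C, fun x ↦ (hC x).trans (le_abs_self C)⟩
  have t1 : Tendsto (fun k ↦ VectorMeasure.integral μ (hf.approxBounded D k) B) atTop
      (𝓝 (VectorMeasure.integral μ f B)) :=
    VectorMeasure.tendsto_integral_of_dominated_convergence (fun _ ↦ D)
      (fun k ↦ (hf.approxBounded D k).aestronglyMeasurable) (integrable_const D)
      (fun k ↦ ae_of_all _ fun x ↦ hf.norm_approxBounded_le (hD0) k x)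
      (ae_of_all _ fun x ↦ hf.tendsto_approxBounded_of_norm_le (hD x))
  have t2 : Tendsto (fun k ↦ ∫ x, B (hf.approxBounded D k x) (g x) ∂τ) atTop
      (𝓝 (∫ x, B (f x) (g x) ∂τ)) := by
    refine tendsto_integral_of_dominated_convergence (fun x ↦ ‖B‖ * D * ‖g x‖)
      (fun k ↦ (hint (hf.approxBounded D k).stronglyMeasurable
        (fun x ↦ hf.norm_approxBounded_le (hD0) k x)).1) (hg.norm.const_mul _)
      (fun k ↦ ae_of_all _ fun x ↦ ?_) (ae_of_all _ fun x ↦ ?_)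
    · refine (B.le_opNorm₂ _ _).trans ?_
      gcongr
      exact hf.norm_approxBounded_le (hD0) k x
    · have := hf.tendsto_approxBounded_of_norm_le (hD x)
      exact ((B.flip (g x)).continuous.tendsto _).comp this
  simp only [hsimple] at t1
  exact tendsto_nhds_unique t1 t2

/-- The Radon-Nikodym theorem for `ℂⁿ`-valued measures. -/
theorem exists_withDensityᵥ_eq {α : Type*} [MeasurableSpace α] {n : ℕ}
    (μ : VectorMeasure α (Cn n)) (τ : Measure α) [IsFiniteMeasure τ] (h : μ.variation ≪ τ) :
    ∃ g : α → Cn n, Integrable g τ ∧ μ = τ.withDensityᵥ g := by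
  have key : ∀ ℓ : Cn n →L[ℝ] ℝ, ∃ r : α → ℝ, Integrable r τ ∧
      ∀ s, MeasurableSet s → ∫ x in s, r x ∂τ = ℓ (μ s) := by
    intro ℓ
    set ν : SignedMeasure α := μ.mapRange ℓ.toLinearMap.toAddMonoidHom ℓ.continuous with hν
    have hac : ν ≪ᵥ τ.toENNRealVectorMeasure := by
      refine VectorMeasure.AbsolutelyContinuous.mk fun s hs h0 ↦ ?_
      rw [Measure.toENNRealVectorMeasure_apply_measurable hs] at h0
      have h1 : ‖μ s‖ₑ ≤ 0 := (μ.enorm_measure_le_variation s).trans_eq (h h0)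
      have h2 : μ s = 0 := by simpa using h1
      change ℓ (μ s) = 0
      rw [h2, map_zero]
    refine ⟨ν.rnDeriv τ, SignedMeasure.integrable_rnDeriv _ _, fun s hs ↦ ?_⟩
    rw [← withDensityᵥ_apply (SignedMeasure.integrable_rnDeriv _ _) hs,
      SignedMeasure.withDensityᵥ_rnDeriv_eq ν τ hac]
    rfl
  let p : Fin n → Cn n →L[ℝ] ℂ := fun i ↦
    (EuclideanSpace.proj i : Cn n →L[ℂ] ℂ).restrictScalars ℝ
  choose a ha ha' using fun i ↦ key (Complex.reCLM.comp (p i))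
  choose b hb hb' using fun i ↦ key (Complex.imCLM.comp (p i))
  have hi : ∀ i, Integrable (fun x ↦ ((a i x : ℂ) + b i x * Complex.I)) τ := fun i ↦
    (ha i).ofReal.add ((hb i).ofReal.mul_const _)
  have hg : Integrable (fun x ↦ ∑ i, ((a i x : ℂ) + b i x * Complex.I) •
      EuclideanSpace.single i (1 : ℂ)) τ :=
    integrable_finsetSum _ fun i _ ↦ (hi i).smul_const _
  refine ⟨_, hg, ?_⟩
  ext1 s hs
  rw [withDensityᵥ_apply hg hs, integral_finsetSum _ fun i _ ↦ ((hi i).smul_const _).integrableOn]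
  ext j
  simp only [integral_smul_const, WithLp.ofLp_sum, Finset.sum_apply, WithLp.ofLp_smul,
    Pi.smul_apply, PiLp.single_apply, smul_eq_mul, mul_ite, mul_one, mul_zero, Finset.sum_ite_eq,
    Finset.mem_univ, if_true]
  have hadd := integral_add (μ := τ.restrict s) (f := fun x ↦ (a j x : ℂ))
    (g := fun x ↦ (b j x : ℂ) * Complex.I) (ha j).ofReal.restrict
    ((hb j).ofReal.mul_const Complex.I).restrict
  rw [hadd, integral_mul_const, integral_complex_ofReal, integral_complex_ofReal, ha' j s hs,
    hb' j s hs]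
  exact (Complex.re_add_im _).symm

variable {n : ℕ}

/-- `û = g τ`, with an integrable density `g`. -/
def HasDensity (u : FM n) (τ : Measure (Rn n)) (g : Rn n → Cn n) : Prop :=
  Integrable g τ ∧ (FM.hat n u).1 = τ.withDensityᵥ g

theorem HasDensity.add {u v : FM n} {τ : Measure (Rn n)} {g h : Rn n → Cn n}
    (hu : HasDensity u τ g) (hv : HasDensity v τ h) : HasDensity (u + v) τ (g + h) := by
  refine ⟨hu.1.add hv.1, ?_⟩
  rw [map_add, Submodule.coe_add, hu.2, hv.2, withDensityᵥ_add hu.1 hv.1]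

theorem HasDensity.smul {u : FM n} {τ : Measure (Rn n)} {g : Rn n → Cn n}
    (hu : HasDensity u τ g) (c : ℂ) : HasDensity (c • u) τ (c • g) := by
  refine ⟨hu.1.smul c, ?_⟩
  rw [map_smul, Submodule.coe_smul, hu.2, withDensityᵥ_smul]

theorem HasDensity.eq_iff {u v : FM n} {τ : Measure (Rn n)} {g h : Rn n → Cn n}
    (hu : HasDensity u τ g) (hv : HasDensity v τ h) : u = v ↔ g =ᵐ[τ] h := by
  rw [← hu.1.withDensityᵥ_eq_iff hv.1, ← hu.2, ← hv.2, Subtype.coe_inj,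
    (FM.hat n).injective.eq_iff]

theorem HasDensity.enorm_eq {u : FM n} {τ : Measure (Rn n)} {g : Rn n → Cn n}
    (hu : HasDensity u τ g) : ‖u‖ₑ = ∫⁻ ξ, ‖g ξ‖ₑ ∂τ := by
  rw [← ofReal_norm, FM.norm_def, ENNReal.ofReal_toReal (FM.hat n u).2.ne, hu.2,
    Measure.variation_withDensityᵥ hu.1, MeasureTheory.withDensity_apply _ .univ,
    setLIntegral_univ]

theorem HasDensity.norm_eq {u : FM n} {τ : Measure (Rn n)} {g : Rn n → Cn n}
    (hu : HasDensity u τ g) : ‖u‖ = ∫ ξ, ‖g ξ‖ ∂τ := by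
  rw [integral_norm_eq_lintegral_enorm hu.1.1, ← hu.enorm_eq, toReal_enorm]

theorem exists_hasDensity {u : FM n} {τ : Measure (Rn n)} [IsFiniteMeasure τ]
    (h : (FM.hat n u).1.variation ≪ τ) : ∃ g, HasDensity u τ g :=
  exists_withDensityᵥ_eq _ _ h

theorem exists_hasDensity_self (u : FM n) : ∃ g, HasDensity u (FM.hat n u).1.variation g :=
  exists_hasDensity Measure.AbsolutelyContinuous.rfl

theorem exists_hasDensity_pair (u v : FM n) : ∃ (τ : Measure (Rn n)) (_ : IsFiniteMeasure τ)
    (g h : Rn n → Cn n), HasDensity u τ g ∧ HasDensity v τ h := by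
  have i : IsFiniteMeasure ((FM.hat n u).1.variation + (FM.hat n v).1.variation) := inferInstance
  obtain ⟨g, hg⟩ := exists_hasDensity (u := u) (τ := (FM.hat n u).1.variation +
    (FM.hat n v).1.variation) (Measure.absolutelyContinuous_of_le (Measure.le_add_right le_rfl))
  obtain ⟨h, hh⟩ := exists_hasDensity (u := v) (τ := (FM.hat n u).1.variation +
    (FM.hat n v).1.variation) (Measure.absolutelyContinuous_of_le (Measure.le_add_left le_rfl))
  exact ⟨_, i, g, h, hg, hh⟩

theorem norm_kernel (x ξ : Rn n) : ‖kernel x ξ‖ = (2 * Real.pi) ^ (-(n : ℝ) / 2) := by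
  rw [kernel, norm_mul, mul_comm Complex.I, Complex.norm_exp_ofReal_mul_I, mul_one,
    Complex.norm_real, Real.norm_of_nonneg (by positivity)]

theorem integrable_kernel_smul {τ : Measure (Rn n)} {g : Rn n → Cn n} (hg : Integrable g τ)
    (x : Rn n) : Integrable (fun ξ ↦ kernel x ξ • g ξ) τ := by
  refine (hg.norm.const_mul ((2 * Real.pi) ^ (-(n : ℝ) / 2))).mono'
    ((continuous_kernel x).aestronglyMeasurable.smul hg.1) (ae_of_all _ fun ξ ↦ ?_)
  rw [norm_smul, norm_kernel]

theorem HasDensity.apply_eq {u : FM n} {τ : Measure (Rn n)} {g : Rn n → Cn n}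
    (hu : HasDensity u τ g) (x : Rn n) : u x = ∫ ξ, kernel x ξ • g ξ ∂τ := by
  rw [FM.eq_fourierInv_hat u]
  change VectorMeasure.integral (FM.hat n u).1 (kernel x) (ContinuousLinearMap.lsmul ℝ ℂ) = _
  rw [hu.2, integral_withDensityᵥ hu.1 _ (continuous_kernel x).stronglyMeasurable
    (fun ξ ↦ (norm_kernel x ξ).le)]
  rfl

/-- The fields whose Fourier transform has a density with respect to the finite measure `τ` form an
isometric copy of `L¹(τ; ℂⁿ)`. -/
def ofL1 (τ : Measure (Rn n)) : Lp (Cn n) 1 τ →ₗᵢ[ℂ] FM n where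
  toFun g := (FM.hat n).symm ⟨τ.withDensityᵥ g, by
    change (τ.withDensityᵥ g).variation univ < ∞
    rw [Measure.variation_withDensityᵥ (L1.integrable_coeFn g),
      MeasureTheory.withDensity_apply _ .univ, setLIntegral_univ]
    exact (L1.integrable_coeFn g).2⟩
  map_add' g h := by
    rw [← map_add]
    congr 1
    refine Subtype.ext ?_
    change _ = τ.withDensityᵥ g + τ.withDensityᵥ h
    rw [← withDensityᵥ_add (L1.integrable_coeFn g) (L1.integrable_coeFn h)]
    exact WithDensityᵥEq.congr_ae (Lp.coeFn_add g h)
  map_smul' c g := by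
    rw [RingHom.id_apply, ← map_smul]
    congr 1
    refine Subtype.ext ?_
    change _ = c • τ.withDensityᵥ g
    rw [← withDensityᵥ_smul]
    exact WithDensityᵥEq.congr_ae (Lp.coeFn_smul c g)
  norm_map' g := by
    have h : HasDensity ((FM.hat n).symm ⟨τ.withDensityᵥ g, by
        change (τ.withDensityᵥ g).variation univ < ∞
        rw [Measure.variation_withDensityᵥ (L1.integrable_coeFn g),
          MeasureTheory.withDensity_apply _ .univ, setLIntegral_univ]
        exact (L1.integrable_coeFn g).2⟩) τ g :=
      ⟨L1.integrable_coeFn g, by rw [LinearEquiv.apply_symm_apply]⟩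
    rw [L1.norm_eq_integral_norm]
    exact h.norm_eq

theorem hasDensity_ofL1 (τ : Measure (Rn n)) (g : Lp (Cn n) 1 τ) : HasDensity (ofL1 τ g) τ g := by
  refine ⟨L1.integrable_coeFn g, ?_⟩
  change ((FM.hat n) ((FM.hat n).symm _)).1 = _
  rw [LinearEquiv.apply_symm_apply]

theorem HasDensity.eq_ofL1 {u : FM n} {τ : Measure (Rn n)} {g : Rn n → Cn n}
    (hu : HasDensity u τ g) : u = ofL1 τ (hu.1.toL1 g) :=
  (hu.eq_iff (hasDensity_ofL1 τ _)).2 hu.1.coeFn_toL1.symm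

/-- An absolutely summable series in `FM(ℝⁿ)` lives in a single space `L¹(τ; ℂⁿ)`. -/
instance : CompleteSpace (FM n) := by
  refine NormedAddCommGroup.completeSpace_of_summable_imp_tendsto fun u hu ↦ ?_
  set τ : Measure (Rn n) := Measure.sum fun k ↦ (FM.hat n (u k)).1.variation with hτ
  have hfin : IsFiniteMeasure τ := by
    refine ⟨?_⟩
    rw [hτ, Measure.sum_apply _ .univ]
    have : ∀ k, (FM.hat n (u k)).1.variation univ = ENNReal.ofReal ‖u k‖ := fun k ↦ by
      rw [FM.norm_def, ENNReal.ofReal_toReal (FM.hat n (u k)).2.ne]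
    simp only [this]
    rw [← ENNReal.ofReal_tsum_of_nonneg (fun k ↦ norm_nonneg _) hu]
    exact ENNReal.ofReal_lt_top
  choose g hg using fun k ↦ exists_hasDensity (u := u k) (τ := τ)
    (Measure.absolutelyContinuous_of_le (Measure.le_sum _ k))
  set G : ℕ → Lp (Cn n) 1 τ := fun k ↦ (hg k).1.toL1 (g k) with hG
  have hGu : ∀ k, u k = ofL1 τ (G k) := fun k ↦ (hg k).eq_ofL1
  have hGs : Summable fun k ↦ ‖G k‖ := by
    simpa only [hGu, LinearIsometry.norm_map] using hu
  refine ⟨ofL1 τ (∑' k, G k), ?_⟩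
  have := ((ofL1 τ).continuous.tendsto _).comp hGs.of_norm.hasSum.tendsto_sum_nat
  refine this.congr fun N ↦ ?_
  simp [hGu]

end Density

/-! ### Fourier multipliers and solenoidal fields -/

section Multiplier

variable {n : ℕ}

/-- The bounded measurable matrix-valued functions, that is, the symbols of Fourier multipliers. -/
structure IsSymbol (ψ : Rn n → Cn n →L[ℂ] Cn n) : Prop where
  stronglyMeasurable : StronglyMeasurable ψ
  bounded : ∃ C, ∀ ξ, ‖ψ ξ‖ ≤ C

/-- The action `u ↦ 𝓕⁻¹(û⌊ψ)` of a symbol on `FM(ℝⁿ)`, as a linear map. -/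
def multLinear (ψ : Rn n → Cn n →L[ℂ] Cn n) (h : IsSymbol ψ) : FM n →ₗ[ℂ] FM n :=
  (FM.hat n).symm.toLinearMap ∘ₗ
    RadonMeasures.floor ψ h.stronglyMeasurable h.bounded ∘ₗ (FM.hat n).toLinearMap

theorem hasDensity_multLinear {ψ : Rn n → Cn n →L[ℂ] Cn n} (h : IsSymbol ψ) {u : FM n}
    {τ : Measure (Rn n)} {g : Rn n → Cn n} (hu : HasDensity u τ g) :
    HasDensity (multLinear ψ h u) τ fun ξ ↦ ψ ξ (g ξ) := by
  obtain ⟨C, hC⟩ := h.bounded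
  have hm : AEStronglyMeasurable (fun ξ ↦ ψ ξ (g ξ)) τ := by
    have := (matVec n).aestronglyMeasurable_comp₂
      (h.stronglyMeasurable.aestronglyMeasurable (μ := τ)) hu.1.1
    exact this
  have hi : Integrable (fun ξ ↦ ψ ξ (g ξ)) τ :=
    (hu.1.norm.const_mul C).mono' hm (ae_of_all _ fun ξ ↦
      ((ψ ξ).le_opNorm _).trans (mul_le_mul_of_nonneg_right (hC ξ) (norm_nonneg _)))
  refine ⟨hi, ?_⟩
  change ((FM.hat n) ((FM.hat n).symm _)).1 = _
  rw [LinearEquiv.apply_symm_apply]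
  change (FM.hat n u).1.withDensity ψ (matVec n) = _
  ext1 s hs
  rw [VectorMeasure.withDensity_apply (integrable_of_bounded h.stronglyMeasurable h.bounded _),
    withDensityᵥ_apply hi hs, hu.2]
  have e : (τ.withDensityᵥ g).restrict s = (τ.restrict s).withDensityᵥ g := by
    ext1 t ht
    rw [VectorMeasure.restrict_apply _ hs ht, withDensityᵥ_apply hu.1 (ht.inter hs),
      withDensityᵥ_apply hu.1.restrict ht, Measure.restrict_restrict ht]
  rw [e]
  exact integral_withDensityᵥ hu.1.restrict (matVec n) h.stronglyMeasurable hC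

open Classical in
/-- The Fourier multiplier operator `u ↦ 𝓕⁻¹(û⌊ψ)` on `FM(ℝⁿ)`, as a bounded operator
(and `0` if `ψ` is not a bounded measurable function). -/
def mult (ψ : Rn n → Cn n →L[ℂ] Cn n) : FM n →L[ℂ] FM n :=
  if h : IsSymbol ψ then (multLinear ψ h).mkContinuousOfExistsBound (by
    obtain ⟨C, hC⟩ := h.bounded
    refine ⟨C, fun u ↦ ?_⟩
    obtain ⟨g, hg⟩ := exists_hasDensity_self u
    have hm := hasDensity_multLinear h hg
    rw [hg.norm_eq, hm.norm_eq, ← integral_const_mul]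
    exact integral_mono hm.1.norm (hg.1.norm.const_mul C) fun ξ ↦
      ((ψ ξ).le_opNorm _).trans (mul_le_mul_of_nonneg_right (hC ξ) (norm_nonneg _)))
  else 0

theorem mult_apply {ψ : Rn n → Cn n →L[ℂ] Cn n} (h : IsSymbol ψ) (u : FM n) :
    mult ψ u = multLinear ψ h u := by
  rw [mult, dif_pos h]
  rfl

theorem HasDensity.mult {ψ : Rn n → Cn n →L[ℂ] Cn n} (h : IsSymbol ψ) {u : FM n}
    {τ : Measure (Rn n)} {g : Rn n → Cn n} (hu : HasDensity u τ g) :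
    HasDensity (mult ψ u) τ fun ξ ↦ ψ ξ (g ξ) := by
  rw [mult_apply h]
  exact hasDensity_multLinear h hu

/-- The bounded measurable complex functions. -/
structure IsScalarSymbol (m : Rn n → ℂ) : Prop where
  measurable : Measurable m
  bounded : ∃ C, ∀ ξ, ‖m ξ‖ ≤ C

/-- The Fourier multiplier operator with the scalar symbol `m`. -/
def smult (m : Rn n → ℂ) : FM n →L[ℂ] FM n := mult fun ξ ↦ m ξ • ContinuousLinearMap.id ℂ (Cn n)

theorem IsScalarSymbol.isSymbol {m : Rn n → ℂ} (h : IsScalarSymbol m) :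
    IsSymbol fun ξ ↦ m ξ • ContinuousLinearMap.id ℂ (Cn n) := by
  obtain ⟨C, hC⟩ := h.bounded
  refine ⟨h.measurable.stronglyMeasurable.smul_const _,
    C * ‖ContinuousLinearMap.id ℂ (Cn n)‖, fun ξ ↦ ?_⟩
  rw [norm_smul]
  gcongr
  exact hC ξ

theorem HasDensity.smult {m : Rn n → ℂ} (h : IsScalarSymbol m) {u : FM n}
    {τ : Measure (Rn n)} {g : Rn n → Cn n} (hu : HasDensity u τ g) :
    HasDensity (smult m u) τ fun ξ ↦ m ξ • g ξ :=
  hu.mult h.isSymbol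

theorem IsScalarSymbol.mul {m k : Rn n → ℂ} (hm : IsScalarSymbol m) (hk : IsScalarSymbol k) :
    IsScalarSymbol fun ξ ↦ m ξ * k ξ := by
  obtain ⟨C, hC⟩ := hm.bounded
  obtain ⟨D, hD⟩ := hk.bounded
  refine ⟨hm.1.mul hk.1, C * D, fun ξ ↦ ?_⟩
  rw [norm_mul]
  exact mul_le_mul (hC ξ) (hD ξ) (norm_nonneg _) ((norm_nonneg _).trans (hC ξ))

theorem IsScalarSymbol.add {m k : Rn n → ℂ} (hm : IsScalarSymbol m) (hk : IsScalarSymbol k) :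
    IsScalarSymbol fun ξ ↦ m ξ + k ξ := by
  obtain ⟨C, hC⟩ := hm.bounded
  obtain ⟨D, hD⟩ := hk.bounded
  exact ⟨hm.1.add hk.1, C + D, fun ξ ↦ (norm_add_le _ _).trans (add_le_add (hC ξ) (hD ξ))⟩

theorem IsScalarSymbol.const_mul {m : Rn n → ℂ} (hm : IsScalarSymbol m) (c : ℂ) :
    IsScalarSymbol fun ξ ↦ c * m ξ :=
  IsScalarSymbol.mul ⟨measurable_const, ‖c‖, fun _ ↦ le_rfl⟩ hm

theorem smult_smult {m k : Rn n → ℂ} (hm : IsScalarSymbol m) (hk : IsScalarSymbol k) (u : FM n) :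
    smult m (smult k u) = smult (fun ξ ↦ m ξ * k ξ) u := by
  obtain ⟨g, hg⟩ := exists_hasDensity_self u
  exact (((hg.smult hk).smult hm).eq_iff (hg.smult (hm.mul hk))).2
    (ae_of_all _ fun ξ ↦ smul_smul _ _ _)

theorem smult_add_apply {m k : Rn n → ℂ} (hm : IsScalarSymbol m) (hk : IsScalarSymbol k)
    (u : FM n) : smult (fun ξ ↦ m ξ + k ξ) u = smult m u + smult k u := by
  obtain ⟨g, hg⟩ := exists_hasDensity_self u
  exact ((hg.smult (hm.add hk)).eq_iff ((hg.smult hm).add (hg.smult hk))).2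
    (ae_of_all _ fun ξ ↦ add_smul _ _ _)

theorem smult_const_mul_apply {m : Rn n → ℂ} (hm : IsScalarSymbol m) (c : ℂ)
    (u : FM n) : smult (fun ξ ↦ c * m ξ) u = c • smult m u := by
  obtain ⟨g, hg⟩ := exists_hasDensity_self u
  exact ((hg.smult (hm.const_mul c)).eq_iff ((hg.smult hm).smul c)).2
    (ae_of_all _ fun ξ ↦ mul_smul _ _ _)

theorem smult_one (u : FM n) : smult (fun _ ↦ 1) u = u := by
  obtain ⟨g, hg⟩ := exists_hasDensity_self u
  exact ((hg.smult ⟨measurable_const, 1, by simp⟩).eq_iff hg).2 (ae_of_all _ fun ξ ↦ one_smul _ _)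

theorem smult_mult_comm {m : Rn n → ℂ} {ψ : Rn n → Cn n →L[ℂ] Cn n} (hm : IsScalarSymbol m)
    (hψ : IsSymbol ψ) (u : FM n) : smult m (mult ψ u) = mult ψ (smult m u) := by
  obtain ⟨g, hg⟩ := exists_hasDensity_self u
  exact (((hg.mult hψ).smult hm).eq_iff ((hg.smult hm).mult hψ)).2
    (ae_of_all _ fun ξ ↦ ((ψ ξ).map_smul _ _).symm)

theorem smult_injective {m : Rn n → ℂ} (hm : IsScalarSymbol m) (h0 : ∀ ξ, m ξ ≠ 0) :
    Function.Injective (smult m : FM n → FM n) := by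
  intro u v huv
  obtain ⟨τ, _, g, h, hg, hh⟩ := exists_hasDensity_pair u v
  rw [hg.eq_iff hh]
  rw [(hg.smult hm).eq_iff (hh.smult hm)] at huv
  filter_upwards [huv] with ξ hξ
  exact smul_right_injective _ (h0 ξ) hξ

theorem norm_smult_le {m : Rn n → ℂ} (hm : Measurable m) {C : ℝ} (hC : ∀ ξ, ‖m ξ‖ ≤ C) (u : FM n) :
    ‖smult m u‖ ≤ C * ‖u‖ := by
  obtain ⟨g, hg⟩ := exists_hasDensity_self u
  have h := hg.smult ⟨hm, C, hC⟩
  rw [h.norm_eq, hg.norm_eq, ← integral_const_mul]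
  refine integral_mono h.1.norm (hg.1.norm.const_mul C) fun ξ ↦ ?_
  rw [norm_smul]
  gcongr
  exact hC ξ

theorem isSymbol_helmholtz : IsSymbol (helmholtzSymbol (n := n)) :=
  ⟨stronglyMeasurable_helmholtzSymbol n, helmholtzSymbol_bound n⟩

theorem helmholtz_eq_mult (u : FM n) : helmholtz n u = mult helmholtzSymbol u :=
  (mult_apply isSymbol_helmholtz u).symm

theorem matMul_eq_mult (M : Matrix (Fin n) (Fin n) ℝ) (u : FM n) :
    matMul M u = mult (fun _ ↦ matCLM M) u := by
  have hs : IsSymbol fun _ : Rn n ↦ matCLM M :=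
    ⟨stronglyMeasurable_const, ‖matCLM M‖, fun _ ↦ le_rfl⟩
  obtain ⟨g, hg⟩ := exists_hasDensity_self u
  ext1 x
  rw [(hg.mult hs).apply_eq x]
  change matCLM M (u x) = _
  have hi := integrable_kernel_smul hg.1 x
  rw [hg.apply_eq x, ← (matCLM M).integral_comp_comm hi]
  simp only [map_smul]

end Multiplier

section Solenoidal

variable {n : ℕ}

theorem helmholtzSymbol_comp_self (ξ : Rn n) :
    helmholtzSymbol ξ ∘L helmholtzSymbol ξ = helmholtzSymbol ξ := by
  have h : ∀ T : Matrix (Fin n) (Fin n) ℂ, T * T = T → (1 - T) * (1 - T) = 1 - T := by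
    intro T hT
    rw [mul_sub, sub_mul, sub_mul, hT]
    simp
  change helmholtzSymbol ξ * helmholtzSymbol ξ = helmholtzSymbol ξ
  rw [helmholtzSymbol, ← map_mul, h]
  ext i j
  rw [Matrix.mul_apply]
  simp only [Matrix.of_apply]
  rw [← Complex.ofReal_inj.2 (?_ : ∑ k, (ξ i * ξ k / ‖ξ‖ ^ 2) * (ξ k * ξ j / ‖ξ‖ ^ 2) =
    ξ i * ξ j / ‖ξ‖ ^ 2)]
  · push_cast
    rfl
  by_cases h0 : ξ = 0
  · simp [h0]
  have hn : ‖ξ‖ ^ 2 ≠ 0 := by positivity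
  have e : ∀ k, (ξ i * ξ k / ‖ξ‖ ^ 2) * (ξ k * ξ j / ‖ξ‖ ^ 2) =
      ξ k ^ 2 * (ξ i * ξ j / (‖ξ‖ ^ 2 * ‖ξ‖ ^ 2)) := fun k ↦ by ring
  simp only [e]
  rw [← Finset.sum_mul, ← EuclideanSpace.real_norm_sq_eq]
  field_simp

open Classical in
/-- The symbol of the projection of `FM(ℝⁿ)` onto `FM_{0,σ}(ℝⁿ)`: the symbol of the Helmholtz
projection, made to vanish at the origin. -/
def solSymbol (ξ : Rn n) : Cn n →L[ℂ] Cn n := if ξ = 0 then 0 else helmholtzSymbol ξ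

theorem isSymbol_solSymbol : IsSymbol (solSymbol (n := n)) := by
  classical
  obtain ⟨C, hC⟩ := helmholtzSymbol_bound n
  refine ⟨StronglyMeasurable.ite (measurableSet_singleton 0) stronglyMeasurable_const
    (stronglyMeasurable_helmholtzSymbol n), C, fun ξ ↦ ?_⟩
  rw [solSymbol]
  split_ifs
  · simpa using (norm_nonneg _).trans (hC 0)
  · exact hC ξ

theorem mem_FM0_iff {u : FM n} {τ : Measure (Rn n)} [IsFiniteMeasure τ] {g : Rn n → Cn n}
    (hu : HasDensity u τ g) : u ∈ FM0 n ↔ ∀ᵐ ξ ∂τ, ξ = 0 → g ξ = 0 := by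
  change (FM.hat n u).1 {0} = 0 ↔ _
  rw [hu.2, withDensityᵥ_apply hu.1 (measurableSet_singleton 0), integral_singleton]
  constructor
  · intro h
    rcases smul_eq_zero.1 h with h | h
    · have h1 : τ {0} = 0 := (measureReal_eq_zero_iff).1 h
      filter_upwards [compl_mem_ae_iff.2 h1] with ξ hξ h0
      exact absurd h0 hξ
    · exact ae_of_all _ fun ξ h0 ↦ h0 ▸ h
  · intro h
    by_cases h0 : g 0 = 0
    · rw [h0, smul_zero]
    · have : τ {0} = 0 := by
        refine measure_mono_null ?_ (ae_iff.1 h)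
        rintro _ rfl hc
        exact h0 (hc rfl)
      rw [(measureReal_eq_zero_iff).2 this, zero_smul]

/-- `FM_{0,σ}(ℝⁿ)` is the range of the bounded projection with symbol `solSymbol`. In particular it
is closed. -/
theorem mem_FM0sol_iff {u : FM n} : u ∈ FM0sol n ↔ mult solSymbol u = u := by
  constructor
  · rintro ⟨v, hv, rfl⟩
    obtain ⟨g, hg⟩ := exists_hasDensity_self v
    rw [helmholtz_eq_mult]
    have h1 := hg.mult isSymbol_helmholtz
    refine ((h1.mult isSymbol_solSymbol).eq_iff h1).2 ?_
    filter_upwards [(mem_FM0_iff hg).1 hv] with ξ hξ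
    by_cases h0 : ξ = 0
    · simp [hξ h0]
    · rw [solSymbol, if_neg h0, ← ContinuousLinearMap.comp_apply, helmholtzSymbol_comp_self]
  · intro hu
    obtain ⟨g, hg⟩ := exists_hasDensity_self u
    have h1 := ((hg.mult isSymbol_solSymbol).eq_iff hg).1 hu
    have h2 : u ∈ FM0 n := by
      rw [mem_FM0_iff hg]
      filter_upwards [h1] with ξ hξ h0
      rw [← hξ, solSymbol, if_pos h0]
      rfl
    refine ⟨u, h2, ?_⟩
    rw [helmholtz_eq_mult]
    refine ((hg.mult isSymbol_helmholtz).eq_iff hg).2 ?_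
    filter_upwards [h1] with ξ hξ
    by_cases h0 : ξ = 0
    · rw [← hξ, solSymbol, if_pos h0]
      simp
    · rwa [solSymbol, if_neg h0] at hξ

theorem isClosed_FM0sol : IsClosed (FM0sol n : Set (FM n)) := by
  have : (FM0sol n : Set (FM n)) = {u | mult solSymbol u = u} := by
    ext u
    exact mem_FM0sol_iff
  rw [this]
  exact isClosed_eq (mult solSymbol).continuous continuous_id

instance : CompleteSpace (FM0sol n) := isClosed_FM0sol.completeSpace_coe

theorem smult_mem_FM0sol {m : Rn n → ℂ} (hm : IsScalarSymbol m) {u : FM n} (hu : u ∈ FM0sol n) :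
    smult m u ∈ FM0sol n := by
  rw [mem_FM0sol_iff] at hu ⊢
  rw [← smult_mult_comm hm isSymbol_solSymbol, hu]

/-- A field is solenoidal if its image under a multiplier without zeros is. This reduces unbounded
symbols to bounded ones. -/
theorem mem_FM0sol_of_smult {m : Rn n → ℂ} (hm : IsScalarSymbol m) (h0 : ∀ ξ, m ξ ≠ 0) {u : FM n}
    (hu : smult m u ∈ FM0sol n) : u ∈ FM0sol n := by
  rw [mem_FM0sol_iff] at hu ⊢
  refine smult_injective hm h0 ?_
  rw [smult_mult_comm hm isSymbol_solSymbol, hu]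

theorem helmholtz_matMul_mem (M : Matrix (Fin n) (Fin n) ℝ) {u : FM n} (hu : u ∈ FM0sol n) :
    helmholtz n (matMul M u) ∈ FM0sol n := by
  refine ⟨matMul M u, ?_, rfl⟩
  rw [mem_FM0sol_iff] at hu
  obtain ⟨g, hg⟩ := exists_hasDensity_self u
  have h1 := ((hg.mult isSymbol_solSymbol).eq_iff hg).1 hu
  have hs : IsSymbol fun _ : Rn n ↦ matCLM M :=
    ⟨stronglyMeasurable_const, ‖matCLM M‖, fun _ ↦ le_rfl⟩
  rw [matMul_eq_mult]
  refine (mem_FM0_iff (hg.mult hs)).2 ?_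
  filter_upwards [h1] with ξ hξ h0
  rw [← hξ, solSymbol, if_pos h0]
  simp

/-- The bounded operator `u ↦ P M u` in `FM_{0,σ}(ℝⁿ)`. -/
def helmholtzMatMul (M : Matrix (Fin n) (Fin n) ℝ) : FM0sol n →L[ℂ] FM0sol n :=
  ((mult helmholtzSymbol ∘L mult fun _ ↦ matCLM M) ∘L (FM0sol n).subtypeL).codRestrict (FM0sol n)
    fun u ↦ by
      have := helmholtz_matMul_mem M u.2
      rwa [helmholtz_eq_mult, matMul_eq_mult] at this

theorem coe_helmholtzMatMul (M : Matrix (Fin n) (Fin n) ℝ) (u : FM0sol n) :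
    (helmholtzMatMul M u : FM n) = helmholtz n (matMul M u) := by
  rw [helmholtz_eq_mult, matMul_eq_mult]
  rfl

open Classical in
/-- The scalar multiplier with symbol `m` as an operator in `FM_{0,σ}(ℝⁿ)` (and `0` if `m` is not a
bounded measurable function). -/
def solMult (m : Rn n → ℂ) : FM0sol n →L[ℂ] FM0sol n :=
  if hm : IsScalarSymbol m then (smult m ∘L (FM0sol n).subtypeL).codRestrict (FM0sol n)
    fun u ↦ smult_mem_FM0sol hm u.2
  else 0

theorem coe_solMult {m : Rn n → ℂ} (hm : IsScalarSymbol m) (u : FM0sol n) :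
    (solMult m u : FM n) = smult m u := by
  rw [solMult, dif_pos hm]
  rfl

end Solenoidal

/-! ### Derivatives and decay of symbols -/

section Derivative

variable {n : ℕ}

/-- The Fourier transform of a directional derivative: if `∂_v u = w` then `ŵ = i (v·ξ) û`, read on
densities with respect to a common measure. -/
theorem density_of_fderiv {u w : FM n} {v : Rn n} (hu : ContDiff ℝ 1 u)
    (hw : ∀ x, fderiv ℝ u x v = w x) {τ : Measure (Rn n)} [IsFiniteMeasure τ] {g h : Rn n → Cn n}
    (hg : HasDensity u τ g) (hh : HasDensity w τ h) :
    ∀ᵐ ξ ∂τ, h ξ = (Complex.I * (⟪v, ξ⟫_ℝ : ℝ)) • g ξ := by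
  -- the symbols of the translation by `t v` and of the average over `[0, t]` of translations
  set e : ℝ → Rn n → ℂ := fun s ξ ↦ Complex.exp (s * (Complex.I * (⟪v, ξ⟫_ℝ : ℝ))) with he
  have hec : Continuous fun p : ℝ × Rn n ↦ e p.1 p.2 := by
    simp only [he]
    fun_prop
  have hen : ∀ s ξ, ‖e s ξ‖ = 1 := fun s ξ ↦ by
    simp only [he]
    rw [show (s : ℂ) * (Complex.I * (⟪v, ξ⟫_ℝ : ℝ)) = ((s * ⟪v, ξ⟫_ℝ : ℝ) : ℂ) * Complex.I by
      push_cast; ring, Complex.norm_exp_ofReal_mul_I]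
  have hker : ∀ s x ξ, kernel (x + s • v) ξ = kernel x ξ * e s ξ := fun s x ξ ↦ by
    simp only [kernel, he]
    rw [mul_assoc, ← Complex.exp_add, inner_add_left, real_inner_smul_left]
    congr 2
    push_cast
    ring
  have hderiv : ∀ (t : ℝ) (ξ : Rn n), HasDerivAt (fun s ↦ ∫ r in (0 : ℝ)..s, e r ξ) (e t ξ) t :=
    fun t ξ ↦ by
      have hc : Continuous fun s ↦ e s ξ := hec.comp (by fun_prop : Continuous fun s : ℝ ↦ (s, ξ))
      exact intervalIntegral.integral_hasDerivAt_right (hc.intervalIntegrable _ _)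
        (hc.stronglyMeasurableAtFilter _ _) hc.continuousAt
  have hmul : ∀ (t : ℝ) (ξ : Rn n), (Complex.I * (⟪v, ξ⟫_ℝ : ℝ)) * ∫ r in (0 : ℝ)..t, e r ξ =
      e t ξ - 1 := fun t ξ ↦ by
    rw [← intervalIntegral.integral_const_mul]
    have h1 : ∀ r ∈ uIcc 0 t, HasDerivAt (fun r ↦ e r ξ)
        (Complex.I * (⟪v, ξ⟫_ℝ : ℝ) * e r ξ) r := fun r _ ↦ by
      have h2 : HasDerivAt (fun r : ℝ ↦ (r : ℂ) * (Complex.I * (⟪v, ξ⟫_ℝ : ℝ)))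
          (1 * (Complex.I * (⟪v, ξ⟫_ℝ : ℝ))) r := (Complex.ofRealCLM.hasDerivAt).mul_const _
      have h3 := h2.cexp
      convert h3 using 1
      simp only [he]
      ring
    have hc : Continuous fun s ↦ e s ξ := hec.comp (by fun_prop : Continuous fun s : ℝ ↦ (s, ξ))
    rw [intervalIntegral.integral_eq_sub_of_hasDerivAt h1
      ((continuous_const.mul hc).intervalIntegrable _ _)]
    simp [he]
  have hm1 : ∀ t, IsScalarSymbol fun ξ : Rn n ↦ e t ξ - 1 := fun t ↦ by
    refine ⟨((hec.comp (by fun_prop : Continuous fun ξ : Rn n ↦ (t, ξ))).sub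
      continuous_const).measurable, 1 + 1, fun ξ ↦ ?_⟩
    exact (norm_sub_le _ _).trans (by rw [hen, norm_one])
  have hm2 : ∀ t, IsScalarSymbol fun ξ : Rn n ↦ ∫ r in (0 : ℝ)..t, e r ξ := fun t ↦ by
    refine ⟨Continuous.measurable ?_, 1 * |t - 0|, fun ξ ↦ ?_⟩
    · have hc : Continuous (Function.uncurry fun (ξ : Rn n) (r : ℝ) ↦ e r ξ) :=
        hec.comp continuous_swap
      exact intervalIntegral.continuous_parametric_intervalIntegral_of_continuous' hc 0 t
    · exact intervalIntegral.norm_integral_le_of_norm_le_const fun r _ ↦ (hen r ξ).le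
  have hwc : Continuous fun x ↦ w x := by
    have : (fun x ↦ w x) = fun x ↦ fderiv ℝ u x v := funext fun x ↦ (hw x).symm
    rw [this]
    exact (hu.continuous_fderiv one_ne_zero).clm_apply continuous_const
  have hki := integrable_kernel_smul hg.1
  have key : ∀ t : ℝ, 0 ≤ t → smult (fun ξ ↦ e t ξ - 1) u =
      smult (fun ξ ↦ ∫ r in (0 : ℝ)..t, e r ξ) w := by
    intro t ht
    ext1 x
    rw [(hg.smult (hm1 t)).apply_eq, (hh.smult (hm2 t)).apply_eq]
    have hl : ∫ ξ, kernel x ξ • (e t ξ - 1) • g ξ ∂τ = u (x + t • v) - u x := by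
      rw [hg.apply_eq, hg.apply_eq, ← integral_sub (hki _) (hki _)]
      refine integral_congr_ae (ae_of_all _ fun ξ ↦ ?_)
      simp only [hker]
      rw [smul_smul, ← sub_smul]
      congr 1
      ring
    have hftc : ∫ s in (0 : ℝ)..t, w (x + s • v) = u (x + t • v) - u x := by
      have hd : ∀ s ∈ uIcc 0 t, HasDerivAt (fun s : ℝ ↦ u (x + s • v)) (w (x + s • v)) s := by
        intro s _
        have h1 : HasDerivAt (fun s : ℝ ↦ x + s • v) v s := by
          simpa using ((hasDerivAt_id s).smul_const v).const_add x
        have h2 := ((hu.differentiable one_ne_zero) (x + s • v)).hasFDerivAt.comp_hasDerivAt s h1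
        rw [hw] at h2
        exact h2
      rw [intervalIntegral.integral_eq_sub_of_hasDerivAt hd
        (Continuous.intervalIntegrable (hwc.comp (by fun_prop)) _ _)]
      simp
    rw [hl, ← hftc]
    have hswap : Integrable (Function.uncurry fun (s : ℝ) (ξ : Rn n) ↦ kernel (x + s • v) ξ • h ξ)
        ((volume.restrict (Ioc 0 t)).prod τ) := by
      have h1 : Integrable (fun p : ℝ × Rn n ↦ h p.2) ((volume.restrict (Ioc 0 t)).prod τ) :=
        hh.1.comp_snd _
      have hc : Continuous fun p : ℝ × Rn n ↦ kernel (x + p.1 • v) p.2 := by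
        unfold kernel
        fun_prop
      exact h1.bdd_smul _ hc.aestronglyMeasurable (ae_of_all _ fun p ↦ (norm_kernel _ p.2).le)
    calc ∫ s in (0 : ℝ)..t, w (x + s • v)
        = ∫ s in (0 : ℝ)..t, (∫ ξ, kernel (x + s • v) ξ • h ξ ∂τ) := by simp only [hh.apply_eq]
      _ = ∫ ξ, (∫ s in (0 : ℝ)..t, kernel (x + s • v) ξ • h ξ) ∂τ := by
          simp only [intervalIntegral.integral_of_le ht]
          exact integral_integral_swap hswap
      _ = ∫ ξ, kernel x ξ • (∫ r in (0 : ℝ)..t, e r ξ) • h ξ ∂τ := by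
          refine integral_congr_ae (ae_of_all _ fun ξ ↦ ?_)
          simp only [hker]
          rw [intervalIntegral.integral_smul_const, intervalIntegral.integral_const_mul, mul_smul]
  have hae : ∀ᵐ ξ ∂τ, ∀ k : ℕ, (e ((k : ℝ) + 1)⁻¹ ξ - 1) • g ξ =
      (∫ r in (0 : ℝ)..((k : ℝ) + 1)⁻¹, e r ξ) • h ξ := by
    rw [ae_all_iff]
    intro k
    have := key ((k : ℝ) + 1)⁻¹ (by positivity)
    rwa [(hg.smult (hm1 _)).eq_iff (hh.smult (hm2 _))] at this
  filter_upwards [hae] with ξ hξ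
  -- the average over `[0, t]` tends to `1` as `t → 0`, so it does not vanish for small `t`
  have hlim : Tendsto (fun t : ℝ ↦ t⁻¹ • ∫ r in (0 : ℝ)..t, e r ξ) (𝓝[≠] 0) (𝓝 1) := by
    have h0 := (hderiv 0 ξ).tendsto_slope_zero
    simpa [he] using h0
  have hk : Tendsto (fun k : ℕ ↦ ((k : ℝ) + 1)⁻¹) atTop (𝓝[≠] 0) := by
    refine tendsto_nhdsWithin_iff.2 ⟨?_, Eventually.of_forall fun k ↦ ?_⟩
    · simpa using tendsto_one_div_add_atTop_nhds_zero_nat (𝕜 := ℝ)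
    · exact (by positivity : ((k : ℝ) + 1)⁻¹ ≠ 0)
  obtain ⟨k, hk⟩ := ((hlim.comp hk).eventually_ne one_ne_zero).exists
  have hne : ∫ r in (0 : ℝ)..((k : ℝ) + 1)⁻¹, e r ξ ≠ 0 := fun h0 ↦ hk (by simp [h0])
  have := hξ k
  rw [← hmul, mul_comm, mul_smul] at this
  exact (smul_right_injective _ hne this).symm

/-- The measurable functions with `|ξ|^i m(ξ)` bounded for `i ≤ k`. -/
def HasDecay (k : ℕ) (m : Rn n → ℂ) : Prop :=
  Measurable m ∧ ∀ i ≤ k, ∃ C, ∀ ξ, ‖ξ‖ ^ i * ‖m ξ‖ ≤ C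

theorem HasDecay.isScalarSymbol {k : ℕ} {m : Rn n → ℂ} (h : HasDecay k m) : IsScalarSymbol m := by
  obtain ⟨C, hC⟩ := h.2 0 k.zero_le
  exact ⟨h.1, C, fun ξ ↦ by simpa using hC ξ⟩

theorem HasDecay.mono {j k : ℕ} {m : Rn n → ℂ} (h : HasDecay k m) (hjk : j ≤ k) : HasDecay j m :=
  ⟨h.1, fun i hi ↦ h.2 i (hi.trans hjk)⟩

theorem HasDecay.mul_of_norm_le {j k : ℕ} {p m : Rn n → ℂ} (h : HasDecay (k + j) m)
    (hp : Measurable p) {D : ℝ} (hpD : ∀ ξ, ‖p ξ‖ ≤ D * ‖ξ‖ ^ j) :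
    HasDecay k fun ξ ↦ p ξ * m ξ := by
  refine ⟨hp.mul h.1, fun i hi ↦ ?_⟩
  obtain ⟨C, hC⟩ := h.2 (i + j) (by omega)
  refine ⟨|D| * C, fun ξ ↦ ?_⟩
  rw [norm_mul]
  calc ‖ξ‖ ^ i * (‖p ξ‖ * ‖m ξ‖) ≤ ‖ξ‖ ^ i * ((|D| * ‖ξ‖ ^ j) * ‖m ξ‖) := by
        gcongr
        refine (hpD ξ).trans ?_
        gcongr
        exact le_abs_self D
    _ = |D| * (‖ξ‖ ^ (i + j) * ‖m ξ‖) := by ring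
    _ ≤ |D| * C := by gcongr; exact hC ξ

theorem norm_I_mul_inner_le (v ξ : Rn n) : ‖Complex.I * (⟪v, ξ⟫_ℝ : ℝ)‖ ≤ ‖v‖ * ‖ξ‖ ^ 1 := by
  rw [norm_mul, Complex.norm_I, one_mul, Complex.norm_real, pow_one]
  exact norm_inner_le_norm v ξ

theorem HasDecay.inner_mul {k : ℕ} {m : Rn n → ℂ} (h : HasDecay (k + 1) m) (v : Rn n) :
    HasDecay k fun ξ ↦ Complex.I * (⟪v, ξ⟫_ℝ : ℝ) * m ξ :=
  h.mul_of_norm_le (by fun_prop) (norm_I_mul_inner_le v)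

theorem smult_of_fderiv {u w : FM n} {v : Rn n} (hu : ContDiff ℝ 1 u)
    (hw : ∀ x, fderiv ℝ u x v = w x) {m : Rn n → ℂ} (hm : HasDecay 1 m) :
    smult m w = smult (fun ξ ↦ Complex.I * (⟪v, ξ⟫_ℝ : ℝ) * m ξ) u := by
  obtain ⟨τ, _, g, h, hg, hh⟩ := exists_hasDensity_pair u w
  rw [(hh.smult hm.isScalarSymbol).eq_iff (hg.smult (hm.inner_mul v (k := 0)).isScalarSymbol)]
  filter_upwards [density_of_fderiv hu hw hg hh] with ξ hξ
  rw [hξ, smul_smul, mul_comm]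

/-- The functions `𝓕⁻¹(m f̂)` with a decaying symbol `m` are smooth. -/
theorem smult_mem_FMk {k : ℕ} {m : Rn n → ℂ} (hm : HasDecay k m) (f : FM n) :
    smult m f ∈ FMk n k := by
  obtain ⟨g, hg⟩ := exists_hasDensity_self f
  set τ := (FM.hat n f).1.variation with hτ
  have hmg := hg.smult hm.isScalarSymbol
  -- turns the kernel `e^{-2πi L(ξ, x)}` of `VectorFourier.fourierIntegral` into `e^{i x·ξ}`
  let L : Rn n →L[ℝ] Rn n →L[ℝ] ℝ := (-(2 * Real.pi)⁻¹) • innerSL ℝ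
  set c : ℂ := (((2 * Real.pi) ^ (-(n : ℝ) / 2) : ℝ) : ℂ) with hc
  have hpi : (Real.pi : ℂ) ≠ 0 := by exact_mod_cast Real.pi_ne_zero
  have hL : ∀ ξ x, L ξ x = -(2 * Real.pi)⁻¹ * ⟪ξ, x⟫_ℝ := fun _ _ ↦ rfl
  have hexp : ∀ x ξ : Rn n, c * ((Real.fourierChar (-L.toLinearMap₁₂ ξ x) : Circle) : ℂ) =
      kernel x ξ := by
    intro x ξ
    rw [kernel, Real.fourierChar_apply]
    congr 2
    change ((2 * Real.pi * -(L ξ x) : ℝ) : ℂ) * Complex.I = _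
    rw [hL, real_inner_comm]
    push_cast
    field_simp
  have hF : ∀ (a : Rn n → Cn n) (x : Rn n),
      VectorFourier.fourierIntegral Real.fourierChar τ L.toLinearMap₁₂ (fun ξ ↦ c • a ξ) x =
      ∫ ξ, kernel x ξ • a ξ ∂τ := by
    intro a x
    rw [VectorFourier.fourierIntegral]
    refine integral_congr_ae (ae_of_all _ fun ξ ↦ ?_)
    simp only [Circle.smul_def, smul_smul]
    rw [mul_comm, hexp]
  set G : Rn n → Cn n := fun ξ ↦ c • m ξ • g ξ with hG
  have hGm : AEStronglyMeasurable G τ := hmg.1.1.const_smul c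
  have hGi : ∀ i : ℕ, (i : ℕ∞) ≤ (k : ℕ∞) → Integrable (fun ξ ↦ ‖ξ‖ ^ i * ‖G ξ‖) τ := by
    intro i hi
    obtain ⟨C, hC⟩ := hm.2 i (by exact_mod_cast hi)
    refine (hg.1.norm.const_mul (‖c‖ * C)).mono' ?_ (ae_of_all _ fun ξ ↦ ?_)
    · exact (continuous_norm.pow i).aestronglyMeasurable.mul hGm.norm
    · rw [Real.norm_of_nonneg (by positivity)]
      simp only [hG, norm_smul]
      calc ‖ξ‖ ^ i * (‖c‖ * (‖m ξ‖ * ‖g ξ‖)) = ‖c‖ * (‖ξ‖ ^ i * ‖m ξ‖) * ‖g ξ‖ := by ring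
        _ ≤ ‖c‖ * C * ‖g ξ‖ := by gcongr; exact hC ξ
  have hu : (smult m f : Rn n → Cn n) =
      VectorFourier.fourierIntegral Real.fourierChar τ L.toLinearMap₁₂ G := by
    ext1 x
    rw [hG, hF, hmg.apply_eq]
  refine ⟨?_, fun j hj s ↦ ?_⟩
  · rw [hu]
    exact VectorFourier.contDiff_fourierIntegral L (N := k) hGi
  · have hd : HasDecay 0 fun ξ ↦ (∏ i, (Complex.I * (ξ (s i) : ℂ))) * m ξ := by
      refine (hm.mono (by omega : 0 + j ≤ k)).mul_of_norm_le (D := 1) (by fun_prop) fun ξ ↦ ?_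
      rw [norm_prod, one_mul]
      calc ∏ i, ‖Complex.I * (ξ (s i) : ℂ)‖ ≤ ∏ _i : Fin j, ‖ξ‖ := by
            refine Finset.prod_le_prod (fun i _ ↦ norm_nonneg _) fun i _ ↦ ?_
            rw [norm_mul, Complex.norm_I, one_mul, Complex.norm_real]
            exact PiLp.norm_apply_le ξ (s i)
        _ = ‖ξ‖ ^ j := by simp
    refine ⟨smult (fun ξ ↦ (∏ i, (Complex.I * (ξ (s i) : ℂ))) * m ξ) f, fun x ↦ ?_⟩
    rw [(hg.smult hd.isScalarSymbol).apply_eq, ← hF, hu,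
      VectorFourier.iteratedFDeriv_fourierIntegral L hGi hGm (by exact_mod_cast hj),
      Real.fourierIntegral_continuousMultilinearMap_apply'
        (VectorFourier.integrable_fourierPowSMulRight L (hGi j (by exact_mod_cast hj)) hGm)]
    congr 1
    ext1 ξ
    simp only [VectorFourier.fourierPowSMulRight_apply, hG]
    rw [← Complex.coe_smul, smul_smul, smul_smul, smul_smul, smul_smul]
    congr 1
    have : (-(2 * Real.pi * Complex.I)) ^ j * ((∏ i, L ξ (EuclideanSpace.single (s i) 1) : ℝ) : ℂ)
        = ∏ i, (Complex.I * (ξ (s i) : ℂ)) := by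
      rw [Complex.ofReal_prod, ← Fin.prod_const, ← Finset.prod_mul_distrib]
      refine Finset.prod_congr rfl fun i _ ↦ ?_
      rw [hL, EuclideanSpace.inner_single_right]
      simp
      field_simp
    rw [this]
    ring

end Derivative

/-! ### The scalar part of the differential operator -/

section DifferentialOperator

variable {n : ℕ}

theorem smult_sum_apply {ι : Type*} (s : Finset ι) {m : ι → Rn n → ℂ}
    (hm : ∀ i, IsScalarSymbol (m i)) (u : FM n) :
    IsScalarSymbol (fun ξ ↦ ∑ i ∈ s, m i ξ) ∧
      smult (fun ξ ↦ ∑ i ∈ s, m i ξ) u = ∑ i ∈ s, smult (m i) u := by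
  classical
  induction s using Finset.induction_on with
  | empty =>
    have h0 : IsScalarSymbol (fun _ : Rn n ↦ (0 : ℂ)) := ⟨measurable_const, 0, by simp⟩
    simp only [Finset.sum_empty]
    refine ⟨h0, ?_⟩
    have := smult_const_mul_apply h0 0 u
    simpa using this
  | insert i s his ih =>
    simp only [Finset.sum_insert his]
    exact ⟨(hm i).add ih.1, by rw [smult_add_apply (hm i) ih.1, ih.2]⟩

theorem FM.sum_apply {ι : Type*} (s : Finset ι) (w : ι → FM n) (x : Rn n) :
    (∑ i ∈ s, w i) x = ∑ i ∈ s, w i x := by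
  let ev : FM n →+ Cn n := ⟨⟨fun u ↦ u x, rfl⟩, fun _ _ ↦ rfl⟩
  exact map_sum ev w s

/-- A partial derivative corresponds to the symbol `i ξ_a`. As this symbol is unbounded, the
relation is expressed after the application of multipliers whose symbols decay. -/
theorem exists_partialDeriv {k : ℕ} {u : FM n} (hu : u ∈ FMk n (k + 1)) (a : Fin n) :
    ∃ w ∈ FMk n k, (∀ x, fderiv ℝ u x (EuclideanSpace.single a 1) = w x) ∧
      ∀ m, HasDecay 1 m → smult m w = smult (fun ξ ↦ Complex.I * (ξ a : ℂ) * m ξ) u := by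
  have hu1 : ContDiff ℝ 1 u := hu.1.of_le (by exact_mod_cast Nat.le_add_left 1 k)
  obtain ⟨w, hw⟩ := hu.2 1 (by omega) fun _ ↦ a
  have hw' : ∀ x, fderiv ℝ u x (EuclideanSpace.single a 1) = w x := fun x ↦ by
    rw [hw, iteratedFDeriv_one_apply]
  have hw'' : (w : Rn n → Cn n) = fun x ↦ fderiv ℝ u x (EuclideanSpace.single a 1) :=
    funext fun x ↦ (hw' x).symm
  have hd : ContDiff ℝ k (fderiv ℝ u) := hu.1.fderiv_right (by exact_mod_cast le_rfl)
  refine ⟨w, ⟨?_, fun j hj s ↦ ?_⟩, hw', fun m hm ↦ ?_⟩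
  · rw [hw'']
    exact hd.clm_apply contDiff_const
  · obtain ⟨z, hz⟩ := hu.2 (j + 1) (by omega) (Fin.snoc s a)
    refine ⟨z, fun x ↦ ?_⟩
    rw [hz, iteratedFDeriv_succ_apply_right, hw'']
    let ev : (Rn n →L[ℝ] Cn n) →L[ℝ] Cn n :=
      ContinuousLinearMap.apply ℝ (Cn n) (EuclideanSpace.single a (1 : ℝ))
    have h1 := ev.iteratedFDeriv_comp_left (hd.contDiffAt (x := x)) (i := j) (by exact_mod_cast hj)
    have h2 := congrArg (fun q ↦ q fun i ↦ EuclideanSpace.single (s i) (1 : ℝ)) h1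
    refine Eq.trans ?_ h2.symm
    simp only [ContinuousLinearMap.compContinuousMultilinearMap_coe, Function.comp_apply, ev,
      ContinuousLinearMap.apply_apply, Fin.snoc_last]
    congr 3
    ext1 i
    simp [Fin.init]
  · rw [smult_of_fderiv hu1 hw' hm]
    congr 2
    ext ξ
    simp [EuclideanSpace.inner_single_left]

theorem exists_fderiv_apply {u : FM n} (hu : u ∈ FMk n 4) (V : Rn n) :
    ∃ w : FM n, (∀ x, fderiv ℝ u x V = w x) ∧
      ∀ m, HasDecay 1 m → smult m w = smult (fun ξ ↦ Complex.I * (⟪V, ξ⟫_ℝ : ℝ) * m ξ) u := by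
  choose w _ hw' hw using fun a ↦ exists_partialDeriv (k := 3) hu a
  have hu1 : ContDiff ℝ 1 u := hu.1.of_le (by norm_num)
  have h1 : ∀ x, fderiv ℝ u x V = (∑ a, (V a : ℂ) • w a : FM n) x := by
    intro x
    have hV : V = ∑ a, V a • EuclideanSpace.single a (1 : ℝ) := by
      have := (EuclideanSpace.basisFun (Fin n) ℝ).sum_repr V
      simpa using this.symm
    rw [FM.sum_apply]
    conv_lhs => rw [hV]
    rw [map_sum]
    refine Finset.sum_congr rfl fun a _ ↦ ?_
    rw [map_smul, hw', FM.smul_apply, Complex.coe_smul]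
  exact ⟨_, h1, fun m hm ↦ smult_of_fderiv hu1 h1 hm⟩

theorem exists_laplacian {k : ℕ} {u : FM n} (hu : u ∈ FMk n (k + 2)) :
    ∃ w ∈ FMk n k, (w : Rn n → Cn n) = Δ (u : Rn n → Cn n) ∧
      ∀ m, HasDecay 2 m → smult m w = smult (fun ξ ↦ (-‖ξ‖ ^ 2 : ℝ) * m ξ) u := by
  choose w hwk hw' hw using fun a ↦ exists_partialDeriv (k := k + 1) hu a
  choose z hzk hz' hz using fun a ↦ exists_partialDeriv (k := k) (hwk a) a
  refine ⟨∑ a, z a, Submodule.sum_mem _ fun a _ ↦ hzk a, ?_, fun m hm ↦ ?_⟩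
  · ext1 x
    rw [FM.sum_apply, InnerProductSpace.laplacian_eq_iteratedFDeriv_orthonormalBasis _
      (EuclideanSpace.basisFun (Fin n) ℝ)]
    refine Finset.sum_congr rfl fun a _ ↦ ?_
    have hu2 : ContDiff ℝ 2 u := hu.1.of_le (by exact_mod_cast Nat.le_add_left 2 k)
    have hd : DifferentiableAt ℝ (fderiv ℝ (u : Rn n → Cn n)) x :=
      (hu2.fderiv_right (m := 1) (by norm_num)).differentiable one_ne_zero x
    have hwa : (w a : Rn n → Cn n) = fun x ↦ fderiv ℝ u x (EuclideanSpace.single a 1) :=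
      funext fun x ↦ (hw' a x).symm
    rw [iteratedFDeriv_two_apply, ← hz', hwa, fderiv_clm_apply hd (differentiableAt_const _)]
    simp
  · have hm2 : ∀ a, HasDecay 0 fun ξ : Rn n ↦ Complex.I * (ξ a : ℂ) *
        (Complex.I * (ξ a : ℂ) * m ξ) := fun a ↦ by
      have h1 := (hm.inner_mul (k := 1) (EuclideanSpace.single a 1)).inner_mul (k := 0)
        (EuclideanSpace.single a 1)
      simpa [EuclideanSpace.inner_single_left] using h1
    have hm1 : ∀ a, HasDecay 1 fun ξ : Rn n ↦ Complex.I * (ξ a : ℂ) * m ξ := fun a ↦ by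
      have h1 := hm.inner_mul (k := 1) (EuclideanSpace.single a 1)
      simpa [EuclideanSpace.inner_single_left] using h1
    rw [map_sum]
    have h2 : ∀ a, smult m (z a) = smult (fun ξ : Rn n ↦ Complex.I * (ξ a : ℂ) *
        (Complex.I * (ξ a : ℂ) * m ξ)) u := fun a ↦ by
      rw [hz a m (hm.mono (by norm_num)), hw a _ (hm1 a)]
    simp only [h2]
    rw [← (smult_sum_apply Finset.univ (fun a ↦ (hm2 a).isScalarSymbol) u).2]
    congr 2
    ext ξ
    rw [EuclideanSpace.real_norm_sq_eq]
    push_cast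
    rw [← Finset.sum_neg_distrib, Finset.sum_mul]
    refine Finset.sum_congr rfl fun a _ ↦ ?_
    linear_combination (ξ a : ℂ) ^ 2 * m ξ * Complex.I_sq

/-- The symbol `i λ₀ (V·ξ) + Γ₀ |ξ|² + Γ₂ |ξ|⁴` of `λ₀ (V·∇) - Γ₀ Δ + Γ₂ Δ²`. -/
def scalarSymbol (lam0 Γ0 Γ2 : ℝ) (V ξ : Rn n) : ℂ :=
  Complex.I * (⟪lam0 • V, ξ⟫_ℝ : ℝ) + (Γ0 * ‖ξ‖ ^ 2 + Γ2 * ‖ξ‖ ^ 4 : ℝ)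

/-- The scalar differential operator `λ₀ (V·∇) - Γ₀ Δ + Γ₂ Δ²` corresponds to `scalarSymbol`, after
the application of multipliers whose symbols decay. -/
theorem exists_scalar_part {u : FM n} (hu : u ∈ FMk n 4) (lam0 Γ0 Γ2 : ℝ) (V : Rn n) :
    ∃ w : FM n, (∀ x, w x = lam0 • fderiv ℝ u x V - Γ0 • Δ (u : Rn n → Cn n) x
        + Γ2 • Δ (Δ (u : Rn n → Cn n)) x) ∧
      ∀ m, HasDecay 4 m → smult m w = smult (fun ξ ↦ scalarSymbol lam0 Γ0 Γ2 V ξ * m ξ) u := by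
  obtain ⟨w₁, hw₁, h₁⟩ := exists_fderiv_apply hu (lam0 • V)
  obtain ⟨w₂, hk₂, hw₂, h₂⟩ := exists_laplacian (k := 2) hu
  obtain ⟨w₃, hk₃, hw₃, h₃⟩ := exists_laplacian (k := 0) hk₂
  refine ⟨w₁ + ((-Γ0 : ℝ) : ℂ) • w₂ + (Γ2 : ℂ) • w₃, fun x ↦ ?_, fun m hm ↦ ?_⟩
  · rw [FM.add_apply, FM.add_apply, FM.smul_apply, FM.smul_apply, ← hw₁, hw₃, hw₂, map_smul,
      Complex.coe_smul, Complex.coe_smul, neg_smul, sub_eq_add_neg]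
  · have hsq : ∀ {k : ℕ} {m : Rn n → ℂ}, HasDecay (k + 2) m →
        HasDecay k fun ξ ↦ ((-‖ξ‖ ^ 2 : ℝ) : ℂ) * m ξ := fun hm ↦
      hm.mul_of_norm_le (D := 1) (by fun_prop) fun ξ ↦ by
        rw [Complex.norm_real]
        simp
    have hm₁ := ((hm.mono (by norm_num : 0 + 1 ≤ 4)).inner_mul (lam0 • V)).isScalarSymbol
    have hm₂ := ((hsq (k := 2) hm).isScalarSymbol).const_mul ((-Γ0 : ℝ) : ℂ)
    have hm₃ := ((hsq (k := 0) (hsq (k := 2) hm)).isScalarSymbol).const_mul (Γ2 : ℂ)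
    rw [map_add, map_add, map_smul, map_smul, h₁ m (hm.mono (by norm_num)),
      h₂ m (hm.mono (by norm_num)), h₃ m (hm.mono (by norm_num)), h₂ _ (hsq (k := 2) hm),
      ← smult_const_mul_apply (hsq (k := 2) hm).isScalarSymbol,
      ← smult_const_mul_apply (hsq (k := 0) (hsq (k := 2) hm)).isScalarSymbol,
      ← smult_add_apply hm₁ hm₂, ← smult_add_apply (hm₁.add hm₂) hm₃]
    congr 2
    ext ξ
    rw [scalarSymbol]
    push_cast
    ring

end DifferentialOperator

/-! ### Estimates of the symbol, bounded perturbations, scalar multipliers on solenoidal fields -/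

section Symbol

variable {n : ℕ}

/-- A point `q` of the sector `|arg q| ≤ π / 4` and a point `z` whose argument has cosine at most
`1 / 4` are separated, uniformly on each scale. -/
theorem norm_add_norm_le_of_re_le {z q : ℂ} (hz : z.re ≤ ‖z‖ / 4) (hq : |q.im| ≤ q.re) :
    ‖z‖ + ‖q‖ ≤ 16 * ‖z - q‖ := by
  have hq2 : ‖q‖ ≤ 2 * q.re := by
    have h1 := Complex.norm_le_abs_re_add_abs_im q
    rw [abs_of_nonneg ((abs_nonneg _).trans hq)] at h1
    linarith
  -- compare the directions of `q` and `z`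
  have h1 : ‖z‖ * ‖q‖ / 4 ≤ ‖(‖z‖ : ℂ) * q - (‖q‖ : ℂ) * z‖ := by
    refine le_trans ?_ (Complex.re_le_norm _)
    rw [Complex.sub_re, Complex.re_ofReal_mul, Complex.re_ofReal_mul]
    nlinarith [norm_nonneg z, norm_nonneg q]
  have hsub : |‖z‖ - ‖q‖| ≤ ‖z - q‖ := abs_norm_sub_norm_le z q
  have h2 : ‖(‖z‖ : ℂ) * q - (‖q‖ : ℂ) * z‖ ≤ 2 * ‖z‖ * ‖z - q‖ := by
    have e : (‖z‖ : ℂ) * q - (‖q‖ : ℂ) * z =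
        -((‖z‖ : ℂ) * (z - q)) + ((‖z‖ - ‖q‖ : ℝ) : ℂ) * z := by push_cast; ring
    rw [e]
    refine (norm_add_le _ _).trans ?_
    rw [norm_neg, norm_mul, norm_mul, Complex.norm_real, Complex.norm_real, norm_norm,
      Real.norm_eq_abs]
    nlinarith [norm_nonneg z]
  have h3 : ‖(‖z‖ : ℂ) * q - (‖q‖ : ℂ) * z‖ ≤ 2 * ‖q‖ * ‖z - q‖ := by
    have e : (‖z‖ : ℂ) * q - (‖q‖ : ℂ) * z =
        -((‖q‖ : ℂ) * (z - q)) + ((‖z‖ - ‖q‖ : ℝ) : ℂ) * q := by push_cast; ring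
    rw [e]
    refine (norm_add_le _ _).trans ?_
    rw [norm_neg, norm_mul, norm_mul, Complex.norm_real, Complex.norm_real, norm_norm,
      Real.norm_eq_abs]
    nlinarith [norm_nonneg q]
  have hq8 : ‖q‖ ≤ 8 * ‖z - q‖ := by
    rcases (norm_nonneg z).eq_or_lt with h0 | h0
    · rw [← h0, zero_sub, abs_neg, abs_norm] at hsub
      linarith [norm_nonneg (z - q)]
    · have : ‖z‖ * ‖q‖ ≤ ‖z‖ * (8 * ‖z - q‖) := by linarith
      exact le_of_mul_le_mul_left this h0
  have hz8 : ‖z‖ ≤ 8 * ‖z - q‖ := by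
    rcases (norm_nonneg q).eq_or_lt with h0 | h0
    · rw [← h0, sub_zero, abs_norm] at hsub
      linarith [norm_nonneg (z - q)]
    · have : ‖q‖ * ‖z‖ ≤ ‖q‖ * (8 * ‖z - q‖) := by linarith
      exact le_of_mul_le_mul_left this h0
  linarith

theorem norm_add_le_of_re_nonneg {z : ℂ} (hz : 0 ≤ z.re) {s : ℝ} (hs : 0 ≤ s) :
    ‖z‖ ≤ ‖z + s‖ ∧ s ≤ ‖z + s‖ := by
  constructor
  · rw [Complex.norm_def, Complex.norm_def]
    refine Real.sqrt_le_sqrt ?_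
    simp only [Complex.normSq_apply, Complex.add_re, Complex.ofReal_re, Complex.add_im,
      Complex.ofReal_im, add_zero]
    nlinarith
  · refine le_trans ?_ (Complex.re_le_norm _)
    simpa using hz

theorem continuous_scalarSymbol (lam0 Γ0 Γ2 : ℝ) (V : Rn n) :
    Continuous (scalarSymbol lam0 Γ0 Γ2 V) := by
  unfold scalarSymbol
  fun_prop

/-- After a large shift the scalar symbol takes values in the sector `|arg q| ≤ π / 4`, away from
the origin, and its growth is of order four. -/
theorem exists_shift_scalarSymbol (lam0 Γ0 : ℝ) {Γ2 : ℝ} (hΓ2 : 0 < Γ2) (V : Rn n) (Λ : ℝ)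
    (hΛ : 0 < Λ) : ∃ ω : ℝ, 0 < ω ∧ ∀ ξ : Rn n,
      |((ω : ℂ) + scalarSymbol lam0 Γ0 Γ2 V ξ).im| ≤ ((ω : ℂ) + scalarSymbol lam0 Γ0 Γ2 V ξ).re ∧
      Λ ≤ ((ω : ℂ) + scalarSymbol lam0 Γ0 Γ2 V ξ).re ∧
      1 + ‖ξ‖ ^ 4 ≤ 2 / Γ2 * ((ω : ℂ) + scalarSymbol lam0 Γ0 Γ2 V ξ).re := by
  set v : ℝ := ‖lam0 • V‖ with hv
  have hv0 : 0 ≤ v := norm_nonneg _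
  set k : ℝ := |Γ0| + v with hk
  set ω : ℝ := Λ + v + Γ2 / 2 + k ^ 2 / (2 * Γ2) with hω
  have hω0 : 0 < ω := by positivity
  refine ⟨ω, hω0, fun ξ ↦ ?_⟩
  set t : ℝ := ‖ξ‖ with ht
  have ht0 : 0 ≤ t := norm_nonneg _
  have hre : ((ω : ℂ) + scalarSymbol lam0 Γ0 Γ2 V ξ).re = ω + (Γ0 * t ^ 2 + Γ2 * t ^ 4) := by
    rw [scalarSymbol, Complex.add_re, Complex.add_re, Complex.ofReal_re, Complex.ofReal_re,
      Complex.I_mul_re, Complex.ofReal_im]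
    simp [ht]
  have him : ((ω : ℂ) + scalarSymbol lam0 Γ0 Γ2 V ξ).im = ⟪lam0 • V, ξ⟫_ℝ := by
    rw [scalarSymbol, Complex.add_im, Complex.add_im, Complex.ofReal_im, Complex.ofReal_im,
      Complex.I_mul_im, Complex.ofReal_re]
    simp
  have hin : |⟪lam0 • V, ξ⟫_ℝ| ≤ v * t := abs_real_inner_le_norm _ _
  -- completing the square in `t²`
  have hsq : k * t ^ 2 ≤ Γ2 / 2 * t ^ 4 + k ^ 2 / (2 * Γ2) := by
    have h1 : 0 ≤ (Γ2 * t ^ 2 - k) ^ 2 / (2 * Γ2) := by positivity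
    have h2 : (Γ2 * t ^ 2 - k) ^ 2 / (2 * Γ2) =
        Γ2 / 2 * t ^ 4 + k ^ 2 / (2 * Γ2) - k * t ^ 2 := by
      field_simp
      ring
    linarith
  have hvt : v * t ≤ v * (1 + t ^ 2) := by
    gcongr
    nlinarith [sq_nonneg (t - 1)]
  have hΓ0 : -(|Γ0| * t ^ 2) ≤ Γ0 * t ^ 2 := by
    nlinarith [neg_abs_le Γ0, sq_nonneg t]
  have hmain : Λ + v * t + Γ2 / 2 * (1 + t ^ 4) ≤ ω + (Γ0 * t ^ 2 + Γ2 * t ^ 4) := by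
    rw [hk] at hsq
    rw [hω, hk]
    nlinarith
  have hpos : 0 ≤ Γ2 / 2 * (1 + t ^ 4) := by positivity
  have hvt0 : 0 ≤ v * t := by positivity
  rw [hre, him]
  refine ⟨by linarith, by linarith, ?_⟩
  have h1 : Γ2 / 2 * (1 + t ^ 4) ≤ ω + (Γ0 * t ^ 2 + Γ2 * t ^ 4) := by linarith
  calc 1 + t ^ 4 = 2 / Γ2 * (Γ2 / 2 * (1 + t ^ 4)) := by field_simp
    _ ≤ _ := by gcongr

theorem hasDecay_four_of_le {m : Rn n → ℂ} (hm : Measurable m) {C : ℝ}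
    (hC : ∀ ξ, (1 + ‖ξ‖ ^ 4) * ‖m ξ‖ ≤ C) : HasDecay 4 m := by
  refine ⟨hm, fun i hi ↦ ⟨C, fun ξ ↦ le_trans ?_ (hC ξ)⟩⟩
  gcongr
  rcases le_total ‖ξ‖ 1 with h | h
  · have := pow_le_one₀ (n := i) (norm_nonneg ξ) h
    have h4 : 0 ≤ ‖ξ‖ ^ 4 := by positivity
    linarith
  · have := pow_le_pow_right₀ h hi
    linarith

theorem setLIntegral_scale {s : ℝ} (hs : 0 < s) :
    ∫⁻ r in Ioi (0 : ℝ), ENNReal.ofReal (s / (r + s) ^ 2) = 1 := by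
  have hd : ∀ r ∈ Ici (0 : ℝ), HasDerivAt (fun r : ℝ ↦ -(s / (r + s))) (s / (r + s) ^ 2) r := by
    intro r hr
    have hne : r + s ≠ 0 := by linarith [mem_Ici.1 hr]
    have h := (((hasDerivAt_id r).add_const s).inv hne).const_mul (-s)
    have e : (fun r : ℝ ↦ -(s / (r + s))) = fun y ↦ -s * (fun x ↦ id x + s)⁻¹ y := by
      funext y
      simp [div_eq_mul_inv]
    rw [e]
    refine h.congr_deriv ?_
    simp only [id]
    field_simp
  have hlim : Tendsto (fun r : ℝ ↦ -(s / (r + s))) atTop (𝓝 0) := by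
    have := (tendsto_const_nhds (x := s)).div_atTop (tendsto_atTop_add_const_right _ s tendsto_id)
    simpa using this.neg
  have hnn : ∀ r ∈ Ioi (0 : ℝ), 0 ≤ s / (r + s) ^ 2 := fun r hr ↦ by positivity
  have hi := integrableOn_Ioi_deriv_of_nonneg' hd hnn hlim
  rw [← ofReal_integral_eq_lintegral_ofReal hi
    ((ae_restrict_iff' measurableSet_Ioi).2 (ae_of_all _ hnn)),
    integral_Ioi_of_hasDerivAt_of_nonneg' hd hnn hlim]
  simp [hs.ne']

end Symbol

section Perturbation

variable {X : Type*} [NormedAddCommGroup X] [NormedSpace ℂ X]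

/-- The resolvent of a bounded perturbation: `R = (1 - R₀ B)⁻¹ R₀`. -/
theorem exists_perturbed_resolvent [CompleteSpace X] {R₀ B : X →L[ℂ] X} {a : ℝ}
    (ha : ‖R₀‖ ≤ a) (h : a * ‖B‖ ≤ 1 / 2) : ∃ R : X →L[ℂ] X, R - R₀ = R₀ * B * R ∧
      (∀ u y, R₀ y = u - R₀ (B u) → R y = u) ∧ ‖R‖ ≤ 2 * a ∧ ‖R - R₀‖ ≤ 2 * ‖B‖ * a ^ 2 := by
  have ha0 : 0 ≤ a := (norm_nonneg _).trans ha
  have hB : ‖R₀ * B‖ ≤ a * ‖B‖ := (norm_mul_le _ _).trans (by gcongr)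
  have hB2 : ‖R₀ * B‖ ≤ 1 / 2 := hB.trans h
  let U : (X →L[ℂ] X)ˣ := Units.oneSub (R₀ * B) (by linarith)
  have hU : (U : X →L[ℂ] X) = 1 - R₀ * B := rfl
  set R : X →L[ℂ] X := ↑U⁻¹ * R₀ with hR
  have h1 : R - R₀ = R₀ * B * R := by
    have : (U : X →L[ℂ] X) * R = R₀ := by rw [hR, ← mul_assoc, Units.mul_inv, one_mul]
    rw [hU, sub_mul, one_mul] at this
    exact sub_eq_iff_eq_add'.2 (sub_eq_iff_eq_add.1 this)
  have h2 : ‖R‖ ≤ 2 * a := by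
    have : R = R₀ + R₀ * B * R := by rw [← h1]; abel
    have h3 : ‖R‖ ≤ a + 1 / 2 * ‖R‖ :=
      calc ‖R‖ = ‖R₀ + R₀ * B * R‖ := by rw [← this]
        _ ≤ ‖R₀‖ + ‖R₀ * B‖ * ‖R‖ := (norm_add_le _ _).trans (by gcongr; exact norm_mul_le _ _)
        _ ≤ a + 1 / 2 * ‖R‖ := by gcongr
    linarith
  refine ⟨R, h1, fun u y huy ↦ ?_, h2, ?_⟩
  · have h3 : R₀ y = (U : X →L[ℂ] X) u := huy
    change (↑U⁻¹ : X →L[ℂ] X) (R₀ y) = u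
    rw [h3]
    change ((↑U⁻¹ : X →L[ℂ] X) * (U : X →L[ℂ] X)) u = u
    rw [Units.inv_mul]
    rfl
  · rw [h1]
    calc ‖R₀ * B * R‖ ≤ ‖R₀ * B‖ * ‖R‖ := norm_mul_le _ _
      _ ≤ (a * ‖B‖) * (2 * a) := by gcongr
      _ = 2 * ‖B‖ * a ^ 2 := by ring

end Perturbation

section SolenoidalMultiplier

variable {n : ℕ}

theorem norm_solMult_le {m : Rn n → ℂ} (hm : Measurable m) {C : ℝ} (hC0 : 0 ≤ C)
    (hC : ∀ ξ, ‖m ξ‖ ≤ C) : ‖solMult m‖ ≤ C := by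
  refine ContinuousLinearMap.opNorm_le_bound _ hC0 fun u ↦ ?_
  change ‖(solMult m u : FM n)‖ ≤ C * ‖(u : FM n)‖
  rw [coe_solMult ⟨hm, C, hC⟩]
  exact norm_smult_le hm hC _

theorem solMult_mul {m k : Rn n → ℂ} (hm : IsScalarSymbol m) (hk : IsScalarSymbol k) :
    solMult m * solMult k = solMult fun ξ ↦ m ξ * k ξ := by
  ext1 u
  refine Subtype.ext ?_
  change (solMult m (solMult k u) : FM n) = _
  rw [coe_solMult hm, coe_solMult hk, coe_solMult (hm.mul hk), smult_smult hm hk]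

theorem solMult_add {m k : Rn n → ℂ} (hm : IsScalarSymbol m) (hk : IsScalarSymbol k) :
    solMult (fun ξ ↦ m ξ + k ξ) = solMult m + solMult k := by
  ext1 u
  refine Subtype.ext ?_
  change _ = (solMult m u : FM n) + solMult k u
  rw [coe_solMult hm, coe_solMult hk, coe_solMult (hm.add hk), smult_add_apply hm hk]

theorem solMult_const_mul {m : Rn n → ℂ} (hm : IsScalarSymbol m) (c : ℂ) :
    solMult (fun ξ ↦ c * m ξ) = c • solMult m := by
  ext1 u
  refine Subtype.ext ?_
  change _ = c • (solMult m u : FM n)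
  rw [coe_solMult hm, coe_solMult (hm.const_mul c), smult_const_mul_apply hm c]

theorem solMult_sub {m k : Rn n → ℂ} (hm : IsScalarSymbol m) (hk : IsScalarSymbol k) :
    solMult (fun ξ ↦ m ξ - k ξ) = solMult m - solMult k := by
  have e : (fun ξ ↦ m ξ - k ξ) = fun ξ ↦ m ξ + (-1) * k ξ := by
    ext ξ
    ring
  rw [e, solMult_add hm (hk.const_mul _), solMult_const_mul hk, sub_eq_add_neg]
  congr 1
  exact neg_one_smul ℂ (solMult k)

theorem solMult_one : solMult (fun _ : Rn n ↦ 1) = 1 := by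
  ext1 u
  refine Subtype.ext ?_
  rw [coe_solMult ⟨measurable_const, 1, by simp⟩, smult_one]
  rfl

theorem solMult_injective {m : Rn n → ℂ} (hm : IsScalarSymbol m) (h0 : ∀ ξ, m ξ ≠ 0) :
    Function.Injective (solMult m) := by
  intro u v huv
  have := congrArg Subtype.val huv
  rw [coe_solMult hm, coe_solMult hm] at this
  exact Subtype.ext (smult_injective hm h0 this)

theorem enorm_solMult_apply {m : Rn n → ℂ} (hm : IsScalarSymbol m) {u : FM0sol n}
    {τ : Measure (Rn n)} {g : Rn n → Cn n} (hg : HasDensity (u : FM n) τ g) :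
    ‖solMult m u‖ₑ = ∫⁻ ξ, ‖m ξ‖ₑ * ‖g ξ‖ₑ ∂τ := by
  have : ‖solMult m u‖ₑ = ‖smult m (u : FM n)‖ₑ := by
    rw [← coe_solMult hm]
    rfl
  rw [this, (hg.smult hm).enorm_eq]
  simp only [enorm_smul]

/-- The fields in `FM_{0,σ}(ℝⁿ)` of class `FM⁴` are dense, by cutting off high frequencies. -/
theorem dense_FMk : Dense {u : FM0sol n | (u : FM n) ∈ FMk n 4} := by
  intro u
  obtain ⟨g, hg⟩ := exists_hasDensity_self (u : FM n)
  set τ := (FM.hat n (u : FM n)).1.variation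
  let S : ℕ → Set (Rn n) := fun k ↦ Metric.closedBall 0 k
  let m : ℕ → Rn n → ℂ := fun k ↦ (S k).indicator 1
  have hmeas : ∀ k, Measurable (m k) := fun k ↦
    measurable_one.indicator Metric.isClosed_closedBall.measurableSet
  have hm : ∀ k, HasDecay 4 (m k) := fun k ↦ by
    refine hasDecay_four_of_le (hmeas k) (C := 1 + (k : ℝ) ^ 4) fun ξ ↦ ?_
    by_cases h : ξ ∈ S k
    · simp only [m, indicator_of_mem h, Pi.one_apply, norm_one, mul_one]
      gcongr
      simpa [S] using h
    · simp only [m, indicator_of_notMem h, norm_zero, mul_zero]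
      positivity
  have hm' : ∀ k, IsScalarSymbol fun ξ ↦ m k ξ - 1 := fun k ↦ by
    refine ⟨(hmeas k).sub_const 1, 1, fun ξ ↦ ?_⟩
    by_cases h : ξ ∈ S k <;> simp [m, h]
  refine mem_closure_of_tendsto (f := fun k ↦ solMult (m k) u) (b := atTop) ?_
    (Eventually.of_forall fun k ↦ ?_)
  · rw [tendsto_iff_norm_sub_tendsto_zero]
    have e : ∀ k, ‖solMult (m k) u - u‖ = ∫ ξ, ‖(m k ξ - 1) • g ξ‖ ∂τ := by
      intro k
      have h1 : solMult (m k) u - u = solMult (fun ξ ↦ m k ξ - 1) u := by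
        rw [solMult_sub (hm k).isScalarSymbol ⟨measurable_const, 1, by simp⟩, solMult_one]
        rfl
      rw [h1, ← (hg.smult (hm' k)).norm_eq, ← coe_solMult (hm' k)]
      rfl
    simp only [e]
    have h0 : ∫ _ξ : Rn n, (0 : ℝ) ∂τ = 0 := by simp
    rw [← h0]
    refine tendsto_integral_of_dominated_convergence (fun ξ ↦ ‖g ξ‖)
      (fun k ↦ (hg.smult (hm' k)).1.1.norm) hg.1.norm (fun k ↦ ae_of_all _ fun ξ ↦ ?_)
      (ae_of_all _ fun ξ ↦ ?_)
    · rw [norm_norm, norm_smul]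
      by_cases h : ξ ∈ S k <;> simp [m, h]
    · refine tendsto_const_nhds.congr' ?_
      obtain ⟨N, hN⟩ := exists_nat_ge ‖ξ‖
      filter_upwards [eventually_ge_atTop N] with k hk
      have h : ξ ∈ S k := by
        simp only [S, mem_closedBall_zero_iff]
        exact hN.trans (by exact_mod_cast hk)
      simp [m, h]
  · change (solMult (m k) u : FM n) ∈ FMk n 4
    rw [coe_solMult (hm k).isScalarSymbol]
    exact smult_mem_FMk (hm k) _

end SolenoidalMultiplier

/-! ### Resolvents of the shifted operator and their comparison -/

section Operator

variable {n : ℕ} {lam0 Γ0 Γ2 : ℝ} {V : Rn n} {M : Matrix (Fin n) (Fin n) ℝ}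

/-- The scalar differential operator preserves solenoidal fields, so that `A_LF` is this operator
plus `u ↦ P M u`, both in `FM_{0,σ}(ℝⁿ)`. -/
theorem exists_solenoidal_scalar_part {u : FM0sol n} (hu : (u : FM n) ∈ FMk n 4)
    (lam0 Γ0 Γ2 : ℝ) (V : Rn n) (M : Matrix (Fin n) (Fin n) ℝ) :
    ∃ w : FM0sol n, (u, w + helmholtzMatMul M u) ∈ graphALF n lam0 Γ0 Γ2 V M ∧
      ∀ m, HasDecay 4 m →
        solMult m w = solMult (fun ξ ↦ scalarSymbol lam0 Γ0 Γ2 V ξ * m ξ) u := by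
  obtain ⟨w, hw, hm⟩ := exists_scalar_part hu lam0 Γ0 Γ2 V
  have hp : ∀ m : Rn n → ℂ, HasDecay 4 m →
      IsScalarSymbol fun ξ ↦ scalarSymbol lam0 Γ0 Γ2 V ξ * m ξ := by
    intro m hm
    have h1 := ((hm.mono (by norm_num : 0 + 1 ≤ 4)).inner_mul (lam0 • V)).isScalarSymbol
    have h2 := (hm.mono (by norm_num : 0 + 2 ≤ 4)).mul_of_norm_le
      (p := fun ξ : Rn n ↦ ((Γ0 * ‖ξ‖ ^ 2 : ℝ) : ℂ)) (D := |Γ0|) (by fun_prop) fun ξ ↦ by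
        rw [Complex.norm_real]; simp
    have h4 := (hm.mono (by norm_num : 0 + 4 ≤ 4)).mul_of_norm_le
      (p := fun ξ : Rn n ↦ ((Γ2 * ‖ξ‖ ^ 4 : ℝ) : ℂ)) (D := |Γ2|) (by fun_prop) fun ξ ↦ by
        rw [Complex.norm_real]; simp
    convert (h1.add h2.isScalarSymbol).add h4.isScalarSymbol using 1
    ext ξ
    rw [scalarSymbol]
    push_cast
    ring
  let m₀ : Rn n → ℂ := fun ξ ↦ ((1 + ‖ξ‖ ^ 4 : ℝ) : ℂ)⁻¹
  have hm₀ : HasDecay 4 m₀ := by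
    refine hasDecay_four_of_le (by fun_prop) (C := 1) fun ξ ↦ ?_
    have h1 : 0 < 1 + ‖ξ‖ ^ 4 := by positivity
    rw [norm_inv, Complex.norm_real, Real.norm_of_nonneg h1.le, mul_inv_cancel₀ h1.ne']
  have hne : ∀ ξ, m₀ ξ ≠ 0 := fun ξ ↦ by
    have h1 : (0 : ℝ) < 1 + ‖ξ‖ ^ 4 := by positivity
    exact inv_ne_zero (by exact_mod_cast h1.ne')
  have hwmem : w ∈ FM0sol n := by
    refine mem_FM0sol_of_smult hm₀.isScalarSymbol hne ?_
    rw [hm m₀ hm₀]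
    exact smult_mem_FM0sol (hp m₀ hm₀) u.2
  refine ⟨⟨w, hwmem⟩, ⟨hu, fun x ↦ ?_⟩, fun m hmd ↦ ?_⟩
  · change (w + (helmholtzMatMul M u : FM n)) x = _
    rw [coe_helmholtzMatMul, FM.add_apply, hw, linExpr]
    abel
  · refine Subtype.ext ?_
    rw [coe_solMult hmd.isScalarSymbol, coe_solMult (hp m hmd)]
    exact hm m hmd

theorem mem_domain_ALF_iff {u : FM0sol n} :
    u ∈ (ALF n lam0 Γ0 Γ2 V M).domain ↔ (u : FM n) ∈ FMk n 4 := by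
  rw [LinearPMap.mem_domain_iff]
  simp only [graph_ALF]
  constructor
  · rintro ⟨f, hf⟩
    exact hf.1
  · intro hu
    obtain ⟨w, hw, -⟩ := exists_solenoidal_scalar_part hu lam0 Γ0 Γ2 V M
    exact ⟨_, hw⟩

/-- The resolvent of `ω + A_LF` is obtained from the multiplier `(z - ω - p)⁻¹`, with `p` the scalar
symbol, by perturbation with `u ↦ P M u`. -/
theorem isResolventAt_shift_ALF {ω z : ℂ}
    (hne : ∀ ξ, z - (ω + scalarSymbol lam0 Γ0 Γ2 V ξ) ≠ 0)
    (hd : HasDecay 4 fun ξ ↦ (z - (ω + scalarSymbol lam0 Γ0 Γ2 V ξ))⁻¹)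
    {R : FM0sol n →L[ℂ] FM0sol n}
    (hR : R - solMult (fun ξ ↦ (z - (ω + scalarSymbol lam0 Γ0 Γ2 V ξ))⁻¹) =
      solMult (fun ξ ↦ (z - (ω + scalarSymbol lam0 Γ0 Γ2 V ξ))⁻¹) * helmholtzMatMul M * R)
    (hR' : ∀ u y, solMult (fun ξ ↦ (z - (ω + scalarSymbol lam0 Γ0 Γ2 V ξ))⁻¹) y =
      u - solMult (fun ξ ↦ (z - (ω + scalarSymbol lam0 Γ0 Γ2 V ξ))⁻¹) (helmholtzMatMul M u) →
      R y = u) :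
    IsResolventAt (shift ω (ALF n lam0 Γ0 Γ2 V M)) z R := by
  set m : Rn n → ℂ := fun ξ ↦ (z - (ω + scalarSymbol lam0 Γ0 Γ2 V ξ))⁻¹ with hm
  have hms := hd.isScalarSymbol
  -- on the domain, `m` inverts `z - ω - p`
  have key : ∀ u : FM0sol n, ∀ h : u ∈ (ALF n lam0 Γ0 Γ2 V M).domain, ∃ w : FM0sol n,
      shift ω (ALF n lam0 Γ0 Γ2 V M) ⟨u, h⟩ = ω • u + (w + helmholtzMatMul M u) ∧
      solMult m (z • u - (ω • u + w)) = u := by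
    intro u h
    obtain ⟨w, hw, hmw⟩ := exists_solenoidal_scalar_part (mem_domain_ALF_iff.1 h) lam0 Γ0 Γ2 V M
    refine ⟨w, ?_, ?_⟩
    · have h1 : ALF n lam0 Γ0 Γ2 V M ⟨u, h⟩ = w + helmholtzMatMul M u := by
        rw [← graph_ALF, LinearPMap.mem_graph_iff] at hw
        obtain ⟨y, hy, hy'⟩ := hw
        have : y = ⟨u, h⟩ := Subtype.ext hy
        rw [this] at hy'
        exact hy'
      change ω • u + ALF n lam0 Γ0 Γ2 V M ⟨u, h⟩ = _
      rw [h1]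
    · have hpm : IsScalarSymbol fun ξ ↦ scalarSymbol lam0 Γ0 Γ2 V ξ * m ξ := by
        have e : (fun ξ ↦ scalarSymbol lam0 Γ0 Γ2 V ξ * m ξ) =
            fun ξ ↦ (z - ω) * m ξ + (-1) := by
          ext ξ
          have := mul_inv_cancel₀ (hne ξ)
          simp only [hm]
          linear_combination -this
        rw [e]
        exact (hms.const_mul _).add ⟨measurable_const, ‖(-1 : ℂ)‖, fun _ ↦ le_rfl⟩
      rw [map_sub, map_add, map_smul, map_smul, hmw m hd]
      have e : solMult (fun ξ ↦ (z - ω) * m ξ - scalarSymbol lam0 Γ0 Γ2 V ξ * m ξ) =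
          (z - ω) • solMult m - solMult fun ξ ↦ scalarSymbol lam0 Γ0 Γ2 V ξ * m ξ := by
        rw [solMult_sub (hms.const_mul _) hpm, solMult_const_mul hms]
      have e1 : (fun ξ ↦ (z - ω) * m ξ - scalarSymbol lam0 Γ0 Γ2 V ξ * m ξ) = fun _ ↦ 1 := by
        ext ξ
        have := mul_inv_cancel₀ (hne ξ)
        simp only [hm]
        linear_combination this
      rw [e1, solMult_one] at e
      have e2 := congrArg (fun T : FM0sol n →L[ℂ] FM0sol n ↦ T u) e
      change u = (z - ω) • solMult m u - solMult _ u at e2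
      rw [sub_smul] at e2
      rw [← sub_sub]
      exact e2.symm
  constructor
  · intro f
    have hRf : R f = solMult m (f + helmholtzMatMul M (R f)) := by
      have h1 := congrArg (fun T : FM0sol n →L[ℂ] FM0sol n ↦ T f) hR
      change R f - solMult m f = solMult m (helmholtzMatMul M (R f)) at h1
      rw [map_add, ← h1]
      abel
    have hmem : R f ∈ (ALF n lam0 Γ0 Γ2 V M).domain := by
      rw [mem_domain_ALF_iff, hRf, coe_solMult hms]
      exact smult_mem_FMk hd _
    refine ⟨hmem, ?_⟩
    obtain ⟨w, hw, hmw⟩ := key _ hmem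
    rw [hw]
    have hinj := solMult_injective hms (fun ξ ↦ inv_ne_zero (hne ξ)) (hmw.trans hRf)
    rw [← add_assoc, ← sub_sub, hinj]
    abel
  · rintro ⟨u, h⟩
    obtain ⟨w, hw, hmw⟩ := key u h
    rw [hw]
    refine hR' _ _ ?_
    rw [← add_assoc, ← sub_sub, map_sub, hmw]

end Operator

section Comparison

variable {n : ℕ} {q : Rn n → ℂ}

theorem isScalarSymbol_inv_add_norm (hqc : Continuous q) (hq1 : ∀ ξ, 1 ≤ ‖q ξ‖) {z : ℂ}
    (hz : 0 ≤ z.re) : IsScalarSymbol fun ξ ↦ (z + (‖q ξ‖ : ℂ))⁻¹ := by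
  refine ⟨(measurable_const.add (Complex.measurable_ofReal.comp hqc.norm.measurable)).inv, 1,
    fun ξ ↦ ?_⟩
  rw [norm_inv]
  exact inv_le_one_of_one_le₀
    ((hq1 ξ).trans (norm_add_le_of_re_nonneg hz (norm_nonneg (q ξ))).2)

/-- The resolvents of the multiplication with `-|q|`, which has its spectrum on the negative
half-line. -/
theorem isPseudoResolventOn_solMult (hqc : Continuous q) (hq1 : ∀ ξ, 1 ≤ ‖q ξ‖) :
    IsPseudoResolventOn (fun z ↦ (solMult fun ξ ↦ (z + (‖q ξ‖ : ℂ))⁻¹ : FM0sol n →L[ℂ] FM0sol n))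
      {z | 0 < z.re} := by
  have hne : ∀ z : ℂ, 0 ≤ z.re → ∀ ξ, z + (‖q ξ‖ : ℂ) ≠ 0 := fun z hz ξ ↦ by
    have := (norm_add_le_of_re_nonneg hz (norm_nonneg (q ξ))).2
    exact norm_pos_iff.1 (by linarith [hq1 ξ])
  refine ⟨isOpen_lt continuous_const Complex.continuous_re, by simp, fun z hz w hw ↦ ?_, 1,
    fun z hz ↦ ?_⟩
  · have hz' : 0 ≤ z.re := le_of_lt hz
    have hw' : 0 ≤ w.re := le_of_lt hw
    have sz := isScalarSymbol_inv_add_norm hqc hq1 hz'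
    have sw := isScalarSymbol_inv_add_norm hqc hq1 hw'
    rw [← solMult_sub sw sz, solMult_mul sw sz, ← solMult_const_mul (sw.mul sz)]
    congr 1
    ext ξ
    have h1 := hne z hz' ξ
    have h2 := hne w hw' ξ
    field_simp
    ring
  · have hz' : 0 ≤ z.re := le_of_lt hz
    have hz0 : 0 < ‖z‖ := norm_pos_iff.2 fun h0 ↦ by simp [h0] at hz
    have h1 : ‖(solMult fun ξ ↦ (z + (‖q ξ‖ : ℂ))⁻¹ : FM0sol n →L[ℂ] FM0sol n)‖ ≤ ‖z‖⁻¹ := by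
      refine norm_solMult_le (isScalarSymbol_inv_add_norm hqc hq1 hz').measurable (by positivity)
        fun ξ ↦ ?_
      rw [norm_inv]
      exact inv_anti₀ hz0 (norm_add_le_of_re_nonneg hz' (norm_nonneg (q ξ))).1
    calc _ ≤ ‖z‖ * ‖z‖⁻¹ := by gcongr
      _ = 1 := mul_inv_cancel₀ hz0.ne'

theorem norm_inv_sub_le (hq : ∀ ξ, |(q ξ).im| ≤ (q ξ).re) (hq1 : ∀ ξ, 1 ≤ ‖q ξ‖) {z : ℂ}
    (hz : z.re ≤ ‖z‖ / 4) (ξ : Rn n) :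
    0 < ‖z - q ξ‖ ∧ ‖(z - q ξ)⁻¹‖ ≤ 16 / (‖z‖ + ‖q ξ‖) := by
  have h0 := norm_add_norm_le_of_re_le hz (hq ξ)
  have h1 := hq1 ξ
  have h2 := norm_nonneg z
  have h3 : 0 < ‖z - q ξ‖ := by linarith
  refine ⟨h3, ?_⟩
  rw [norm_inv, inv_eq_one_div, div_le_div_iff₀ h3 (by linarith), one_mul]
  exact h0

/-- Each of the two terms decays like `|z|⁻¹` only; their difference decays like `|q| |z|⁻²`, which
is integrable, with an integral that does not depend on `|q|`. -/
theorem norm_inv_sub_inv_add_norm_le (hq : ∀ ξ, |(q ξ).im| ≤ (q ξ).re) (hq1 : ∀ ξ, 1 ≤ ‖q ξ‖)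
    {z : ℂ} (hz : z.re ≤ ‖z‖ / 4) (hz0 : 0 ≤ z.re) (ξ : Rn n) :
    ‖(z - q ξ)⁻¹ - (z + (‖q ξ‖ : ℂ))⁻¹‖ ≤ 64 * (‖q ξ‖ / (‖z‖ + ‖q ξ‖) ^ 2) := by
  have h4 := norm_add_norm_le_of_re_le hz (hq ξ)
  have p1 := (norm_inv_sub_le hq hq1 hz ξ).1
  have h5 := norm_add_le_of_re_nonneg hz0 (norm_nonneg (q ξ))
  have hs := hq1 ξ
  have p2 : 0 < ‖z + (‖q ξ‖ : ℂ)‖ := by linarith [h5.2]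
  have h2 := norm_nonneg z
  have h7 : ‖z‖ + ‖q ξ‖ ≤ 2 * ‖z + (‖q ξ‖ : ℂ)‖ := by linarith [h5.1, h5.2]
  have h6 : ‖z + (‖q ξ‖ : ℂ) - (z - q ξ)‖ ≤ 2 * ‖q ξ‖ := by
    rw [show z + (‖q ξ‖ : ℂ) - (z - q ξ) = (‖q ξ‖ : ℂ) + q ξ by ring]
    refine (norm_add_le _ _).trans ?_
    rw [Complex.norm_real, norm_norm]
    linarith
  rw [inv_sub_inv (norm_pos_iff.1 p1) (norm_pos_iff.1 p2), norm_div, norm_mul, ← mul_div_assoc,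
    div_le_div_iff₀ (by positivity) (by positivity)]
  calc ‖z + (‖q ξ‖ : ℂ) - (z - q ξ)‖ * (‖z‖ + ‖q ξ‖) ^ 2
      ≤ 2 * ‖q ξ‖ * ((16 * ‖z - q ξ‖) * (2 * ‖z + (‖q ξ‖ : ℂ)‖)) := by
        rw [sq]
        gcongr
    _ = 64 * ‖q ξ‖ * (‖z - q ξ‖ * ‖z + (‖q ξ‖ : ℂ)‖) := by ring

theorem isScalarSymbol_inv_sub (hqc : Continuous q) (hq : ∀ ξ, |(q ξ).im| ≤ (q ξ).re)
    (hq1 : ∀ ξ, 1 ≤ ‖q ξ‖) {z : ℂ} (hz : z.re ≤ ‖z‖ / 4) :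
    IsScalarSymbol fun ξ ↦ (z - q ξ)⁻¹ := by
  refine ⟨(measurable_const.sub hqc.measurable).inv, 16, fun ξ ↦
    (norm_inv_sub_le hq hq1 hz ξ).2.trans (div_le_self (by norm_num) ?_)⟩
  linarith [hq1 ξ, norm_nonneg z]

/-- In the total variation norm, the difference of the resolvents of the multiplications with `q`
and `-|q|` is integrable along rays: by Tonelli the integration over the ray can be carried out at
each frequency, where it gives a bound that does not depend on the frequency. -/
theorem lintegral_solMult_sub_le (hqc : Continuous q) (hq : ∀ ξ, |(q ξ).im| ≤ (q ξ).re)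
    (hq1 : ∀ ξ, 1 ≤ ‖q ξ‖) {u : ℂ} (hu : ‖u‖ = 1) (hu0 : 0 ≤ u.re) (hu4 : u.re ≤ 1 / 4)
    (x : FM0sol n) :
    ∫⁻ r in Ioi (0 : ℝ), ‖(solMult (fun ξ ↦ ((r : ℂ) * u - q ξ)⁻¹) -
      solMult (fun ξ ↦ ((r : ℂ) * u + (‖q ξ‖ : ℂ))⁻¹)) x‖ₑ ≤ ENNReal.ofReal (64 * ‖x‖) := by
  obtain ⟨g, hg⟩ := exists_hasDensity_self (x : FM n)
  set τ := (FM.hat n (x : FM n)).1.variation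
  have hpoint : ∀ r ∈ Ioi (0 : ℝ), ‖(solMult (fun ξ ↦ ((r : ℂ) * u - q ξ)⁻¹) -
      solMult (fun ξ ↦ ((r : ℂ) * u + (‖q ξ‖ : ℂ))⁻¹)) x‖ₑ ≤
      ∫⁻ ξ, ENNReal.ofReal (64 * (‖q ξ‖ / (r + ‖q ξ‖) ^ 2)) * ‖g ξ‖ₑ ∂τ := by
    intro r hr
    have hr : 0 < r := hr
    have h1 : ‖(r : ℂ) * u‖ = r := by
      rw [norm_mul, hu, mul_one, Complex.norm_real, Real.norm_of_nonneg hr.le]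
    have h2 : ((r : ℂ) * u).re ≤ ‖(r : ℂ) * u‖ / 4 := by
      rw [h1, Complex.re_ofReal_mul]
      nlinarith
    have h3 : 0 ≤ ((r : ℂ) * u).re := by
      rw [Complex.re_ofReal_mul]
      positivity
    have s1 := isScalarSymbol_inv_sub hqc hq hq1 h2
    have s2 := isScalarSymbol_inv_add_norm hqc hq1 h3
    have hsym : IsScalarSymbol
        fun ξ ↦ ((r : ℂ) * u - q ξ)⁻¹ - ((r : ℂ) * u + (‖q ξ‖ : ℂ))⁻¹ := by
      obtain ⟨C, hC⟩ := s1.bounded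
      obtain ⟨D, hD⟩ := s2.bounded
      exact ⟨s1.measurable.sub s2.measurable, C + D,
        fun ξ ↦ (norm_sub_le _ _).trans (add_le_add (hC ξ) (hD ξ))⟩
    rw [← solMult_sub s1 s2, enorm_solMult_apply hsym hg]
    refine lintegral_mono fun ξ ↦ ?_
    gcongr
    rw [← ofReal_norm]
    refine ENNReal.ofReal_le_ofReal ?_
    have := norm_inv_sub_inv_add_norm_le hq hq1 h2 h3 ξ
    rwa [h1] at this
  have hjoint : AEMeasurable (Function.uncurry fun (r : ℝ) (ξ : Rn n) ↦
      ENNReal.ofReal (64 * (‖q ξ‖ / (r + ‖q ξ‖) ^ 2)) * ‖g ξ‖ₑ)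
      ((volume.restrict (Ioi 0)).prod τ) := by
    have h1 : Measurable fun p : ℝ × Rn n ↦
        ENNReal.ofReal (64 * (‖q p.2‖ / (p.1 + ‖q p.2‖) ^ 2)) := by
      have := hqc.measurable
      fun_prop
    exact h1.aemeasurable.mul (hg.1.1.comp_snd.enorm)
  refine (setLIntegral_mono' measurableSet_Ioi hpoint).trans (le_of_eq ?_)
  calc ∫⁻ r in Ioi (0 : ℝ), ∫⁻ ξ, ENNReal.ofReal (64 * (‖q ξ‖ / (r + ‖q ξ‖) ^ 2)) * ‖g ξ‖ₑ ∂τ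
      = ∫⁻ ξ, (∫⁻ r in Ioi (0 : ℝ),
          ENNReal.ofReal (64 * (‖q ξ‖ / (r + ‖q ξ‖) ^ 2)) * ‖g ξ‖ₑ) ∂τ :=
        lintegral_lintegral_swap hjoint
    _ = ENNReal.ofReal 64 * ∫⁻ ξ, ‖g ξ‖ₑ ∂τ := by
        rw [← lintegral_const_mul' _ _ ENNReal.ofReal_ne_top]
        congr 1
        ext ξ
        have hs : 0 < ‖q ξ‖ := by linarith [hq1 ξ]
        simp only [ENNReal.ofReal_mul (show (0 : ℝ) ≤ 64 by norm_num), mul_assoc]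
        rw [lintegral_const_mul' _ _ ENNReal.ofReal_ne_top,
          lintegral_mul_const' _ _ enorm_ne_top, setLIntegral_scale hs, one_mul]
    _ = ENNReal.ofReal (64 * ‖x‖) := by
        have hx : ∫⁻ ξ, ‖g ξ‖ₑ ∂τ = ENNReal.ofReal ‖x‖ := by
          rw [← hg.enorm_eq, ← ofReal_norm]
          rfl
        rw [hx, ← ENNReal.ofReal_mul (by norm_num)]

end Comparison

end ActiveFluid

end

theorem proposition3p1 (n : ℕ) (hn : n = 2 ∨ n = 3) (lam0 Γ0 Γ2 : ℝ) (hΓ2 : 0 < Γ2)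
    (V : Rn n) (M : Matrix (Fin n) (Fin n) ℝ) (hM : M.IsSymm) :
    CompleteSpace (FM0sol n) ∧
    (∀ u : FM0sol n, u ∈ (ALF n lam0 Γ0 Γ2 V M).domain ↔ (u : FM n) ∈ FMk n 4) ∧
    ∃ ω : ℝ, 0 < ω ∧
      HasBoundedHInftyCalculus (shift (ω : ℂ) (ALF n lam0 Γ0 Γ2 V M)) ∧
      hInftyAngle (shift (ω : ℂ) (ALF n lam0 Γ0 Γ2 V M)) < Real.pi / 2 := by
  refine ⟨inferInstance, fun u ↦ mem_domain_ALF_iff, ?_⟩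
  let b : ℝ := ‖helmholtzMatMul M‖
  have hb0 : 0 ≤ b := norm_nonneg (helmholtzMatMul M)
  -- this size makes the perturbation `P M` at most half as large as the unperturbed operator
  obtain ⟨Λ, hΛ⟩ : ∃ Λ : ℝ, Λ = 32 * b + 1 := ⟨_, rfl⟩
  have hΛ1 : 1 ≤ Λ := by linarith
  obtain ⟨ω, hω, hqω⟩ := exists_shift_scalarSymbol lam0 Γ0 hΓ2 V Λ (by linarith)
  refine ⟨ω, hω, ?_⟩
  let q : Rn n → ℂ := fun ξ ↦ (ω : ℂ) + scalarSymbol lam0 Γ0 Γ2 V ξ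
  have hqc : Continuous q := continuous_const.add (continuous_scalarSymbol _ _ _ _)
  have hqre : ∀ ξ, (q ξ).re ≤ ‖q ξ‖ := fun ξ ↦ Complex.re_le_norm _
  have hq : ∀ ξ, |(q ξ).im| ≤ (q ξ).re := fun ξ ↦ (hqω ξ).1
  have hqΛ : ∀ ξ, Λ ≤ ‖q ξ‖ := fun ξ ↦ (hqω ξ).2.1.trans (hqre ξ)
  have hq1 : ∀ ξ, 1 ≤ ‖q ξ‖ := fun ξ ↦ hΛ1.trans (hqΛ ξ)
  have hdecay : ∀ z : ℂ, z.re ≤ ‖z‖ / 4 → HasDecay 4 fun ξ ↦ (z - q ξ)⁻¹ := by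
    intro z hz
    refine hasDecay_four_of_le (measurable_const.sub hqc.measurable).inv (C := 2 / Γ2 * 16)
      fun ξ ↦ ?_
    have h2 := norm_nonneg z
    have h3 : 0 < ‖z‖ + ‖q ξ‖ := by linarith [hqΛ ξ]
    calc (1 + ‖ξ‖ ^ 4) * ‖(z - q ξ)⁻¹‖
        ≤ (2 / Γ2 * (‖z‖ + ‖q ξ‖)) * (16 / (‖z‖ + ‖q ξ‖)) := by
          gcongr
          · refine (hqω ξ).2.2.trans ?_
            gcongr
            exact (hqre ξ).trans (by linarith)
          · exact (norm_inv_sub_le hq hq1 hz ξ).2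
      _ = 2 / Γ2 * 16 := by field_simp
  have hres : ∀ z : ℂ, z.re ≤ ‖z‖ / 4 → ∃ R : FM0sol n →L[ℂ] FM0sol n,
      IsResolventAt (shift (ω : ℂ) (ALF n lam0 Γ0 Γ2 V M)) z R ∧
      ‖R‖ ≤ 2 * (16 / (‖z‖ + Λ)) ∧
      ‖R - solMult fun ξ ↦ (z - q ξ)⁻¹‖ ≤ 2 * b * (16 / (‖z‖ + Λ)) ^ 2 := by
    intro z hz
    have h2 := norm_nonneg z
    have h3 : ‖(solMult fun ξ ↦ (z - q ξ)⁻¹ : FM0sol n →L[ℂ] FM0sol n)‖ ≤ 16 / (‖z‖ + Λ) := by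
      refine norm_solMult_le (measurable_const.sub hqc.measurable).inv (by positivity)
        fun ξ ↦ (norm_inv_sub_le hq hq1 hz ξ).2.trans ?_
      gcongr
      exact hqΛ ξ
    have h4 : 16 / (‖z‖ + Λ) * b ≤ 1 / 2 := by
      rw [div_mul_eq_mul_div, div_le_div_iff₀ (by linarith) (by norm_num)]
      linarith
    obtain ⟨R, h5, h6, h7, h8⟩ := exists_perturbed_resolvent h3 h4
    exact ⟨R, isResolventAt_shift_ALF (fun ξ ↦ norm_pos_iff.1 (norm_inv_sub_le hq hq1 hz ξ).1)
      (hdecay z hz) h5 h6, h7, h8⟩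
  refine hasBoundedHInftyCalculus_of_comparison (C := 32) (K := 512 * b + 64) ?_ (fun z hz ↦ ?_)
    (isPseudoResolventOn_solMult hqc hq1) (by positivity) fun u hu hu0 hu4 x ↦ ?_
  · have e : ((shift (ω : ℂ) (ALF n lam0 Γ0 Γ2 V M)).domain : Set (FM0sol n)) =
        {u : FM0sol n | (u : FM n) ∈ FMk n 4} := by
      ext u
      exact mem_domain_ALF_iff
    rw [e]
    exact dense_FMk
  · obtain ⟨R, h1, h3, -⟩ := hres z hz
    refine ⟨R, h1, ?_⟩
    have h2 := norm_nonneg z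
    have h4 : 0 < ‖z‖ + Λ := by linarith
    refine (mul_le_mul_of_nonneg_left h3 h2).trans ?_
    rw [← mul_assoc, mul_div_assoc', div_le_iff₀ h4]
    linarith
  · have hpoint : ∀ r ∈ Ioi (0 : ℝ),
        ‖(resolvent (shift (ω : ℂ) (ALF n lam0 Γ0 Γ2 V M)) (r * u) -
          solMult fun ξ ↦ ((r : ℂ) * u + (‖q ξ‖ : ℂ))⁻¹) x‖ₑ ≤
        ENNReal.ofReal (512 * b * ‖x‖) * ENNReal.ofReal (1 / (r + 1) ^ 2) +
        ‖(solMult (fun ξ ↦ ((r : ℂ) * u - q ξ)⁻¹) -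
          solMult fun ξ ↦ ((r : ℂ) * u + (‖q ξ‖ : ℂ))⁻¹) x‖ₑ := by
      intro r hr
      have hr : 0 < r := hr
      have h1 : ‖(r : ℂ) * u‖ = r := by
        rw [norm_mul, hu, mul_one, Complex.norm_real, Real.norm_of_nonneg hr.le]
      have h2 : ((r : ℂ) * u).re ≤ ‖(r : ℂ) * u‖ / 4 := by
        rw [h1, Complex.re_ofReal_mul]
        nlinarith
      obtain ⟨R, hRr, -, hRd⟩ := hres _ h2
      rw [hRr.resolvent_eq, ← sub_add_sub_cancel R (solMult fun ξ ↦ ((r : ℂ) * u - q ξ)⁻¹)]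
      refine (enorm_add_le _ _).trans (add_le_add ?_ le_rfl)
      rw [← ENNReal.ofReal_mul (by positivity), ← ofReal_norm]
      refine ENNReal.ofReal_le_ofReal ?_
      rw [h1] at hRd
      refine (ContinuousLinearMap.le_opNorm _ _).trans
        ((mul_le_mul_of_nonneg_right hRd (norm_nonneg x)).trans ?_)
      calc 2 * b * (16 / (r + Λ)) ^ 2 * ‖x‖ ≤ 2 * b * (16 / (r + 1)) ^ 2 * ‖x‖ := by gcongr
        _ = 512 * b * ‖x‖ * (1 / (r + 1) ^ 2) := by
            field_simp
            ring
    have hmeas : Measurable fun r : ℝ ↦ ENNReal.ofReal (1 / (r + 1) ^ 2) := by fun_prop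
    refine (setLIntegral_mono' measurableSet_Ioi hpoint).trans ?_
    rw [lintegral_add_left (hmeas.const_mul _), lintegral_const_mul _ hmeas,
      setLIntegral_scale one_pos, mul_one, add_mul, ENNReal.ofReal_add (by positivity)
      (by positivity)]
    gcongr
    exact lintegral_solMult_sub_le hqc hq hq1 hu hu0 hu4 x
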